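/- Let $N,k\ge 1$ be integers, let $\rho>1$ and suppose that $p=\frac{N+2k}{2}(\rho-1)>1$. Let $\Delta_{\mathcal G}=\frac12(\Delta_x+|x|^2\Delta_y)$ on $\mathbb R^{N+k}=\mathbb R^N_x\times\mathbb R^k_y$, let $$K(x,x_0,y;t)=\frac1{(2\pi)^{\frac{N+2k}{2}}}\int_{\mathbb R^k}\Big(\frac{|\xi|}{\sinh(|\xi|t)}\Big)^{\frac N2}e^{\,i\xi\cdot y-\frac{|\xi|}{2}\left((|x|^2+|x_0|^2)\coth(|\xi|t)-2x\cdot x_0\,\mathrm{csch}(|\xi|t)\right)}\,d\xi\qquad(t>0)$$ be its heat kernel, and let $S_{\mathcal G}(0)=I$ and $S_{\mathcal G}(t)\varphi(x,y)=\int_{\mathbb R^{N+k}}K(x,w,y-z;t)\varphi(w,z)\,d(w,z)$ for $t>0$. A global $L^p$-mild solution of $u_t=\Delta_{\mathcal G}u+|u|^{\rho-1}u$, $u(0)=u_0$, is a continuous function $u:[0,\infty)\to L^p(\mathbb R^{N+k})$ (real-valued $L^p$) such that for all $t\ge0$ $$u(t)=S_{\mathcal G}(t)u_0+\int_0^tS_{\mathcal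 G}(t-s)\,|u(s)|^{\rho-1}u(s)\,ds ,$$ where $S_{\mathcal G}(t-s)|u(s)|^{\rho-1}u(s)$ is well defined and belongs to $L^p$ for $0<s<t$, and the integral is a Bochner integral in $L^p$. Let $r\in(p,\rho p)$ and $\alpha=\frac{N+2k}{2}\left(\frac1p-\frac1r\right)$. Then there is $\delta>0$, depending only on $N,k,\rho,r$, such that for every $u_0\in L^p(\mathbb R^{N+k})$ with $\|u_0\|_{L^p}\le\delta$ there exists a global $L^p$-mild solution $u\in X_\alpha\cap E$. Here $u\in E$ means that $u\in C([0,\infty);L^p(\mathbb R^{N+k}))$ and $\sup_{t\ge0}\|u(t)\|_{L^p}<\infty$, and $u\in X_\alpha$ means that $u\in C((0,\infty);L^r(\mathbb R^{N+k}))$ and $\sup_{t>0}t^\alpha\|u(t)\|_{L^r}<\infty$. -/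

import Mathlib

open MeasureTheory Filter Topology Set
open scoped ENNReal

namespace Grushin

/-- The space `ℝ^N × ℝ^k` of points `(x, y)`, with Lebesgue measure `volume`. -/
abbrev Pt (N k : ℕ) : Type := EuclideanSpace ℝ (Fin N) × EuclideanSpace ℝ (Fin k)

/-- The integrand, in the frequency variable `ξ ∈ ℝ^k`, of the heat kernel. -/
noncomputable def kernelIntegrand {N k : ℕ} (x x₀ : EuclideanSpace ℝ (Fin N))
    (y : EuclideanSpace ℝ (Fin k)) (t : ℝ) (ξ : EuclideanSpace ℝ (Fin k)) : ℂ :=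
  (((‖ξ‖ / Real.sinh (‖ξ‖ * t)) ^ ((N : ℝ) / 2) : ℝ) : ℂ) *
    Complex.exp (Complex.I * ((inner ℝ ξ y : ℝ) : ℂ) -
      ((‖ξ‖ / 2 * ((‖x‖ ^ 2 + ‖x₀‖ ^ 2) * (Real.cosh (‖ξ‖ * t) / Real.sinh (‖ξ‖ * t)) -
        2 * inner ℝ x x₀ * (1 / Real.sinh (‖ξ‖ * t))) : ℝ) : ℂ))

/-- The Fourier integral defining the heat kernel. -/
noncomputable def kernelComplex {N k : ℕ} (x x₀ : EuclideanSpace ℝ (Fin N))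
    (y : EuclideanSpace ℝ (Fin k)) (t : ℝ) : ℂ :=
  ((1 / (2 * Real.pi) ^ (((N : ℝ) + 2 * k) / 2) : ℝ) : ℂ) * ∫ ξ, kernelIntegrand x x₀ y t ξ

/-- The Fourier integral is real, by the symmetry `ξ ↦ -ξ`. -/
theorem kernelComplex_im {N k : ℕ} (x x₀ : EuclideanSpace ℝ (Fin N))
    (y : EuclideanSpace ℝ (Fin k)) (t : ℝ) : (kernelComplex x x₀ y t).im = 0 := by
  have h : ∀ ξ, kernelIntegrand x x₀ y t (-ξ) =
      (starRingEnd ℂ) (kernelIntegrand x x₀ y t ξ) := by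
    intro ξ
    simp only [kernelIntegrand, map_mul, Complex.conj_ofReal, ← Complex.exp_conj, map_sub,
      Complex.conj_I, norm_neg, inner_neg_left, Complex.ofReal_neg, mul_neg, neg_mul]
  have h2 : (starRingEnd ℂ) (∫ ξ, kernelIntegrand x x₀ y t ξ) =
      ∫ ξ, kernelIntegrand x x₀ y t ξ := by
    rw [← integral_conj, ← integral_neg_eq_self (kernelIntegrand x x₀ y t) volume]
    exact integral_congr_ae (Eventually.of_forall fun ξ => (h ξ).symm)
  rw [kernelComplex, Complex.im_ofReal_mul, Complex.conj_eq_iff_im.mp h2, mul_zero]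

/-- The heat kernel `K(x, x₀, y; t)`, for `t > 0`, of the Grushin operator
`(1/2) (Δ_x + |x|² Δ_y)`; the Fourier integral is real (`kernelComplex_im`). -/
noncomputable def kernel {N k : ℕ} (x x₀ : EuclideanSpace ℝ (Fin N))
    (y : EuclideanSpace ℝ (Fin k)) (t : ℝ) : ℝ :=
  (kernelComplex x x₀ y t).re

/-- The Grushin heat semigroup `S(t)`:
`S(t) φ (x, y) = ∫ K(x, w, y - z; t) φ(w, z) d(w, z)` for `t > 0`, and `S(0)` is the identity. -/
noncomputable def semigroup {N k : ℕ} (t : ℝ) (φ : Pt N k → ℝ) : Pt N k → ℝ :=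
  if t = 0 then φ else fun a => ∫ b : Pt N k, kernel a.1 b.1 (a.2 - b.2) t * φ b

/-- `g = S(t) φ` almost everywhere, including the assertion that the integral defining
`S(t) φ` converges absolutely almost everywhere. -/
def IsSemigroupImage {N k : ℕ} (t : ℝ) (φ g : Pt N k → ℝ) : Prop :=
  (0 < t → ∀ᵐ a : Pt N k,
    Integrable (fun b : Pt N k => kernel a.1 b.1 (a.2 - b.2) t * φ b)) ∧
  g =ᵐ[volume] semigroup t φ

/-- `u : [0, ∞) → L^p` is a global `L^p`-mild solution of
`u_t = Δ_G u + |u|^{ρ-1} u`, `u(0) = u₀`: it is continuous and, for every `t ≥ 0`,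
`u(t) = S(t) u₀ + ∫_0^t S(t-s) (|u(s)|^{ρ-1} u(s)) ds`, the integral being a (convergent)
Bochner integral in `L^p`; here `G = S(t) u₀` and `F s = S(t-s) (|u(s)|^{ρ-1} u(s))`.
Only the values of `u` on `[0, ∞)` matter. -/
structure IsGlobalMildSolution {N k : ℕ} (p : ℝ≥0∞) [Fact (1 ≤ p)] (ρ : ℝ)
    (u₀ : Lp ℝ p (volume : Measure (Pt N k)))
    (u : ℝ → Lp ℝ p (volume : Measure (Pt N k))) : Prop where
  continuousOn : ContinuousOn u (Ici 0)
  duhamel : ∀ t : ℝ, 0 ≤ t →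
    ∃ (G : Lp ℝ p (volume : Measure (Pt N k)))
      (F : ℝ → Lp ℝ p (volume : Measure (Pt N k))),
      IsSemigroupImage t u₀ G ∧
      (∀ s ∈ Ioo 0 t, IsSemigroupImage (t - s) (fun a => |u s a| ^ (ρ - 1) * u s a) (F s)) ∧
      IntegrableOn F (Ioo 0 t) ∧
      u t = G + ∫ s in Ioo 0 t, F s

/-- The space `E = C([0, ∞); L^p)`, with finite norm `sup_{t ≥ 0} ‖u(t)‖_{L^p}`. -/
def spaceE (N k : ℕ) (p : ℝ≥0∞) [Fact (1 ≤ p)] :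
    Set (ℝ → Lp ℝ p (volume : Measure (Pt N k))) :=
  {u | ContinuousOn u (Ici 0) ∧ ∃ M : ℝ, ∀ t : ℝ, 0 ≤ t → ‖u t‖ ≤ M}

/-- The space `X_α` with `T = ∞`: `u` is continuous from `(0, ∞)` to `L^r` and
`sup_{t > 0} t^α ‖u(t)‖_{L^r} < ∞`. -/
def spaceX (N k : ℕ) (p r : ℝ≥0∞) (α : ℝ) :
    Set (ℝ → Lp ℝ p (volume : Measure (Pt N k))) :=
  {u | (∀ t : ℝ, 0 < t → MemLp (u t) r volume) ∧
    (∀ t : ℝ, 0 < t →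
      Tendsto (fun s : ℝ => eLpNorm (fun a => u s a - u t a) r volume) (𝓝 t) (𝓝 0)) ∧
    ∃ M : ℝ, ∀ t : ℝ, 0 < t → t ^ α * (eLpNorm (u t) r volume).toReal ≤ M}

end Grushin

/-! Write d = (N+2k)/2. The nonlinear problem needs only the properties of the kernel collected in
`IsHeatKernel`: it is nonnegative, symmetric, of mass one, bounded by C t^{-d}, continuous in time,
and an approximate identity. Jensen's inequality for the probability measures κ(t,a,·)dμ and the sup
bound then give ‖S(t)‖_{L^q→L^s} ≤ (C t^{-d})^{1/q-1/s}. Strong continuity follows from Scheffé's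
argument on continuous compactly supported functions and from density.

Positivity is the delicate property, since the kernel is an oscillatory integral. Half-angle
formulas turn its Fourier transform in y (`symbol`) into a product of a power of u/sinh u and
exponentials of -u coth u and -u tanh u. Euler's product and the partial fractions of the cotangent
make each factor a limit of products of functions (1+c|ξ|²)^{-a} and exp(-a c|ξ|²/(1+c|ξ|²)). These
are mixtures of Gaussians and exponentials of such mixtures, hence positive definite. Positive
definiteness is encoded in `IsPosMultiplier`: multiplication preserves nonnegativity of the cosine
transform, a class visibly closed under sums, products, mixtures and bounded limits
(`isPosMultiplier_symbol`, `kernel_nonneg`). The mass is read off at frequency ξ = 0, where the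
symbol is a Euclidean heat kernel up to a constant. The approximate identity follows from one
Gaussian test function and a Korovkin-type estimate (`tendsto_integral_kernel_mul`).

The solution is a fixed point in the weighted norm. Put v(t) = t^α u(t). The power map is locally
Lipschitz from L^r to L^{r/ρ}. After the substitution s = tσ, the Duhamel term for v becomes an
integral over (0,1) of uniformly bounded operators against σ^{-αρ}(1-σ)^{-p/r}. No power of t
remains because p = d(ρ-1), and the weight is integrable because p < r < ρp. Small data make this
map a contraction on a ball of bounded continuous L^r-valued functions (`exists_duhamel_solution`).
The same integrand, read in L^p, carries the weight σ^{-γ}(1-σ)^{-(1-γ)} with γ = αρ, so u is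
bounded and continuous in L^p (`exists_global_solution`).

The argument needs r/ρ ≥ 1. It is therefore run with max(r, ρ) in place of r, and the given r is
recovered by interpolation with L^p (`mem_spaceX`). -/

namespace Grushin

/-! ### Positive definite functions, as multipliers on nonnegative cosine transforms. -/

section PositiveMultipliers

variable {V : Type*} [NormedAddCommGroup V] [InnerProductSpace ℝ V] [FiniteDimensional ℝ V]
  [MeasurableSpace V] [BorelSpace V]

/-- Integrable functions with a nonnegative cosine transform. -/
structure CosNonneg (g : V → ℝ) : Prop where
  integrable : Integrable g
  nonneg : ∀ y, 0 ≤ ∫ ξ, Real.cos (inner ℝ ξ y) * g ξ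

theorem CosNonneg.integrable_cos_mul {g : V → ℝ} (hg : Integrable g) (y : V) :
    Integrable fun ξ => Real.cos (inner ℝ ξ y) * g ξ := by
  refine hg.bdd_mul (c := 1) ?_ (Eventually.of_forall fun ξ => ?_)
  · exact Continuous.aestronglyMeasurable (by fun_prop)
  · simpa using Real.abs_cos_le_one _

/-- Bounded measurable functions which preserve, by multiplication, the class of integrable
functions with a nonnegative cosine transform. -/
structure IsPosMultiplier (f : V → ℝ) : Prop where
  measurable : Measurable f
  bdd : ∃ C, ∀ ξ, |f ξ| ≤ C
  mul_mem : ∀ g, CosNonneg g → CosNonneg (fun ξ => f ξ * g ξ)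

theorem integrable_bdd_mul {f g : V → ℝ} (hf : Measurable f) {C : ℝ} (hC : ∀ ξ, |f ξ| ≤ C)
    (hg : Integrable g) : Integrable fun ξ => f ξ * g ξ :=
  hg.bdd_mul (c := C) hf.aestronglyMeasurable (Eventually.of_forall fun ξ => by simpa using hC ξ)

namespace IsPosMultiplier

theorem const {c : ℝ} (hc : 0 ≤ c) : IsPosMultiplier (fun _ : V => c) where
  measurable := measurable_const
  bdd := ⟨|c|, fun _ => le_rfl⟩
  mul_mem g hg := by
    refine ⟨hg.integrable.const_mul c, fun y => ?_⟩
    simp_rw [mul_left_comm _ c]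
    rw [integral_const_mul]
    exact mul_nonneg hc (hg.nonneg y)

theorem mul {f₁ f₂ : V → ℝ} (h₁ : IsPosMultiplier f₁) (h₂ : IsPosMultiplier f₂) :
    IsPosMultiplier (fun ξ => f₁ ξ * f₂ ξ) where
  measurable := h₁.measurable.mul h₂.measurable
  bdd := by
    obtain ⟨C₁, hC₁⟩ := h₁.bdd
    obtain ⟨C₂, hC₂⟩ := h₂.bdd
    refine ⟨C₁ * C₂, fun ξ => ?_⟩
    rw [abs_mul]
    exact mul_le_mul (hC₁ ξ) (hC₂ ξ) (abs_nonneg _) ((abs_nonneg _).trans (hC₁ ξ))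
  mul_mem g hg := by
    simpa only [mul_assoc] using h₁.mul_mem _ (h₂.mul_mem g hg)

theorem add {f₁ f₂ : V → ℝ} (h₁ : IsPosMultiplier f₁) (h₂ : IsPosMultiplier f₂) :
    IsPosMultiplier (fun ξ => f₁ ξ + f₂ ξ) where
  measurable := h₁.measurable.add h₂.measurable
  bdd := by
    obtain ⟨C₁, hC₁⟩ := h₁.bdd
    obtain ⟨C₂, hC₂⟩ := h₂.bdd
    exact ⟨C₁ + C₂, fun ξ => (abs_add_le _ _).trans (add_le_add (hC₁ ξ) (hC₂ ξ))⟩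
  mul_mem g hg := by
    have i₁ := h₁.mul_mem g hg
    have i₂ := h₂.mul_mem g hg
    simp_rw [add_mul]
    refine ⟨i₁.integrable.add i₂.integrable, fun y => ?_⟩
    simp_rw [mul_add]
    rw [integral_add (CosNonneg.integrable_cos_mul i₁.integrable y)
      (CosNonneg.integrable_cos_mul i₂.integrable y)]
    exact add_nonneg (i₁.nonneg y) (i₂.nonneg y)

theorem pow {f : V → ℝ} (h : IsPosMultiplier f) (n : ℕ) :
    IsPosMultiplier (fun ξ => f ξ ^ n) := by
  induction n with
  | zero => simpa using const (V := V) zero_le_one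
  | succ n ih => simpa only [pow_succ] using ih.mul h

theorem prod {ι : Type*} (s : Finset ι) {f : ι → V → ℝ} (h : ∀ i ∈ s, IsPosMultiplier (f i)) :
    IsPosMultiplier (fun ξ => ∏ i ∈ s, f i ξ) := by
  classical
  induction s using Finset.induction_on with
  | empty => simpa using const (V := V) zero_le_one
  | insert i s hi ih =>
    simp_rw [Finset.prod_insert hi]
    exact (h i (Finset.mem_insert_self _ _)).mul
      (ih fun j hj => h j (Finset.mem_insert_of_mem hj))

/-- Dominated convergence, with majorant C|g|, passes the nonnegative cosine integrals to the limit.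
The bound must be uniform in n. -/
theorem of_tendsto {F : ℕ → V → ℝ} {f : V → ℝ} {C : ℝ} (hF : ∀ n, IsPosMultiplier (F n))
    (hC : ∀ n ξ, |F n ξ| ≤ C) (hlim : ∀ ξ, Tendsto (fun n => F n ξ) atTop (𝓝 (f ξ))) :
    IsPosMultiplier f := by
  have hm : Measurable f := measurable_of_tendsto_metrizable (fun n => (hF n).measurable)
    (tendsto_pi_nhds.2 hlim)
  have hb : ∀ ξ, |f ξ| ≤ C := fun ξ =>
    le_of_tendsto (hlim ξ).abs (Eventually.of_forall fun n => hC n ξ)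
  refine ⟨hm, ⟨C, hb⟩, fun g hg => ⟨integrable_bdd_mul hm hb hg.integrable, fun y => ?_⟩⟩
  have ht : Tendsto (fun n => ∫ ξ, Real.cos (inner ℝ ξ y) * (F n ξ * g ξ)) atTop
      (𝓝 (∫ ξ, Real.cos (inner ℝ ξ y) * (f ξ * g ξ))) := by
    refine tendsto_integral_of_dominated_convergence (fun ξ => C * |g ξ|)
      (fun n => (CosNonneg.integrable_cos_mul
        ((hF n).mul_mem g hg).integrable y).aestronglyMeasurable)
      (hg.integrable.abs.const_mul C) (fun n => Eventually.of_forall fun ξ => ?_)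
      (Eventually.of_forall fun ξ => ((hlim ξ).mul_const _).const_mul _)
    rw [Real.norm_eq_abs, abs_mul, abs_mul]
    have h1 := Real.abs_cos_le_one (inner ℝ ξ y)
    have h2 : |F n ξ| * |g ξ| ≤ C * |g ξ| := mul_le_mul_of_nonneg_right (hC n ξ) (abs_nonneg _)
    nlinarith [abs_nonneg (F n ξ), abs_nonneg (g ξ), mul_nonneg (abs_nonneg (F n ξ)) (abs_nonneg (g ξ))]
  exact ge_of_tendsto' ht fun n => ((hF n).mul_mem g hg).nonneg y

/-- By the product formula for cosines, multiplying by cos⟨ξ,v⟩ averages the cosine transform over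
its translates y + v and y - v. -/
theorem cos_inner (v : V) : IsPosMultiplier (fun ξ : V => Real.cos (inner ℝ ξ v)) where
  measurable := Continuous.measurable (by fun_prop)
  bdd := ⟨1, fun _ => Real.abs_cos_le_one _⟩
  mul_mem g hg := by
    refine ⟨CosNonneg.integrable_cos_mul hg.integrable v, fun y => ?_⟩
    have : ∀ ξ : V, Real.cos (inner ℝ ξ y) * (Real.cos (inner ℝ ξ v) * g ξ) =
        (1 / 2) * (Real.cos (inner ℝ ξ (y + v)) * g ξ + Real.cos (inner ℝ ξ (y - v)) * g ξ) := by
      intro ξ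
      rw [inner_add_right, inner_sub_right, Real.cos_add, Real.cos_sub]
      ring
    simp_rw [this]
    rw [integral_const_mul, integral_add (CosNonneg.integrable_cos_mul hg.integrable _)
      (CosNonneg.integrable_cos_mul hg.integrable _)]
    have := hg.nonneg (y + v)
    have := hg.nonneg (y - v)
    positivity

/-- Fubini: the cosine transform of the mixture times g is the ν-integral of the transforms of F s ·
g. The majorant h(s)|g(ξ)| makes the double integral absolutely convergent. -/
theorem mixture {S : Type*} [MeasurableSpace S] {ν : Measure S} [SFinite ν] {F : S → V → ℝ}
    {h : S → ℝ} (hh : Integrable h ν) (hm : Measurable (Function.uncurry F))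
    (hF : ∀ᵐ s ∂ν, IsPosMultiplier (F s)) (hb : ∀ᵐ s ∂ν, ∀ ξ, |F s ξ| ≤ h s) :
    IsPosMultiplier (fun ξ => ∫ s, F s ξ ∂ν) := by
  have hm' : Measurable (fun ξ => ∫ s, F s ξ ∂ν) :=
    ((hm.comp measurable_swap).stronglyMeasurable.integral_prod_right' (ν := ν)).measurable
  have hb' : ∀ ξ, |∫ s, F s ξ ∂ν| ≤ ∫ s, h s ∂ν := fun ξ => by
    rw [← Real.norm_eq_abs]
    refine norm_integral_le_of_norm_le hh ?_
    filter_upwards [hb] with s hs using hs ξ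
  refine ⟨hm', ⟨_, hb'⟩, fun g hg => ⟨integrable_bdd_mul hm' hb' hg.integrable, fun y => ?_⟩⟩
  have hint : Integrable (Function.uncurry fun (ξ : V) (s : S) =>
      Real.cos (inner ℝ ξ y) * (F s ξ * g ξ)) (volume.prod ν) := by
    refine (hg.integrable.abs.mul_prod hh).mono' ?_ ?_
    · refine AEStronglyMeasurable.mul (f := fun z : V × S => Real.cos (inner ℝ z.1 y))
        (Continuous.aestronglyMeasurable (f := fun ξ : V => Real.cos (inner ℝ ξ y))
          (by fun_prop)).comp_fst ?_
      exact (hm.comp measurable_swap).aestronglyMeasurable.mul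
        hg.integrable.aestronglyMeasurable.comp_fst
    · have := (Measure.quasiMeasurePreserving_snd (μ := (volume : Measure V)) (ν := ν)).ae hb
      filter_upwards [this] with z hz
      simp only [Function.uncurry, Real.norm_eq_abs, abs_mul]
      have h1 := Real.abs_cos_le_one (inner ℝ z.1 y)
      have h2 := mul_le_mul_of_nonneg_right (hz z.1) (abs_nonneg (g z.1))
      nlinarith [mul_nonneg (abs_nonneg (F z.2 z.1)) (abs_nonneg (g z.1))]
  have : ∀ ξ, Real.cos (inner ℝ ξ y) * ((∫ s, F s ξ ∂ν) * g ξ) =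
      ∫ s, Real.cos (inner ℝ ξ y) * (F s ξ * g ξ) ∂ν := fun ξ => by
    rw [integral_const_mul, integral_mul_const]
  simp_rw [this]
  rw [integral_integral_swap hint]
  refine integral_nonneg_of_ae ?_
  filter_upwards [hF] with s hs using (hs.mul_mem g hg).nonneg y

/-- exp f is the limit of (1 + f/n)^n, built from sums and products, with the uniform bound e^C
whenever |f| ≤ C. -/
theorem exp_comp {f : V → ℝ} (hf : IsPosMultiplier f) :
    IsPosMultiplier (fun ξ => Real.exp (f ξ)) := by
  obtain ⟨C, hC⟩ := hf.bdd
  refine of_tendsto (F := fun n ξ => (1 + f ξ / n) ^ n) (C := Real.exp C) (fun n => ?_)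
    (fun n ξ => ?_) (fun ξ => Real.tendsto_one_add_div_pow_exp (f ξ))
  · refine ((const zero_le_one).add ?_).pow n
    simpa only [div_eq_mul_inv] using hf.mul (const (inv_nonneg.2 (Nat.cast_nonneg n)))
  · rw [abs_pow]
    rcases Nat.eq_zero_or_pos n with rfl | hn
    · simpa using (abs_nonneg _).trans (hC ξ)
    · have hn' : (0 : ℝ) < n := Nat.cast_pos.2 hn
      have h1 : |1 + f ξ / n| ≤ Real.exp (C / n) := by
        calc |1 + f ξ / n| ≤ |1| + |f ξ / n| := abs_add_le _ _
          _ = |f ξ| / n + 1 := by rw [abs_one, abs_div, abs_of_pos hn', add_comm]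
          _ ≤ C / n + 1 := by gcongr; exact hC ξ
          _ ≤ _ := Real.add_one_le_exp _
      calc |1 + f ξ / n| ^ n ≤ Real.exp (C / n) ^ n := by gcongr
        _ = Real.exp C := by rw [← Real.exp_nat_mul]; congr 1; field_simp

end IsPosMultiplier

theorem integral_gaussian_mul_cos {b : ℝ} (hb : 0 < b) (w : V) :
    ∫ v : V, Real.exp (-b * ‖v‖ ^ 2) * Real.cos (inner ℝ v w) =
      (Real.pi / b) ^ (Module.finrank ℝ V / 2 : ℝ) * Real.exp (-‖w‖ ^ 2 / (4 * b)) := by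
  have hb' : 0 < (b : ℂ).re := by simpa using hb
  have h := GaussianFourier.integral_cexp_neg_mul_sq_norm_add hb' Complex.I w
  have hi := GaussianFourier.integrable_cexp_neg_mul_sq_norm_add hb' Complex.I w
  have h2 := congrArg Complex.re h
  have h3 := integral_re hi
  simp only [RCLike.re_to_complex] at h3
  rw [← h3] at h2
  have h4 : ∀ v : V, (Complex.exp (-(b : ℂ) * (‖v‖ : ℂ) ^ 2 +
      Complex.I * ((inner ℝ w v : ℝ) : ℂ))).re =
      Real.exp (-b * ‖v‖ ^ 2) * Real.cos (inner ℝ v w) := by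
    intro v
    rw [Complex.exp_add, mul_comm Complex.I, Complex.exp_mul_I]
    rw [real_inner_comm]
    have : Complex.exp (-(b : ℂ) * (‖v‖ : ℂ) ^ 2) = ((Real.exp (-b * ‖v‖ ^ 2) : ℝ) : ℂ) := by
      push_cast; rfl
    rw [this, Complex.re_ofReal_mul]
    congr 1
    rw [← Complex.ofReal_cos, ← Complex.ofReal_sin, Complex.add_re, Complex.re_ofReal_mul,
      Complex.ofReal_re, Complex.I_re, mul_zero, add_zero]
  simp_rw [h4] at h2
  rw [h2]
  have h5 : ((Real.pi : ℂ) / (b : ℂ)) ^ ((Module.finrank ℝ V : ℂ) / 2) *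
      Complex.exp (Complex.I ^ 2 * (‖w‖ : ℂ) ^ 2 / (4 * (b : ℂ))) =
      (((Real.pi / b) ^ (Module.finrank ℝ V / 2 : ℝ) * Real.exp (-‖w‖ ^ 2 / (4 * b)) : ℝ) : ℂ) := by
    push_cast
    rw [Complex.ofReal_cpow (by positivity)]
    push_cast
    simp [Complex.I_sq]
  rw [h5, Complex.ofReal_re]

theorem integrable_gaussian {b : ℝ} (hb : 0 < b) :
    Integrable fun v : V => Real.exp (-b * ‖v‖ ^ 2) := by
  have h := (GaussianFourier.integrable_cexp_neg_mul_sq_norm_add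
    (b := (b : ℂ)) (by simpa using hb) 0 (0 : V)).re
  refine h.congr (Eventually.of_forall fun v => ?_)
  have : Complex.exp (-(b : ℂ) * (‖v‖ : ℂ) ^ 2) = ((Real.exp (-b * ‖v‖ ^ 2) : ℝ) : ℂ) := by
    push_cast; rfl
  simp only [zero_mul, add_zero, this, RCLike.re_to_complex, Complex.ofReal_re]

theorem cosNonneg_gaussian {b : ℝ} (hb : 0 < b) :
    CosNonneg fun v : V => Real.exp (-b * ‖v‖ ^ 2) := by
  refine ⟨integrable_gaussian hb, fun y => ?_⟩
  simp_rw [mul_comm (Real.cos _)]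
  rw [integral_gaussian_mul_cos hb]
  positivity

namespace IsPosMultiplier

/-- A Gaussian is, up to a positive constant, the Fourier transform of a Gaussian, hence a mixture
of the functions cos⟨ξ,v⟩. -/
theorem gaussian {s : ℝ} (hs : 0 ≤ s) :
    IsPosMultiplier fun ξ : V => Real.exp (-s * ‖ξ‖ ^ 2) := by
  rcases hs.eq_or_lt with rfl | hs
  · simpa using const (V := V) zero_le_one
  -- The width b = 1/(4s) is the one for which |ξ|²/(4b) = s|ξ|².
  · have hb : 0 < 1 / (4 * s) := by positivity
    have h := mixture (V := V) (ν := (volume : Measure V))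
      (F := fun v ξ => Real.exp (-(1 / (4 * s)) * ‖v‖ ^ 2) * Real.cos (inner ℝ ξ v))
      (h := fun v => Real.exp (-(1 / (4 * s)) * ‖v‖ ^ 2)) (integrable_gaussian hb)
      (Continuous.measurable (by unfold Function.uncurry; fun_prop))
      (Eventually.of_forall fun v => (const (Real.exp_nonneg _)).mul (cos_inner v))
      (Eventually.of_forall fun v ξ => by
        rw [abs_mul, abs_of_pos (Real.exp_pos _)]
        exact mul_le_of_le_one_right (Real.exp_nonneg _) (Real.abs_cos_le_one _))
    have h2 := (const (V := V) (c := ((Real.pi / (1 / (4 * s))) ^ (Module.finrank ℝ V / 2 : ℝ))⁻¹)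
      (by positivity)).mul h
    convert h2 using 2 with ξ
    have hcomm : ∀ v : V, inner ℝ ξ v = inner ℝ v ξ := fun v => real_inner_comm _ _
    simp_rw [hcomm]
    rw [integral_gaussian_mul_cos hb, inv_mul_cancel_left₀ (by positivity)]
    congr 1
    field_simp

/-- The Gamma integral Γ(a) X^{-a} = ∫ s^{a-1} e^{-Xs} ds with X = 1 + c|ξ|² exhibits the function
as a mixture of Gaussians. -/
theorem one_add_sq_rpow {a c : ℝ} (ha : 0 < a) (hc : 0 ≤ c) :
    IsPosMultiplier fun ξ : V => (1 / (1 + c * ‖ξ‖ ^ 2)) ^ a := by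
  have hint : IntegrableOn (fun s : ℝ => s ^ (a - 1) * Real.exp (-s)) (Ioi 0) := by
    simpa only [mul_comm] using Real.GammaIntegral_convergent ha
  have h := mixture (V := V) (ν := volume.restrict (Ioi (0 : ℝ)))
    (F := fun s ξ => s ^ (a - 1) * Real.exp (-((1 + c * ‖ξ‖ ^ 2) * s)))
    (h := fun s => s ^ (a - 1) * Real.exp (-s)) hint
    (by unfold Function.uncurry; fun_prop)
    ((ae_restrict_iff' measurableSet_Ioi).2 (Eventually.of_forall fun s hs => by
      have hs' : (0 : ℝ) < s := hs
      have := (const (V := V) (c := s ^ (a - 1) * Real.exp (-s)) (by positivity)).mul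
        (gaussian (s := c * s) (by positivity))
      convert this using 2 with ξ
      rw [mul_assoc, ← Real.exp_add]
      ring_nf))
    ((ae_restrict_iff' measurableSet_Ioi).2 (Eventually.of_forall fun s hs ξ => by
      have hs' : (0 : ℝ) < s := hs
      rw [abs_of_nonneg (by positivity)]
      have : 0 ≤ c * ‖ξ‖ ^ 2 * s := by positivity
      gcongr
      linarith))
  have h2 := (const (V := V) (c := (Real.Gamma a)⁻¹)
      (inv_nonneg.2 (Real.Gamma_pos_of_pos ha).le)).mul h
  convert h2 using 2 with ξ
  have hpos : 0 < 1 + c * ‖ξ‖ ^ 2 := by positivity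
  rw [Real.integral_rpow_mul_exp_neg_mul_Ioi ha hpos, mul_comm (_ ^ a),
    inv_mul_cancel_left₀ (Real.Gamma_pos_of_pos ha).ne']

/-- Since X/(1+X) = 1 - 1/(1+X), the function is e^{-a} times the exponential of a/(1 + c|ξ|²). -/
theorem exp_neg_div {a c : ℝ} (ha : 0 ≤ a) (hc : 0 ≤ c) :
    IsPosMultiplier fun ξ : V => Real.exp (-(a * (c * ‖ξ‖ ^ 2 / (1 + c * ‖ξ‖ ^ 2)))) := by
  have h := (const (V := V) (Real.exp_nonneg (-a))).mul
    ((const (V := V) ha).mul (one_add_sq_rpow (V := V) one_pos hc)).exp_comp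
  convert h using 2 with ξ
  have hpos : 0 < 1 + c * ‖ξ‖ ^ 2 := by positivity
  rw [← Real.exp_add, Real.rpow_one]
  congr 1
  field_simp
  ring

end IsPosMultiplier

end PositiveMultipliers

/-! ### The functions `u / sinh u` and `u coth u` -/

/-- The continuous extension of `u / sinh u`. -/
noncomputable def sinhRatio (u : ℝ) : ℝ := (dslope Real.sinh 0 u)⁻¹

/-- The continuous extension of `u coth u`. -/
noncomputable def mulCoth (u : ℝ) : ℝ := Real.cosh u * sinhRatio u

theorem sinhRatio_of_ne {u : ℝ} (hu : u ≠ 0) : sinhRatio u = u / Real.sinh u := by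
  rw [sinhRatio, dslope_of_ne _ hu, slope_def_field]
  simp

@[simp] theorem sinhRatio_zero : sinhRatio 0 = 1 := by
  simp [sinhRatio]

theorem mulCoth_of_ne {u : ℝ} (hu : u ≠ 0) : mulCoth u = u * Real.cosh u / Real.sinh u := by
  rw [mulCoth, sinhRatio_of_ne hu]
  ring

@[simp] theorem mulCoth_zero : mulCoth 0 = 1 := by
  simp [mulCoth]

theorem sinhRatio_pos (u : ℝ) : 0 < sinhRatio u := by
  rcases eq_or_ne u 0 with rfl | hu
  · simp
  · rw [sinhRatio_of_ne hu]
    rcases hu.lt_or_gt with h | h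
    · exact div_pos_of_neg_of_neg h (Real.sinh_neg_iff.2 h)
    · exact div_pos h (Real.sinh_pos_iff.2 h)

theorem continuous_sinhRatio : Continuous sinhRatio := by
  have h : Continuous (dslope Real.sinh 0) := by
    rw [continuous_iff_continuousAt]
    intro u
    rcases eq_or_ne u 0 with rfl | hu
    · exact continuousAt_dslope_same.2 Real.differentiable_sinh.differentiableAt
    · exact (continuousAt_dslope_of_ne hu).2 Real.continuous_sinh.continuousAt
  refine h.inv₀ fun u hu => ?_
  have := sinhRatio_pos u
  simp [sinhRatio, hu] at this

theorem continuous_mulCoth : Continuous mulCoth :=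
  Real.continuous_cosh.mul continuous_sinhRatio

theorem sinhRatio_le_one {u : ℝ} (hu : 0 ≤ u) : sinhRatio u ≤ 1 := by
  rcases hu.eq_or_lt with rfl | hu
  · simp
  · rw [sinhRatio_of_ne hu.ne', div_le_one (Real.sinh_pos_iff.2 hu)]
    exact Real.self_le_sinh_iff.2 hu.le

/-- Write sinh u = 2 sinh(u/2) cosh(u/2): the first factor absorbs the numerator u, and the second
gives exponential decay at half the true rate. -/
theorem sinhRatio_le_exp {u : ℝ} (hu : 0 ≤ u) : sinhRatio u ≤ 2 * Real.exp (-(u / 2)) := by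
  rcases hu.eq_or_lt with rfl | hu
  · norm_num
  · rw [sinhRatio_of_ne hu.ne', div_le_iff₀ (Real.sinh_pos_iff.2 hu)]
    have h1 : Real.sinh u = 2 * Real.sinh (u / 2) * Real.cosh (u / 2) := by
      rw [← Real.sinh_two_mul]
      ring_nf
    have h2 : u / 2 ≤ Real.sinh (u / 2) := Real.self_le_sinh_iff.2 (by positivity)
    have h3 : Real.exp (u / 2) / 2 ≤ Real.cosh (u / 2) := by
      rw [Real.cosh_eq]
      have := Real.exp_pos (-(u / 2))
      linarith
    have h4 : Real.exp (-(u / 2)) * Real.exp (u / 2) = 1 := by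
      rw [← Real.exp_add]
      simp
    calc u = 2 * Real.exp (-(u / 2)) * (2 * (u / 2) * (Real.exp (u / 2) / 2)) := by
          linear_combination (-u) * h4
      _ ≤ 2 * Real.exp (-(u / 2)) * (2 * Real.sinh (u / 2) * Real.cosh (u / 2)) := by gcongr
      _ = _ := by rw [h1]

/-- The coefficients of the partial fraction expansions. -/
noncomputable def poleCoeff (j : ℕ) : ℝ := 1 / (Real.pi * (j + 1)) ^ 2

theorem poleCoeff_nonneg (j : ℕ) : 0 ≤ poleCoeff j := by
  unfold poleCoeff
  positivity

/-- Doubling the argument of coth brings every second term of its expansion onto a term of the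
original one; this is the cancellation behind the expansion of u tanh u. -/
theorem four_mul_poleCoeff (i : ℕ) : 4 * poleCoeff (2 * i + 1) = poleCoeff i := by
  unfold poleCoeff
  have := Real.pi_pos
  push_cast
  field_simp
  ring

/-- Euler's product for sin(πx)/(πx) at the imaginary point x = iu/π, inverted. -/
theorem tendsto_prod_sinhRatio (u : ℝ) :
    Tendsto (fun n => ∏ j ∈ Finset.range n, 1 / (1 + poleCoeff j * u ^ 2)) atTop
      (𝓝 (sinhRatio u)) := by
  rcases eq_or_ne u 0 with rfl | hu
  · simp
  have hpi : (Real.pi : ℂ) ≠ 0 := Complex.ofReal_ne_zero.2 Real.pi_ne_zero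
  have hu' : (u : ℂ) ≠ 0 := Complex.ofReal_ne_zero.2 hu
  have hx : (Complex.I * u / Real.pi : ℂ) ≠ 0 :=
    div_ne_zero (mul_ne_zero Complex.I_ne_zero hu') hpi
  have h := tendsto_euler_sin_prod' hx
  have e1 : (Real.pi : ℂ) * (Complex.I * u / Real.pi) = u * Complex.I := by field_simp
  have e2 : Complex.sin ((Real.pi : ℂ) * (Complex.I * u / Real.pi)) /
      ((Real.pi : ℂ) * (Complex.I * u / Real.pi)) = ((Real.sinh u / u : ℝ) : ℂ) := by
    rw [e1, Complex.sin_mul_I, mul_div_mul_right _ _ Complex.I_ne_zero]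
    push_cast
    rfl
  have e3 : ∀ j : ℕ, 1 + sineTerm (Complex.I * u / Real.pi) j =
      ((1 + poleCoeff j * u ^ 2 : ℝ) : ℂ) := by
    intro j
    have : ((j : ℂ) + 1) ≠ 0 := Nat.cast_add_one_ne_zero j
    simp only [sineTerm, poleCoeff]
    push_cast
    field_simp
    simp [Complex.I_sq]
  simp_rw [e2, e3, ← Complex.ofReal_prod] at h
  have h' := (Complex.continuous_re.tendsto _).comp h
  simp only [Function.comp_def, Complex.ofReal_re] at h'
  have hne : Real.sinh u / u ≠ 0 := div_ne_zero (Real.sinh_ne_zero.2 hu) hu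
  have h'' := h'.inv₀ hne
  rw [sinhRatio_of_ne hu]
  simpa [Finset.prod_inv_distrib] using h''

/-- The partial fraction expansion of π cot(πx) - 1/x at x = iu/π, multiplied by x. -/
theorem tendsto_sum_mulCoth (u : ℝ) :
    Tendsto (fun n => ∑ j ∈ Finset.range n,
      2 * (poleCoeff j * u ^ 2 / (1 + poleCoeff j * u ^ 2))) atTop (𝓝 (mulCoth u - 1)) := by
  rcases eq_or_ne u 0 with rfl | hu
  · simp
  have hpi : (Real.pi : ℂ) ≠ 0 := Complex.ofReal_ne_zero.2 Real.pi_ne_zero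
  have hu' : (u : ℂ) ≠ 0 := Complex.ofReal_ne_zero.2 hu
  have hsinh : (Real.sinh u : ℂ) ≠ 0 := Complex.ofReal_ne_zero.2 (Real.sinh_ne_zero.2 hu)
  have hx : (Complex.I * u / Real.pi : ℂ) ∈ Complex.integerComplement := by
    rintro ⟨n, hn⟩
    have := congrArg Complex.im hn
    rw [show (Complex.I * u / Real.pi : ℂ) = ((u / Real.pi : ℝ) : ℂ) * Complex.I by
      push_cast; ring] at this
    rw [Complex.intCast_im, Complex.mul_I_im, Complex.ofReal_re] at this
    exact div_ne_zero hu Real.pi_ne_zero this.symm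
  have h := (tendsto_logDeriv_euler_cot_sub hx).mul_const (Complex.I * u / Real.pi : ℂ)
  have e1 : (Real.pi : ℂ) * (Complex.I * u / Real.pi) = u * Complex.I := by field_simp
  have e2 : ((Real.pi : ℂ) * Complex.cot (Real.pi * (Complex.I * u / Real.pi)) -
      1 / (Complex.I * u / Real.pi)) * (Complex.I * u / Real.pi) =
      ((mulCoth u - 1 : ℝ) : ℂ) := by
    rw [e1, Complex.cot, Complex.cos_mul_I, Complex.sin_mul_I, mulCoth_of_ne hu]
    push_cast at hsinh ⊢
    field_simp
  have e3 : ∀ j : ℕ, cotTerm (Complex.I * u / Real.pi) j * (Complex.I * u / Real.pi) =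
      ((2 * (poleCoeff j * u ^ 2 / (1 + poleCoeff j * u ^ 2)) : ℝ) : ℂ) := by
    intro j
    have hj : ((j : ℂ) + 1) ≠ 0 := Nat.cast_add_one_ne_zero j
    rw [cotTerm_identity hx]
    have hd : (Complex.I * u / Real.pi + ((j : ℂ) + 1)) * (Complex.I * u / Real.pi - (j + 1)) =
        -(((j : ℂ) + 1) ^ 2 * ((1 + poleCoeff j * u ^ 2 : ℝ) : ℂ)) := by
      simp only [poleCoeff]
      push_cast
      field_simp
      ring_nf
      simp [Complex.I_sq]
    have hne : ((1 + poleCoeff j * u ^ 2 : ℝ) : ℂ) ≠ 0 := by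
      have := poleCoeff_nonneg j
      exact Complex.ofReal_ne_zero.2 (by positivity)
    rw [hd, Complex.ofReal_mul, Complex.ofReal_div, div_eq_mul_one_div (Complex.ofReal _)]
    have hnum : ((poleCoeff j * u ^ 2 : ℝ) : ℂ) = u ^ 2 / (Real.pi * (j + 1)) ^ 2 := by
      simp only [poleCoeff]
      push_cast
      ring
    rw [hnum]
    generalize ((1 + poleCoeff j * u ^ 2 : ℝ) : ℂ) = D at hne
    field_simp
    simp [Complex.I_sq]
  simp_rw [Finset.sum_mul, e2, e3, ← Complex.ofReal_sum] at h
  simpa only [Function.comp_def, Complex.ofReal_re] using (Complex.continuous_re.tendsto _).comp h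

/-- From u tanh u = 2u coth 2u - u coth u: among the first 2n terms of the expansion at 2u, those of
odd index cancel the first n terms of the expansion at u. -/
theorem tendsto_sum_mul_tanh (u : ℝ) :
    Tendsto (fun n => ∑ i ∈ Finset.range n,
      2 * (4 * poleCoeff (2 * i) * u ^ 2 / (1 + 4 * poleCoeff (2 * i) * u ^ 2))) atTop
      (𝓝 (u * Real.tanh u)) := by
  have h2 := (tendsto_sum_mulCoth (2 * u)).comp
    (tendsto_id.const_mul_atTop' (show 0 < 2 by norm_num))
  have h := h2.sub (tendsto_sum_mulCoth u)
  have e : mulCoth (2 * u) - 1 - (mulCoth u - 1) = u * Real.tanh u := by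
    rcases eq_or_ne u 0 with rfl | hu
    · simp
    have hs := Real.sinh_ne_zero.2 hu
    have hc := (Real.cosh_pos u).ne'
    rw [mulCoth_of_ne hu, mulCoth_of_ne (by simpa using hu), Real.sinh_two_mul, Real.cosh_two_mul,
      Real.tanh_eq_sinh_div_cosh]
    field_simp
    ring
  rw [e] at h
  refine h.congr fun n => ?_
  simp only [Function.comp_def, id]
  induction n with
  | zero => simp
  | succ n ih =>
    rw [Finset.sum_range_succ _ n, Finset.sum_range_succ _ n, mul_add, mul_one,
      Finset.sum_range_succ, Finset.sum_range_succ, ← ih, ← four_mul_poleCoeff n]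
    ring

theorem one_le_mulCoth (u : ℝ) : 1 ≤ mulCoth u := by
  refine sub_nonneg.1 (ge_of_tendsto' (tendsto_sum_mulCoth u) fun n => ?_)
  refine Finset.sum_nonneg fun j _ => ?_
  have := poleCoeff_nonneg j
  positivity

theorem mul_tanh_nonneg (u : ℝ) : 0 ≤ u * Real.tanh u := by
  refine ge_of_tendsto' (tendsto_sum_mul_tanh u) fun n => ?_
  refine Finset.sum_nonneg fun j _ => ?_
  have := poleCoeff_nonneg (2 * j)
  positivity

namespace IsPosMultiplier

variable {V : Type*} [NormedAddCommGroup V] [InnerProductSpace ℝ V] [FiniteDimensional ℝ V]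
  [MeasurableSpace V] [BorelSpace V]

/-- The exponential of a partial sum is a finite product of the multipliers of `exp_neg_div`. All
these products are at most 1, so the limit is again a multiplier. -/
theorem exp_neg_of_tendsto_sum {a s : ℝ} (ha : 0 ≤ a) {c : ℕ → ℝ} (hc : ∀ j, 0 ≤ c j)
    {f : ℝ → ℝ} (hf : ∀ u, Tendsto (fun n => ∑ j ∈ Finset.range n,
      2 * (c j * u ^ 2 / (1 + c j * u ^ 2))) atTop (𝓝 (f u))) :
    IsPosMultiplier fun ξ : V => Real.exp (-(a * f (‖ξ‖ * s))) := by
  refine of_tendsto (C := 1) (F := fun n ξ => Real.exp (-(a * ∑ j ∈ Finset.range n,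
    2 * (c j * (‖ξ‖ * s) ^ 2 / (1 + c j * (‖ξ‖ * s) ^ 2))))) (fun n => ?_) (fun n ξ => ?_)
    (fun ξ => ?_)
  · have := prod (V := V) (Finset.range n) fun j _ =>
      exp_neg_div (V := V) (a := 2 * a) (c := c j * s ^ 2) (by positivity)
        (mul_nonneg (hc j) (sq_nonneg s))
    convert this using 2 with ξ
    rw [← Real.exp_sum, Finset.sum_neg_distrib, Finset.mul_sum]
    congr 2
    refine Finset.sum_congr rfl fun j _ => ?_
    ring_nf
  · rw [Real.abs_exp, Real.exp_le_one_iff, neg_nonpos]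
    refine mul_nonneg ha (Finset.sum_nonneg fun j _ => ?_)
    have := hc j
    positivity
  · exact (Real.continuous_exp.tendsto _).comp (((hf _).const_mul a).neg)

theorem exp_neg_mulCoth {a : ℝ} (ha : 0 ≤ a) (s : ℝ) :
    IsPosMultiplier fun ξ : V => Real.exp (-(a * mulCoth (‖ξ‖ * s))) := by
  have h := (const (V := V) (Real.exp_nonneg (-a))).mul
    (exp_neg_of_tendsto_sum (V := V) (s := s) ha poleCoeff_nonneg tendsto_sum_mulCoth)
  convert h using 2 with ξ
  rw [← Real.exp_add]
  ring_nf

theorem exp_neg_mul_tanh {a : ℝ} (ha : 0 ≤ a) (s : ℝ) :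
    IsPosMultiplier fun ξ : V => Real.exp (-(a * (‖ξ‖ * s * Real.tanh (‖ξ‖ * s)))) :=
  exp_neg_of_tendsto_sum (V := V) (f := fun u => u * Real.tanh u) ha
    (fun j => mul_nonneg (by norm_num) (poleCoeff_nonneg (2 * j))) tendsto_sum_mul_tanh

/-- Partial Euler products, raised to the power a, are finite products of the multipliers of
`one_add_sq_rpow` and are bounded by 1. Real powers are covered, as needed for the exponent N/2. -/
theorem sinhRatio_rpow {a : ℝ} (ha : 0 < a) (s : ℝ) :
    IsPosMultiplier fun ξ : V => sinhRatio (‖ξ‖ * s) ^ a := by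
  have hpos : ∀ (j : ℕ) (u : ℝ), 1 ≤ 1 + poleCoeff j * u ^ 2 := fun j u => by
    have := poleCoeff_nonneg j
    nlinarith [sq_nonneg u, mul_nonneg this (sq_nonneg u)]
  refine of_tendsto (C := 1) (F := fun n ξ =>
    (∏ j ∈ Finset.range n, 1 / (1 + poleCoeff j * (‖ξ‖ * s) ^ 2)) ^ a) (fun n => ?_)
    (fun n ξ => ?_) (fun ξ => (tendsto_prod_sinhRatio _).rpow_const (Or.inr ha.le))
  · have := prod (V := V) (Finset.range n) fun j _ =>
      one_add_sq_rpow (V := V) (c := poleCoeff j * s ^ 2) ha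
        (mul_nonneg (poleCoeff_nonneg j) (sq_nonneg s))
    convert this using 2 with ξ
    rw [← Real.finsetProd_rpow _ _ fun j _ => ?_]
    · refine Finset.prod_congr rfl fun j _ => ?_
      ring_nf
    · exact div_nonneg zero_le_one (zero_le_one.trans (hpos _ _))
  · have h0 : 0 ≤ ∏ j ∈ Finset.range n, 1 / (1 + poleCoeff j * (‖ξ‖ * s) ^ 2) :=
      Finset.prod_nonneg fun j _ => div_nonneg zero_le_one (zero_le_one.trans (hpos _ _))
    rw [abs_of_nonneg (Real.rpow_nonneg h0 _)]
    refine Real.rpow_le_one h0 (Finset.prod_le_one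
      (fun j _ => div_nonneg zero_le_one (zero_le_one.trans (hpos _ _))) fun j _ => ?_) ha.le
    rw [div_le_one (zero_lt_one.trans_le (hpos _ _))]
    exact hpos _ _

end IsPosMultiplier

/-- The inequality x^n/n! ≤ e^x at x = c(1+‖v‖) compares the exponential with (1+‖v‖)^{-n}, which is
integrable for n = dim V + 1. -/
theorem integrable_exp_neg_mul_norm {V : Type*} [NormedAddCommGroup V] [NormedSpace ℝ V]
    [FiniteDimensional ℝ V] [MeasurableSpace V] [BorelSpace V] (μ : Measure V)
    [μ.IsAddHaarMeasure] {c : ℝ} (hc : 0 < c) :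
    Integrable (fun v : V => Real.exp (-(c * ‖v‖))) μ := by
  set n := Module.finrank ℝ V + 1 with hn
  have h := integrable_one_add_norm (E := V) (μ := μ) (r := n) (by simp [hn])
  refine (h.const_mul (Real.exp c * (n.factorial / c ^ n))).mono'
    (Continuous.aestronglyMeasurable (by fun_prop)) (Eventually.of_forall fun v => ?_)
  have hv : 0 < 1 + ‖v‖ := by positivity
  have h1 := Real.pow_div_factorial_le_exp (c * (1 + ‖v‖)) (by positivity) n
  have hfac : (0 : ℝ) < n.factorial := by positivity
  rw [Real.norm_eq_abs, Real.abs_exp, Real.rpow_neg hv.le, Real.rpow_natCast]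
  have h2 : Real.exp (-(c * ‖v‖)) = Real.exp c * (Real.exp (c * (1 + ‖v‖)))⁻¹ := by
    rw [← Real.exp_neg, ← Real.exp_add]
    ring_nf
  rw [h2, mul_assoc]
  refine mul_le_mul_of_nonneg_left ?_ (Real.exp_nonneg _)
  refine (inv_anti₀ (by positivity) h1).trans (le_of_eq ?_)
  rw [mul_pow, inv_div]
  field_simp

/-! ### The partial Fourier transform of the heat kernel. -/

section Symbol

variable {N : ℕ}

/-- The partial Fourier transform of the heat kernel at a frequency of modulus `z`, up to the
factor `(2π)^{-N/2}`. -/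
noncomputable def symbol (t : ℝ) (x w : EuclideanSpace ℝ (Fin N)) (z : ℝ) : ℝ :=
  (1 / t) ^ ((N : ℝ) / 2) * sinhRatio (z * t) ^ ((N : ℝ) / 2) *
    Real.exp (-(1 / (2 * t) * (‖x - w‖ ^ 2 * mulCoth (z * (t / 2)) +
      ‖x + w‖ ^ 2 * (z * (t / 2) * Real.tanh (z * (t / 2))))))

variable {t : ℝ} (x w : EuclideanSpace ℝ (Fin N)) (z : ℝ)

theorem symbol_nonneg (ht : 0 < t) : 0 ≤ symbol t x w z := by
  have := sinhRatio_pos (z * t)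
  unfold symbol
  positivity

theorem symbol_comm : symbol t x w z = symbol t w x z := by
  rw [symbol, symbol, norm_sub_rev, add_comm x w]

theorem symbol_zero : symbol t x w 0 =
    (1 / t) ^ ((N : ℝ) / 2) * Real.exp (-(1 / (2 * t) * ‖x - w‖ ^ 2)) := by
  simp [symbol]

theorem exponent_le (ht : 0 < t) :
    Real.exp (-(1 / (2 * t) * (‖x - w‖ ^ 2 * mulCoth (z * (t / 2)) +
      ‖x + w‖ ^ 2 * (z * (t / 2) * Real.tanh (z * (t / 2)))))) ≤
    Real.exp (-(1 / (2 * t) * ‖x - w‖ ^ 2)) := by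
  have h1 := one_le_mulCoth (z * (t / 2))
  have h2 := mul_tanh_nonneg (z * (t / 2))
  rw [Real.exp_le_exp, neg_le_neg_iff]
  gcongr
  nlinarith [mul_nonneg (sq_nonneg ‖x + w‖) h2, sq_nonneg ‖x - w‖]

/-- The right-hand side is the value at frequency zero, so the symbol is largest there; this
dominates the limits in which the frequency tends to zero. -/
theorem symbol_le_gaussian (ht : 0 < t) {z : ℝ} (hz : 0 ≤ z) : symbol t x w z ≤
    (1 / t) ^ ((N : ℝ) / 2) * Real.exp (-(1 / (2 * t) * ‖x - w‖ ^ 2)) := by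
  have h0 := sinhRatio_pos (z * t)
  have h1 : sinhRatio (z * t) ^ ((N : ℝ) / 2) ≤ 1 :=
    Real.rpow_le_one h0.le (sinhRatio_le_one (by positivity)) (by positivity)
  unfold symbol
  refine mul_le_mul ?_ (exponent_le x w z ht) (Real.exp_nonneg _) (by positivity)
  exact mul_le_of_le_one_right (by positivity) h1

/-- Decay in frequency, uniform in x and w. It gives integrability in ξ and, by scaling, the
on-diagonal bound C t^{-d}. -/
theorem symbol_le_exp (ht : 0 < t) {z : ℝ} (hz : 0 ≤ z) : symbol t x w z ≤
    (2 / t) ^ ((N : ℝ) / 2) * Real.exp (-(N / 4 * t * z)) := by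
  have h0 := sinhRatio_pos (z * t)
  have h1 : sinhRatio (z * t) ^ ((N : ℝ) / 2) ≤
      2 ^ ((N : ℝ) / 2) * Real.exp (-(N / 4 * t * z)) := by
    calc sinhRatio (z * t) ^ ((N : ℝ) / 2) ≤ (2 * Real.exp (-(z * t / 2))) ^ ((N : ℝ) / 2) := by
          gcongr
          exact sinhRatio_le_exp (by positivity)
      _ = _ := by
          rw [Real.mul_rpow (by norm_num) (Real.exp_nonneg _), ← Real.exp_mul]
          ring_nf
  have h2 : Real.exp (-(1 / (2 * t) * ‖x - w‖ ^ 2)) ≤ 1 := by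
    rw [Real.exp_le_one_iff, neg_nonpos]
    positivity
  calc symbol t x w z ≤ (1 / t) ^ ((N : ℝ) / 2) *
        (2 ^ ((N : ℝ) / 2) * Real.exp (-(N / 4 * t * z))) * 1 := by
        unfold symbol
        gcongr
        exact (exponent_le x w z ht).trans h2
    _ = _ := by
        rw [mul_one, ← mul_assoc, ← Real.mul_rpow (by positivity) (by norm_num)]
        ring_nf

theorem continuous_tanh : Continuous Real.tanh := by
  have : Real.tanh = fun u => Real.sinh u / Real.cosh u := funext Real.tanh_eq_sinh_div_cosh
  rw [this]
  exact Real.continuous_sinh.div Real.continuous_cosh fun u => (Real.cosh_pos u).ne'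

theorem ContinuousAt.symbol {X : Type*} [TopologicalSpace X] {t : X → ℝ}
    {x w : X → EuclideanSpace ℝ (Fin N)} {z : X → ℝ} {q : X} (ht : ContinuousAt t q)
    (hx : ContinuousAt x q) (hw : ContinuousAt w q) (hz : ContinuousAt z q) (h0 : 0 < t q) :
    ContinuousAt (fun q => symbol (t q) (x q) (w q) (z q)) q := by
  have h1 : ContinuousAt (fun q => sinhRatio (z q * t q)) q :=
    continuous_sinhRatio.continuousAt.comp (hz.mul ht)
  have h2 : ContinuousAt (fun q => mulCoth (z q * (t q / 2))) q :=
    continuous_mulCoth.continuousAt.comp (hz.mul (ht.div_const 2))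
  have h3 : ContinuousAt (fun q => Real.tanh (z q * (t q / 2))) q :=
    continuous_tanh.continuousAt.comp (hz.mul (ht.div_const 2))
  have h4 : ContinuousAt (fun q => (1 / t q) ^ ((N : ℝ) / 2)) q :=
    (continuousAt_const.div ht h0.ne').rpow_const (Or.inl (one_div_pos.2 h0).ne')
  have h5 : ContinuousAt (fun q => 1 / (2 * t q)) q :=
    continuousAt_const.div (continuousAt_const.mul ht) (mul_pos two_pos h0).ne'
  unfold Grushin.symbol
  refine (h4.mul (h1.rpow_const (Or.inl (sinhRatio_pos _).ne'))).mul
    (Real.continuous_exp.continuousAt.comp (h5.mul ?_).neg)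
  exact (((hx.sub hw).norm.pow 2).mul h2).add
    (((hx.add hw).norm.pow 2).mul ((hz.mul (ht.div_const 2)).mul h3))

theorem isPosMultiplier_symbol {V : Type*} [NormedAddCommGroup V] [InnerProductSpace ℝ V]
    [FiniteDimensional ℝ V] [MeasurableSpace V] [BorelSpace V] (hN : 1 ≤ N) (ht : 0 < t) :
    IsPosMultiplier fun ξ : V => symbol t x w ‖ξ‖ := by
  have hN' : (0 : ℝ) < N := by exact_mod_cast hN
  have h := ((IsPosMultiplier.const (V := V) (c := (1 / t) ^ ((N : ℝ) / 2)) (by positivity)).mul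
    (IsPosMultiplier.sinhRatio_rpow (V := V) (a := (N : ℝ) / 2) (by positivity) t)).mul
    ((IsPosMultiplier.exp_neg_mulCoth (V := V) (a := 1 / (2 * t) * ‖x - w‖ ^ 2)
      (by positivity) (t / 2)).mul
    (IsPosMultiplier.exp_neg_mul_tanh (V := V) (a := 1 / (2 * t) * ‖x + w‖ ^ 2)
      (by positivity) (t / 2)))
  convert h using 2 with ξ
  rw [symbol, ← Real.exp_add]
  ring_nf

end Symbol

/-! ### Positivity, symmetry, bounds and regularity of the Grushin kernel. -/

section Kernel

variable {N k : ℕ}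

local notation "𝕏" => EuclideanSpace ℝ (Fin N)
local notation "𝕐" => EuclideanSpace ℝ (Fin k)

/-- The normalizing constant of the heat kernel. -/
noncomputable def kernelConst (N k : ℕ) : ℝ := 1 / (2 * Real.pi) ^ (((N : ℝ) + 2 * k) / 2)

theorem kernelConst_pos (N k : ℕ) : 0 < kernelConst N k := by
  unfold kernelConst
  positivity

/-- With v = |ξ|t/2, the relations coth v ± tanh v = 2 coth 2v, 2 csch 2v give (|x|²+|w|²) coth 2v -
2x·w csch 2v = ½(|x-w|² coth v + |x+w|² tanh v). Both terms are nonnegative, unlike those on the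
left. At ξ = 0 the integrand contains a division by sinh 0, while the symbol uses the continuous
extension. -/
theorem kernelIntegrand_eq (x w : 𝕏) (y : 𝕐) {t : ℝ} (ht : 0 < t) {ξ : 𝕐} (hξ : ξ ≠ 0) :
    kernelIntegrand x w y t ξ =
      (symbol t x w ‖ξ‖ : ℂ) * Complex.exp (Complex.I * ((inner ℝ ξ y : ℝ) : ℂ)) := by
  have hn : 0 < ‖ξ‖ := norm_pos_iff.2 hξ
  have hu : 0 < ‖ξ‖ * (t / 2) := by positivity
  have h1 : ‖ξ‖ / Real.sinh (‖ξ‖ * t) = 1 / t * sinhRatio (‖ξ‖ * t) := by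
    rw [sinhRatio_of_ne (by positivity)]
    field_simp
  have h2 : ‖ξ‖ / 2 * ((‖x‖ ^ 2 + ‖w‖ ^ 2) * (Real.cosh (‖ξ‖ * t) / Real.sinh (‖ξ‖ * t)) -
        2 * inner ℝ x w * (1 / Real.sinh (‖ξ‖ * t))) =
      1 / (2 * t) * (‖x - w‖ ^ 2 * mulCoth (‖ξ‖ * (t / 2)) +
      ‖x + w‖ ^ 2 * (‖ξ‖ * (t / 2) * Real.tanh (‖ξ‖ * (t / 2)))) := by
    have hs := Real.sinh_ne_zero.2 hu.ne'
    have hc := (Real.cosh_pos (‖ξ‖ * (t / 2))).ne'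
    have e : ‖ξ‖ * t = 2 * (‖ξ‖ * (t / 2)) := by ring
    rw [e, Real.sinh_two_mul, Real.cosh_two_mul, mulCoth_of_ne hu.ne',
      Real.tanh_eq_sinh_div_cosh, norm_sub_sq_real, norm_add_sq_real]
    have hsq := Real.cosh_sq (‖ξ‖ * (t / 2))
    generalize Real.sinh (‖ξ‖ * (t / 2)) = S at *
    generalize Real.cosh (‖ξ‖ * (t / 2)) = C at *
    field_simp
    rw [hsq]
    ring
  rw [kernelIntegrand, h1, h2, Real.mul_rpow (by positivity) (sinhRatio_pos _).le, symbol,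
    Complex.exp_sub, Complex.ofReal_mul _ (Real.exp _), Complex.ofReal_exp, Complex.ofReal_neg,
    Complex.exp_neg]
  ring

variable (x w : EuclideanSpace ℝ (Fin N))

theorem integrable_symbol (hN : 1 ≤ N) {t : ℝ} (ht : 0 < t) :
    Integrable fun ξ : 𝕐 => symbol t x w ‖ξ‖ := by
  have hN' : (0 : ℝ) < N := by exact_mod_cast hN
  refine ((integrable_exp_neg_mul_norm (V := 𝕐) volume (c := N / 4 * t) (by positivity)).const_mul
    ((2 / t) ^ ((N : ℝ) / 2))).mono' (isPosMultiplier_symbol x w hN ht).measurable.aestronglyMeasurable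
    (Eventually.of_forall fun ξ => ?_)
  rw [Real.norm_eq_abs, abs_of_nonneg (symbol_nonneg _ _ _ ht)]
  exact symbol_le_exp x w ht (norm_nonneg _)

theorem kernel_eq (hN : 1 ≤ N) (hk : 1 ≤ k) (y : 𝕐) {t : ℝ} (ht : 0 < t) :
    kernel x w y t = kernelConst N k * ∫ ξ : 𝕐, Real.cos (inner ℝ ξ y) * symbol t x w ‖ξ‖ := by
  -- Since k ≥ 1, the exceptional frequency ξ = 0 is a null set.
  have : Nonempty (Fin k) := ⟨⟨0, hk⟩⟩
  have hae : kernelIntegrand x w y t =ᵐ[volume] fun ξ : 𝕐 =>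
      (symbol t x w ‖ξ‖ : ℂ) * Complex.exp (Complex.I * ((inner ℝ ξ y : ℝ) : ℂ)) := by
    filter_upwards [compl_mem_ae_iff.2 (measure_singleton (0 : 𝕐))] with ξ hξ
    exact kernelIntegrand_eq x w y ht (by simpa using hξ)
  have hint : Integrable fun ξ : 𝕐 =>
      (symbol t x w ‖ξ‖ : ℂ) * Complex.exp (Complex.I * ((inner ℝ ξ y : ℝ) : ℂ)) := by
    refine (integrable_symbol x w hN ht).ofReal.mul_bdd (c := 1)
      (Continuous.aestronglyMeasurable (by fun_prop)) (Eventually.of_forall fun ξ => ?_)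
    rw [mul_comm, Complex.norm_exp_ofReal_mul_I]
  have hre := integral_re hint
  simp only [RCLike.re_to_complex] at hre
  rw [kernel, kernelComplex, integral_congr_ae hae, Complex.re_ofReal_mul, ← hre, kernelConst]
  congr 1
  refine integral_congr_ae (Eventually.of_forall fun ξ => ?_)
  simp only [Complex.re_ofReal_mul]
  rw [mul_comm Complex.I, Complex.exp_ofReal_mul_I_re, mul_comm]

/-- The constant 1 is not integrable, so the multiplier property of the symbol is applied to the
Gaussians exp(-|ξ|²/(n+1)), whose cosine transforms are positive. Letting n → ∞ removes the
Gaussian. -/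
theorem kernel_nonneg (hN : 1 ≤ N) (hk : 1 ≤ k) (y : 𝕐) {t : ℝ} (ht : 0 < t) :
    0 ≤ kernel x w y t := by
  rw [kernel_eq x w hN hk y ht]
  refine mul_nonneg (kernelConst_pos N k).le ?_
  have hs := isPosMultiplier_symbol (V := 𝕐) x w hN ht
  have hi := integrable_symbol (k := k) x w hN ht
  have hlim : Tendsto (fun n : ℕ => ∫ ξ : 𝕐, Real.cos (inner ℝ ξ y) *
      (symbol t x w ‖ξ‖ * Real.exp (-(1 / ((n : ℝ) + 1)) * ‖ξ‖ ^ 2))) atTop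
      (𝓝 (∫ ξ : 𝕐, Real.cos (inner ℝ ξ y) * symbol t x w ‖ξ‖)) := by
    refine tendsto_integral_of_dominated_convergence (fun ξ => symbol t x w ‖ξ‖)
      (fun n => (CosNonneg.integrable_cos_mul ((hs.mul_mem _ (cosNonneg_gaussian
        (by positivity))).integrable) y).aestronglyMeasurable) hi
      (fun n => Eventually.of_forall fun ξ => ?_) (Eventually.of_forall fun ξ => ?_)
    · have h0 := symbol_nonneg x w ‖ξ‖ ht
      have h1 : Real.exp (-(1 / ((n : ℝ) + 1)) * ‖ξ‖ ^ 2) ≤ 1 := by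
        rw [Real.exp_le_one_iff, neg_mul, neg_nonpos]
        positivity
      rw [Real.norm_eq_abs, abs_mul, abs_mul, Real.abs_exp, abs_of_nonneg h0]
      calc _ ≤ 1 * (symbol t x w ‖ξ‖ * 1) := by
            gcongr
            exact Real.abs_cos_le_one _
        _ = _ := by ring
    · have h1 := ((tendsto_one_div_add_atTop_nhds_zero_nat (𝕜 := ℝ)).neg.mul_const (‖ξ‖ ^ 2))
      have h2 := (Real.continuous_exp.tendsto _).comp h1
      simpa using (h2.const_mul (symbol t x w ‖ξ‖)).const_mul (Real.cos (inner ℝ ξ y))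
  exact ge_of_tendsto' hlim fun n =>
    (hs.mul_mem _ (cosNonneg_gaussian (by positivity))).nonneg y

theorem kernel_comm (hN : 1 ≤ N) (hk : 1 ≤ k) (y : 𝕐) {t : ℝ} (ht : 0 < t) :
    kernel x w y t = kernel w x (-y) t := by
  rw [kernel_eq x w hN hk y ht, kernel_eq w x hN hk (-y) ht]
  simp_rw [inner_neg_right, Real.cos_neg, symbol_comm x w]

/-- Bound the cosine by 1 and the symbol by `symbol_le_exp`; scaling ξ by t turns the remaining
integral into t^{-k} times a constant, next to the prefactor t^{-N/2}. -/
theorem exists_kernel_le (hN : 1 ≤ N) (hk : 1 ≤ k) : ∃ C : ℝ, 0 < C ∧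
    ∀ (x w : 𝕏) (y : 𝕐) (t : ℝ), 0 < t →
      kernel x w y t ≤ C * t ^ (-(((N : ℝ) + 2 * k) / 2)) := by
  have hN' : (0 : ℝ) < N := by exact_mod_cast hN
  set I := ∫ v : 𝕐, Real.exp (-((N : ℝ) / 4 * ‖v‖)) with hI
  have hI0 : 0 ≤ I := integral_nonneg fun _ => Real.exp_nonneg _
  -- I + 1 instead of I makes the constant positive without a proof that I > 0.
  refine ⟨kernelConst N k * 2 ^ ((N : ℝ) / 2) * (I + 1), ?_, fun x w y t ht => ?_⟩
  · have := kernelConst_pos N k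
    positivity
  have hi : Integrable fun v : 𝕐 => (2 / t) ^ ((N : ℝ) / 2) * Real.exp (-((N : ℝ) / 4 * t * ‖v‖)) :=
    (integrable_exp_neg_mul_norm (V := 𝕐) volume (by positivity)).const_mul _
  have h1 : ∫ ξ : 𝕐, Real.cos (inner ℝ ξ y) * symbol t x w ‖ξ‖ ≤
      ∫ ξ : 𝕐, (2 / t) ^ ((N : ℝ) / 2) * Real.exp (-((N : ℝ) / 4 * t * ‖ξ‖)) := by
    refine integral_mono (CosNonneg.integrable_cos_mul (integrable_symbol x w hN ht) y) hi
      fun ξ => ?_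
    refine (mul_le_of_le_one_left (symbol_nonneg _ _ _ ht) (Real.cos_le_one _)).trans ?_
    exact symbol_le_exp x w ht (norm_nonneg _)
  have h2 : ∫ ξ : 𝕐, Real.exp (-((N : ℝ) / 4 * t * ‖ξ‖)) = t ^ (-(k : ℝ)) * I := by
    have := Measure.integral_comp_smul (volume : Measure 𝕐)
      (fun v => Real.exp (-((N : ℝ) / 4 * ‖v‖))) t
    simp_rw [norm_smul, Real.norm_eq_abs, abs_of_pos ht, ← mul_assoc] at this
    rw [this, finrank_euclideanSpace, Fintype.card_fin, abs_of_pos (by positivity),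
      Real.rpow_neg ht.le, Real.rpow_natCast, smul_eq_mul]
  have h3 : (t : ℝ) ^ (-(((N : ℝ) + 2 * k) / 2)) = (1 / t) ^ ((N : ℝ) / 2) * t ^ (-(k : ℝ)) := by
    rw [one_div, Real.inv_rpow ht.le, ← Real.rpow_neg ht.le, ← Real.rpow_add ht]
    ring_nf
  rw [integral_const_mul, h2] at h1
  rw [kernel_eq x w hN hk y ht, h3]
  calc _ ≤ kernelConst N k * ((2 / t) ^ ((N : ℝ) / 2) * (t ^ (-(k : ℝ)) * I)) :=
        mul_le_mul_of_nonneg_left h1 (kernelConst_pos N k).le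
    _ = kernelConst N k * 2 ^ ((N : ℝ) / 2) * I * ((1 / t) ^ ((N : ℝ) / 2) * t ^ (-(k : ℝ))) := by
        rw [show (2 : ℝ) / t = 2 * (1 / t) by ring, Real.mul_rpow (by norm_num) (by positivity)]
        ring
    _ ≤ _ := by
        have := kernelConst_pos N k
        gcongr
        linarith

theorem continuousAt_kernel (hN : 1 ≤ N) (hk : 1 ≤ k) (y : 𝕐) {t₀ : ℝ} (ht₀ : 0 < t₀) :
    ContinuousAt (fun t => kernel x w y t) t₀ := by
  have hN' : (0 : ℝ) < N := by exact_mod_cast hN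
  have hev : ∀ᶠ t in 𝓝 t₀, t₀ / 2 < t := eventually_gt_nhds (by linarith)
  have h : ContinuousAt (fun t => kernelConst N k *
      ∫ ξ : 𝕐, Real.cos (inner ℝ ξ y) * symbol t x w ‖ξ‖) t₀ := by
    refine continuousAt_const.mul (continuousAt_of_dominated
      (bound := fun ξ => (2 / (t₀ / 2)) ^ ((N : ℝ) / 2) * Real.exp (-(N / 4 * (t₀ / 2) * ‖ξ‖)))
      ?_ ?_ ?_ ?_)
    · filter_upwards [hev] with t ht
      exact (CosNonneg.integrable_cos_mul (integrable_symbol x w hN (by linarith))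
        y).aestronglyMeasurable
    · filter_upwards [hev] with t ht
      refine Eventually.of_forall fun ξ => ?_
      have ht' : 0 < t := by linarith
      rw [Real.norm_eq_abs, abs_mul, abs_of_nonneg (symbol_nonneg _ _ _ ht')]
      refine (mul_le_of_le_one_left (symbol_nonneg _ _ _ ht') (Real.abs_cos_le_one _)).trans ?_
      refine (symbol_le_exp x w ht' (norm_nonneg _)).trans ?_
      gcongr
    · exact (integrable_exp_neg_mul_norm (V := 𝕐) volume (by positivity)).const_mul _
    · refine Eventually.of_forall fun ξ => continuousAt_const.mul ?_
      exact ContinuousAt.symbol continuousAt_id continuousAt_const continuousAt_const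
        continuousAt_const ht₀
  refine h.congr ?_
  filter_upwards [hev] with t ht
  rw [kernel_eq x w hN hk y (by linarith)]

theorem measurable_kernel (hN : 1 ≤ N) (hk : 1 ≤ k) {t : ℝ} (ht : 0 < t) :
    Measurable fun q : 𝕏 × 𝕏 × 𝕐 => kernel q.1 q.2.1 q.2.2 t := by
  simp_rw [fun q : 𝕏 × 𝕏 × 𝕐 => kernel_eq q.1 q.2.1 hN hk q.2.2 ht]
  refine Measurable.const_mul ?_ _
  have hc : Continuous fun z : (𝕏 × 𝕏 × 𝕐) × 𝕐 =>
      Real.cos (inner ℝ z.2 z.1.2.2) * symbol t z.1.1 z.1.2.1 ‖z.2‖ := by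
    refine Continuous.mul (by fun_prop) (continuous_iff_continuousAt.2 fun z => ?_)
    exact ContinuousAt.symbol continuousAt_const (by fun_prop) (by fun_prop) (by fun_prop) ht
  exact (hc.stronglyMeasurable.integral_prod_right' (ν := volume)).measurable

end Kernel

/-! ### The abstract properties of a heat kernel used in the sequel. -/

/-- A symmetric Markov kernel family on `Ω`, indexed by positive times, which is bounded by
`C t^{-d}`, is continuous in time, and is an approximate identity as `t → 0`. -/
structure IsHeatKernel {Ω : Type*} [TopologicalSpace Ω] [MeasurableSpace Ω] (μ : Measure Ω)
    (d C : ℝ) (κ : ℝ → Ω → Ω → ℝ) : Prop where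
  measurable : ∀ t, 0 < t → Measurable (Function.uncurry (κ t))
  nonneg : ∀ t, 0 < t → ∀ a b, 0 ≤ κ t a b
  symm : ∀ t, 0 < t → ∀ a b, κ t a b = κ t b a
  mass : ∀ t, 0 < t → ∀ a, ∫⁻ b, ENNReal.ofReal (κ t a b) ∂μ = 1
  const_pos : 0 < C
  le : ∀ t, 0 < t → ∀ a b, κ t a b ≤ C * t ^ (-d)
  continuousAt : ∀ t, 0 < t → ∀ a b, ContinuousAt (fun s => κ s a b) t
  tendsto_zero : ∀ φ : Ω → ℝ, Continuous φ → HasCompactSupport φ → ∀ a,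
    Tendsto (fun t => ∫ b, κ t a b * φ b ∂μ) (𝓝[>] 0) (𝓝 (φ a))

/-! ### Mass one and approximate identity for the Grushin kernel. -/

section

variable {N k : ℕ}

local notation "𝕏" => EuclideanSpace ℝ (Fin N)
local notation "𝕐" => EuclideanSpace ℝ (Fin k)

variable (x w : EuclideanSpace ℝ (Fin N))

theorem measurable_kernel_right (hN : 1 ≤ N) (hk : 1 ≤ k) {t : ℝ} (ht : 0 < t) :
    Measurable fun z : 𝕐 => kernel x w z t :=
  (measurable_kernel hN hk ht).comp (f := fun z : 𝕐 => (x, w, z)) (by fun_prop)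

theorem integrable_kernel_mul_gaussian (hN : 1 ≤ N) (hk : 1 ≤ k) {t : ℝ} (ht : 0 < t) {b : ℝ}
    (hb : 0 < b) : Integrable fun z : 𝕐 => kernel x w z t * Real.exp (-b * ‖z‖ ^ 2) := by
  obtain ⟨C, hC, hle⟩ := exists_kernel_le (N := N) (k := k) hN hk
  refine integrable_bdd_mul (C := C * t ^ (-(((N : ℝ) + 2 * k) / 2)))
    (measurable_kernel_right x w hN hk ht) (fun z => ?_) (integrable_gaussian hb)
  rw [abs_of_nonneg (kernel_nonneg x w hN hk z ht)]
  exact hle x w z t ht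

/-- Fubini moves the Gaussian in z to a Gaussian of width δ in the frequency, and ξ = δv rescales
it. Letting δ → 0 yields the mass in z; δ = 2 is the test function exp(-|z|²) of the approximate
identity. -/
theorem integral_kernel_mul_gaussian (hN : 1 ≤ N) (hk : 1 ≤ k) {t : ℝ} (ht : 0 < t) {δ : ℝ}
    (hδ : 0 < δ) : ∫ z : 𝕐, kernel x w z t * Real.exp (-(δ ^ 2 / 4) * ‖z‖ ^ 2) =
      (2 * Real.pi) ^ (-(N / 2 : ℝ)) * Real.pi ^ (-(k / 2 : ℝ)) *
        ∫ v : 𝕐, symbol t x w (δ * ‖v‖) * Real.exp (-‖v‖ ^ 2) := by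
  have hpi := Real.pi_pos
  have hb : 0 < δ ^ 2 / 4 := by positivity
  have hs := integrable_symbol (k := k) x w hN ht
  have e1 : ∀ z : 𝕐, kernel x w z t * Real.exp (-(δ ^ 2 / 4) * ‖z‖ ^ 2) =
      kernelConst N k * ∫ ξ : 𝕐, symbol t x w ‖ξ‖ *
        (Real.exp (-(δ ^ 2 / 4) * ‖z‖ ^ 2) * Real.cos (inner ℝ z ξ)) := fun z => by
    rw [kernel_eq x w hN hk z ht, mul_assoc, ← integral_mul_const]
    congr 1
    refine integral_congr_ae (Eventually.of_forall fun ξ => ?_)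
    simp only [real_inner_comm ξ z]
    ring
  have hint : Integrable (Function.uncurry fun (z ξ : 𝕐) => symbol t x w ‖ξ‖ *
      (Real.exp (-(δ ^ 2 / 4) * ‖z‖ ^ 2) * Real.cos (inner ℝ z ξ)))
      ((volume : Measure 𝕐).prod (volume : Measure 𝕐)) := by
    refine ((integrable_gaussian (V := 𝕐) hb).mul_prod hs).mono' ?_
      (Eventually.of_forall fun z => ?_)
    · exact hs.aestronglyMeasurable.comp_snd.mul
        (Continuous.aestronglyMeasurable (by fun_prop))
    · simp only [Function.uncurry, Real.norm_eq_abs, abs_mul, Real.abs_exp]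
      rw [abs_of_nonneg (symbol_nonneg _ _ _ ht), mul_comm (symbol _ _ _ _)]
      have := symbol_nonneg x w ‖z.2‖ ht
      gcongr
      exact mul_le_of_le_one_right (Real.exp_nonneg _) (Real.abs_cos_le_one _)
  simp_rw [e1]
  rw [integral_const_mul, integral_integral_swap hint]
  simp_rw [integral_const_mul, integral_gaussian_mul_cos hb]
  have e2 := Measure.integral_comp_smul (volume : Measure 𝕐)
    (fun ξ => symbol t x w ‖ξ‖ * Real.exp (-‖ξ‖ ^ 2 / (4 * (δ ^ 2 / 4)))) δ
  have e3 : ∀ v : 𝕐, symbol t x w ‖δ • v‖ * Real.exp (-‖δ • v‖ ^ 2 / (4 * (δ ^ 2 / 4))) =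
      symbol t x w (δ * ‖v‖) * Real.exp (-‖v‖ ^ 2) := fun v => by
    rw [norm_smul, Real.norm_eq_abs, abs_of_pos hδ]
    congr 2
    field_simp
  simp_rw [e3] at e2
  rw [e2, finrank_euclideanSpace, Fintype.card_fin, abs_of_pos (by positivity), smul_eq_mul]
  simp_rw [mul_left_comm (symbol _ _ _ _), integral_const_mul, ← mul_assoc]
  congr 1
  have h1 : (Real.pi / (δ ^ 2 / 4)) ^ (k / 2 : ℝ) =
      Real.pi ^ (k / 2 : ℝ) * (2 ^ (k : ℝ) * (δ ^ k)⁻¹) := by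
    rw [show Real.pi / (δ ^ 2 / 4) = Real.pi * (2 / δ) ^ (2 : ℝ) by
      rw [Real.rpow_two]; field_simp; norm_num, Real.mul_rpow hpi.le (by positivity),
      ← Real.rpow_mul (by positivity), Real.div_rpow (by norm_num) hδ.le]
    rw [show 2 * ((k : ℝ) / 2) = k by ring, Real.rpow_natCast δ]
    rfl
  have h2 : kernelConst N k = (2 * Real.pi) ^ (-(N / 2 : ℝ)) *
      (2 ^ (-(k : ℝ)) * (Real.pi ^ (-(k / 2 : ℝ)) * Real.pi ^ (-(k / 2 : ℝ)))) := by
    rw [kernelConst, one_div, ← Real.rpow_neg (by positivity), ← Real.rpow_add hpi,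
      show -(k / 2 : ℝ) + -(k / 2) = -k by ring, ← Real.mul_rpow (by norm_num) hpi.le,
      ← Real.rpow_add (by positivity)]
    ring_nf
  rw [h1, h2]
  have h3 : Real.pi ^ (-(k / 2 : ℝ)) * Real.pi ^ (k / 2 : ℝ) = 1 := by
    rw [← Real.rpow_add hpi]; simp
  have h4 : (2 : ℝ) ^ (-(k : ℝ)) * 2 ^ (k : ℝ) = 1 := by
    rw [← Real.rpow_add (by norm_num)]; simp
  linear_combination ((2 * Real.pi) ^ (-(N / 2 : ℝ)) * Real.pi ^ (-(k / 2 : ℝ)) * (δ ^ k)⁻¹) *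
    (h4 + 2 ^ (-(k : ℝ)) * 2 ^ (k : ℝ) * h3)

theorem integral_exp_neg_norm_sq : ∫ v : 𝕐, Real.exp (-‖v‖ ^ 2) = Real.pi ^ (k / 2 : ℝ) := by
  have := GaussianFourier.integral_rexp_neg_mul_sq_norm (V := 𝕐) one_pos
  simpa using this

theorem integrable_exp_neg_norm_sq : Integrable fun v : 𝕐 => Real.exp (-‖v‖ ^ 2) := by
  have := integrable_gaussian (V := 𝕐) one_pos
  simpa using this

/-- Integrating in z selects the frequency ξ = 0. Integrability in z is not known beforehand, so
Gaussian cutoffs are removed: the space side converges monotonically because the kernel is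
nonnegative, the frequency side by domination with the symbol at zero. -/
theorem lintegral_kernel (hN : 1 ≤ N) (hk : 1 ≤ k) {t : ℝ} (ht : 0 < t) :
    ∫⁻ z : 𝕐, ENNReal.ofReal (kernel x w z t) =
      ENNReal.ofReal ((2 * Real.pi) ^ (-(N / 2 : ℝ)) * symbol t x w 0) := by
  have hpi := Real.pi_pos
  set δ : ℕ → ℝ := fun n => 1 / ((n : ℝ) + 1) with hδ
  have hδ0 : ∀ n, 0 < δ n := fun n => by simp only [hδ]; positivity
  have hδlim : Tendsto δ atTop (𝓝 0) := tendsto_one_div_add_atTop_nhds_zero_nat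
  have hδanti : Antitone δ := fun m n h => by
    simp only [hδ]
    gcongr
  have h1 : Tendsto (fun n => ∫⁻ z : 𝕐,
      ENNReal.ofReal (kernel x w z t * Real.exp (-(δ n ^ 2 / 4) * ‖z‖ ^ 2))) atTop
      (𝓝 (∫⁻ z : 𝕐, ENNReal.ofReal (kernel x w z t))) := by
    refine lintegral_tendsto_of_tendsto_of_monotone (fun n => ?_)
      (Eventually.of_forall fun z m n h => ?_) (Eventually.of_forall fun z => ?_)
    · exact ((measurable_kernel_right x w hN hk ht).mul (by fun_prop)).ennreal_ofReal.aemeasurable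
    · have := kernel_nonneg x w hN hk z ht
      have h' := hδanti h
      have := hδ0 n
      dsimp only
      gcongr
    · have h2 : Tendsto (fun n => kernel x w z t * Real.exp (-(δ n ^ 2 / 4) * ‖z‖ ^ 2)) atTop
          (𝓝 (kernel x w z t * Real.exp (-(0 ^ 2 / 4) * ‖z‖ ^ 2))) := by
        refine ((Real.continuous_exp.tendsto _).comp ?_).const_mul _
        exact (((hδlim.pow 2).div_const 4).neg).mul_const _
      simp only [ne_eq, OfNat.ofNat_ne_zero, not_false_eq_true, zero_pow, zero_div, neg_zero,
        zero_mul, Real.exp_zero, mul_one] at h2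
      exact (ENNReal.continuous_ofReal.tendsto _).comp h2
  have h3 : ∀ n, ∫⁻ z : 𝕐, ENNReal.ofReal (kernel x w z t * Real.exp (-(δ n ^ 2 / 4) * ‖z‖ ^ 2)) =
      ENNReal.ofReal ((2 * Real.pi) ^ (-(N / 2 : ℝ)) * Real.pi ^ (-(k / 2 : ℝ)) *
        ∫ v : 𝕐, symbol t x w (δ n * ‖v‖) * Real.exp (-‖v‖ ^ 2)) := fun n => by
    rw [← integral_kernel_mul_gaussian x w hN hk ht (hδ0 n),
      ofReal_integral_eq_lintegral_ofReal
        (integrable_kernel_mul_gaussian x w hN hk ht (by have := hδ0 n; positivity))]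
    exact Eventually.of_forall fun z =>
      mul_nonneg (kernel_nonneg x w hN hk z ht) (Real.exp_nonneg _)
  have h4 : Tendsto (fun n => ∫ v : 𝕐, symbol t x w (δ n * ‖v‖) * Real.exp (-‖v‖ ^ 2)) atTop
      (𝓝 (∫ v : 𝕐, symbol t x w 0 * Real.exp (-‖v‖ ^ 2))) := by
    have hcont : ∀ z, ContinuousAt (fun z => symbol t x w z) z := fun z =>
      ContinuousAt.symbol continuousAt_const continuousAt_const continuousAt_const
        continuousAt_id ht
    refine tendsto_integral_of_dominated_convergence
      (fun v => symbol t x w 0 * Real.exp (-‖v‖ ^ 2)) (fun n => ?_)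
      (integrable_exp_neg_norm_sq.const_mul _) (fun n => Eventually.of_forall fun v => ?_)
      (Eventually.of_forall fun v => ?_)
    · exact (((continuous_iff_continuousAt.2 hcont).comp (by fun_prop)).mul
        (by fun_prop)).aestronglyMeasurable
    · rw [Real.norm_eq_abs, abs_mul, Real.abs_exp, abs_of_nonneg (symbol_nonneg _ _ _ ht),
        symbol_zero]
      have := hδ0 n
      gcongr
      exact symbol_le_gaussian x w ht (by positivity)
    · have : Tendsto (fun n => δ n * ‖v‖) atTop (𝓝 0) := by simpa using hδlim.mul_const ‖v‖
      exact ((hcont 0).tendsto.comp this).mul_const _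
  have h5 := (ENNReal.continuous_ofReal.tendsto _).comp
    (h4.const_mul ((2 * Real.pi) ^ (-(N / 2 : ℝ)) * Real.pi ^ (-(k / 2 : ℝ))))
  rw [tendsto_nhds_unique h1 (h5.congr fun n => (h3 n).symm), integral_const_mul,
    integral_exp_neg_norm_sq]
  congr 1
  have h6 : Real.pi ^ (-(k / 2 : ℝ)) * Real.pi ^ (k / 2 : ℝ) = 1 := by
    rw [← Real.rpow_add hpi]; simp
  linear_combination ((2 * Real.pi) ^ (-(N / 2 : ℝ)) * symbol t x w 0) * h6

theorem measurable_kernel_pt (hN : 1 ≤ N) (hk : 1 ≤ k) {t : ℝ} (ht : 0 < t) :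
    Measurable fun q : Pt N k × Pt N k => kernel q.1.1 q.2.1 (q.1.2 - q.2.2) t :=
  (measurable_kernel hN hk ht).comp
    (f := fun q : Pt N k × Pt N k => (q.1.1, q.2.1, q.1.2 - q.2.2)) (by fun_prop)

/-- After the integration in z, what remains is the Euclidean heat kernel on ℝ^N, of mass one. -/
theorem lintegral_kernel_pt (hN : 1 ≤ N) (hk : 1 ≤ k) {t : ℝ} (ht : 0 < t) (a : Pt N k) :
    ∫⁻ b : Pt N k, ENNReal.ofReal (kernel a.1 b.1 (a.2 - b.2) t) = 1 := by
  have hpi := Real.pi_pos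
  have hm : Measurable fun b : Pt N k => ENNReal.ofReal (kernel a.1 b.1 (a.2 - b.2) t) :=
    ((measurable_kernel_pt hN hk ht).comp (f := fun b => (a, b)) measurable_prodMk_left).ennreal_ofReal
  rw [Measure.volume_eq_prod, lintegral_prod _ hm.aemeasurable]
  have h1 : ∀ w : 𝕏, ∫⁻ z : 𝕐, ENNReal.ofReal (kernel a.1 w (a.2 - z) t) =
      ENNReal.ofReal ((2 * Real.pi) ^ (-(N / 2 : ℝ)) * symbol t a.1 w 0) := fun w => by
    rw [lintegral_sub_left_eq_self (fun z : 𝕐 => ENNReal.ofReal (kernel a.1 w z t)),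
      lintegral_kernel a.1 w hN hk ht]
  simp_rw [h1, symbol_zero]
  have hb : 0 < 1 / (2 * t) := by positivity
  have hi : Integrable fun w : 𝕏 => Real.exp (-(1 / (2 * t) * ‖a.1 - w‖ ^ 2)) := by
    have := (integrable_gaussian (V := 𝕏) hb).comp_sub_left a.1
    simpa only [neg_mul] using this
  rw [← ofReal_integral_eq_lintegral_ofReal ((hi.const_mul _).const_mul _)
    (Eventually.of_forall fun w => by positivity), integral_const_mul, integral_const_mul]
  have h2 := GaussianFourier.integral_rexp_neg_mul_sq_norm (V := 𝕏) hb
  rw [← integral_sub_left_eq_self _ volume a.1] at h2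
  simp only [neg_mul] at h2
  rw [h2, finrank_euclideanSpace, Fintype.card_fin,
    show Real.pi / (1 / (2 * t)) = (2 * Real.pi) * t by field_simp,
    Real.mul_rpow (by positivity) ht.le, Real.rpow_neg (by positivity), one_div,
    Real.inv_rpow ht.le]
  rw [← ENNReal.ofReal_one]
  congr 1
  field_simp

theorem integrable_kernel_pt (hN : 1 ≤ N) (hk : 1 ≤ k) {t : ℝ} (ht : 0 < t) (a : Pt N k) :
    Integrable fun b : Pt N k => kernel a.1 b.1 (a.2 - b.2) t := by
  have hm : Measurable fun b : Pt N k => kernel a.1 b.1 (a.2 - b.2) t :=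
    (measurable_kernel_pt hN hk ht).comp (f := fun b => (a, b)) measurable_prodMk_left
  refine ⟨hm.aestronglyMeasurable, ?_⟩
  rw [hasFiniteIntegral_iff_ofReal
    (Eventually.of_forall fun b => kernel_nonneg _ _ hN hk _ ht), lintegral_kernel_pt hN hk ht]
  exact ENNReal.one_lt_top

theorem integral_kernel_pt (hN : 1 ≤ N) (hk : 1 ≤ k) {t : ℝ} (ht : 0 < t) (a : Pt N k) :
    ∫ b : Pt N k, kernel a.1 b.1 (a.2 - b.2) t = 1 := by
  rw [integral_eq_lintegral_of_nonneg_ae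
    (Eventually.of_forall fun b => kernel_nonneg _ _ hN hk _ ht)
    (integrable_kernel_pt hN hk ht a).aestronglyMeasurable, lintegral_kernel_pt hN hk ht]
  rfl

/-- The kernel in the parabolic variable `w = x + √t u`. -/
theorem symbol_parabolic (u : 𝕏) (z : ℝ) {t : ℝ} (ht : 0 < t) :
    √t ^ N * symbol t x (x + √t • u) z = sinhRatio (z * t) ^ ((N : ℝ) / 2) *
      Real.exp (-(1 / 2 * (‖u‖ ^ 2 * mulCoth (z * (t / 2))) +
        ‖x + (x + √t • u)‖ ^ 2 * (z / 4 * Real.tanh (z * (t / 2))))) := by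
  have h1 : √t ^ N * (1 / t) ^ ((N : ℝ) / 2) = 1 := by
    rw [Real.sqrt_eq_rpow, ← Real.rpow_natCast, ← Real.rpow_mul ht.le, one_div t,
      Real.inv_rpow ht.le, show 1 / 2 * (N : ℝ) = N / 2 by ring]
    exact mul_inv_cancel₀ (by positivity)
  have h2 : ‖x - (x + √t • u)‖ ^ 2 = t * ‖u‖ ^ 2 := by
    rw [sub_add_cancel_left, norm_neg, norm_smul, mul_pow, Real.norm_eq_abs, sq_abs,
      Real.sq_sqrt ht.le]
  rw [symbol, h2, ← mul_assoc, ← mul_assoc, h1, one_mul]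
  congr 2
  field_simp
  ring

theorem tendsto_symbol_parabolic (u : 𝕏) (z : ℝ) :
    Tendsto (fun t => √t ^ N * symbol t x (x + √t • u) z) (𝓝[>] 0)
      (𝓝 (Real.exp (-(1 / 2 * ‖u‖ ^ 2)))) := by
  have h : ContinuousAt (fun t => sinhRatio (z * t) ^ ((N : ℝ) / 2) *
      Real.exp (-(1 / 2 * (‖u‖ ^ 2 * mulCoth (z * (t / 2))) +
        ‖x + (x + √t • u)‖ ^ 2 * (z / 4 * Real.tanh (z * (t / 2)))))) 0 := by
    have h1 : Continuous fun t : ℝ => sinhRatio (z * t) := continuous_sinhRatio.comp (by fun_prop)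
    have h2 : Continuous fun t : ℝ => mulCoth (z * (t / 2)) := continuous_mulCoth.comp (by fun_prop)
    have h3 : Continuous fun t : ℝ => Real.tanh (z * (t / 2)) := continuous_tanh.comp (by fun_prop)
    refine ((h1.rpow_const fun t => Or.inl (sinhRatio_pos _).ne').mul ?_).continuousAt
    fun_prop
  have h0 := h.tendsto.mono_left (nhdsWithin_le_nhds (s := Ioi 0))
  simp only [mul_zero, zero_div, sinhRatio_zero, Real.one_rpow, mulCoth_zero, mul_one,
    Real.tanh_zero, add_zero, one_mul] at h0
  refine h0.congr' ?_
  filter_upwards [self_mem_nhdsWithin] with t ht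
  exact (symbol_parabolic x u z ht).symm

/-- A majorant independent of t and of the frequency, which dominates both integrals as t → 0. -/
theorem symbol_parabolic_le (u : 𝕏) {z : ℝ} (hz : 0 ≤ z) {t : ℝ} (ht : 0 < t) :
    √t ^ N * symbol t x (x + √t • u) z ≤ Real.exp (-(1 / 2 * ‖u‖ ^ 2)) := by
  rw [symbol_parabolic x u z ht]
  have h1 : sinhRatio (z * t) ^ ((N : ℝ) / 2) ≤ 1 :=
    Real.rpow_le_one (sinhRatio_pos _).le (sinhRatio_le_one (by positivity)) (by positivity)
  have h2 : 0 ≤ z / 4 * Real.tanh (z * (t / 2)) := by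
    have := mul_tanh_nonneg (z * (t / 2))
    rw [mul_right_comm] at this
    have := nonneg_of_mul_nonneg_left this (by positivity : (0 : ℝ) < t / 2)
    linarith
  refine (mul_le_of_le_one_left (Real.exp_nonneg _) h1).trans (Real.exp_le_exp.2 ?_)
  have h3 := one_le_mulCoth (z * (t / 2))
  have h4 := mul_nonneg (sq_nonneg ‖x + (x + √t • u)‖) h2
  nlinarith [mul_le_mul_of_nonneg_left h3 (sq_nonneg ‖u‖)]

/-- For a Gaussian centred at a, the z-integral is explicit on the frequency side. In the variable u
with w = x + √t u the integrand converges, under a fixed Gaussian majorant, to a product of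
Gaussians whose integral is the reciprocal of the constant A. -/
theorem tendsto_integral_kernel_mul_gaussian (hN : 1 ≤ N) (hk : 1 ≤ k) (a : Pt N k) :
    Tendsto (fun t => ∫ b : Pt N k, kernel a.1 b.1 (a.2 - b.2) t *
      (Real.exp (-‖a.1 - b.1‖ ^ 2) * Real.exp (-‖a.2 - b.2‖ ^ 2))) (𝓝[>] 0) (𝓝 1) := by
  have hpi := Real.pi_pos
  set A : ℝ := (2 * Real.pi) ^ (-(N / 2 : ℝ)) * Real.pi ^ (-(k / 2 : ℝ)) with hA
  set H : ℝ → 𝕏 → ℝ := fun t u => Real.exp (-(t * ‖u‖ ^ 2)) *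
    ∫ v : 𝕐, √t ^ N * symbol t a.1 (a.1 + √t • u) (2 * ‖v‖) * Real.exp (-‖v‖ ^ 2) with hH
  have hcont : ∀ t, 0 < t → Continuous fun q : 𝕏 × 𝕐 =>
      √t ^ N * symbol t a.1 (a.1 + √t • q.1) (2 * ‖q.2‖) * Real.exp (-‖q.2‖ ^ 2) := by
    intro t ht
    refine Continuous.mul (continuous_const.mul (continuous_iff_continuousAt.2 fun q => ?_))
      (by fun_prop)
    exact ContinuousAt.symbol continuousAt_const (by fun_prop) (by fun_prop) (by fun_prop) ht
  have hbd : ∀ t, 0 < t → ∀ (u : 𝕏) (v : 𝕐),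
      ‖√t ^ N * symbol t a.1 (a.1 + √t • u) (2 * ‖v‖) * Real.exp (-‖v‖ ^ 2)‖ ≤
        Real.exp (-(1 / 2 * ‖u‖ ^ 2)) * Real.exp (-‖v‖ ^ 2) := by
    intro t ht u v
    rw [Real.norm_eq_abs, abs_mul, Real.abs_exp, abs_of_nonneg
      (mul_nonneg (by positivity) (symbol_nonneg _ _ _ ht))]
    gcongr
    exact symbol_parabolic_le a.1 u (by positivity) ht
  have key : ∀ t, 0 < t → ∫ b : Pt N k, kernel a.1 b.1 (a.2 - b.2) t *
      (Real.exp (-‖a.1 - b.1‖ ^ 2) * Real.exp (-‖a.2 - b.2‖ ^ 2)) = A * ∫ u, H t u := by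
    intro t ht
    have hi : Integrable fun b : Pt N k => kernel a.1 b.1 (a.2 - b.2) t *
        (Real.exp (-‖a.1 - b.1‖ ^ 2) * Real.exp (-‖a.2 - b.2‖ ^ 2)) := by
      refine (integrable_kernel_pt hN hk ht a).mul_bdd (c := 1)
        (Continuous.aestronglyMeasurable (by fun_prop)) (Eventually.of_forall fun b => ?_)
      rw [Real.norm_eq_abs, abs_mul, Real.abs_exp, Real.abs_exp, ← Real.exp_add,
        Real.exp_le_one_iff]
      nlinarith [sq_nonneg ‖a.1 - b.1‖, sq_nonneg ‖a.2 - b.2‖]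
    rw [Measure.volume_eq_prod] at hi ⊢
    rw [integral_prod _ hi]
    have h1 : ∀ w : 𝕏, ∫ z : 𝕐, kernel a.1 w (a.2 - z) t *
        (Real.exp (-‖a.1 - w‖ ^ 2) * Real.exp (-‖a.2 - z‖ ^ 2)) =
        Real.exp (-‖a.1 - w‖ ^ 2) * (A * ∫ v : 𝕐, symbol t a.1 w (2 * ‖v‖) *
          Real.exp (-‖v‖ ^ 2)) := by
      intro w
      rw [hA, ← integral_kernel_mul_gaussian a.1 w hN hk ht two_pos, ← integral_const_mul,
        ← integral_sub_left_eq_self _ volume a.2]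
      refine integral_congr_ae (Eventually.of_forall fun z => ?_)
      simp only
      norm_num
      ring
    simp_rw [h1]
    -- The Jacobian √t^N of w = x + √t u is the factor attached to the symbol in `H`.
    have h2 := Measure.integral_comp_smul (volume : Measure 𝕏) (fun u =>
      Real.exp (-‖a.1 - (a.1 + u)‖ ^ 2) * (A * ∫ v : 𝕐, symbol t a.1 (a.1 + u) (2 * ‖v‖) *
          Real.exp (-‖v‖ ^ 2))) √t
    rw [integral_add_left_eq_self (fun w => Real.exp (-‖a.1 - w‖ ^ 2) *
      (A * ∫ v : 𝕐, symbol t a.1 w (2 * ‖v‖) * Real.exp (-‖v‖ ^ 2))) a.1,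
      finrank_euclideanSpace, Fintype.card_fin, abs_of_pos (by positivity), smul_eq_mul,
      eq_inv_mul_iff_mul_eq₀ (by positivity)] at h2
    rw [← h2, ← integral_const_mul, ← integral_const_mul]
    refine integral_congr_ae (Eventually.of_forall fun u => ?_)
    simp only [hH]
    simp_rw [mul_assoc (√t ^ N), integral_const_mul]
    rw [sub_add_cancel_left, norm_neg, norm_smul, mul_pow, Real.norm_eq_abs, sq_abs,
      Real.sq_sqrt ht.le]
    ring
  have hlim : Tendsto (fun t => ∫ u, H t u) (𝓝[>] 0)
      (𝓝 (∫ u : 𝕏, Real.exp (-(1 / 2 * ‖u‖ ^ 2)) * Real.pi ^ (k / 2 : ℝ))) := by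
    have hgi : Integrable fun u : 𝕏 => Real.exp (-(1 / 2 * ‖u‖ ^ 2)) * Real.pi ^ (k / 2 : ℝ) := by
      have := integrable_gaussian (V := 𝕏) (b := 1 / 2) (by norm_num)
      simpa only [neg_mul] using this.mul_const _
    refine tendsto_integral_filter_of_dominated_convergence _ ?_ ?_ hgi ?_
    · filter_upwards [self_mem_nhdsWithin] with t ht
      refine AEStronglyMeasurable.mul (Continuous.aestronglyMeasurable (by fun_prop)) ?_
      exact ((hcont t ht).stronglyMeasurable.integral_prod_right' (ν := volume)).aestronglyMeasurable
    · filter_upwards [self_mem_nhdsWithin] with t ht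
      refine Eventually.of_forall fun u => ?_
      have ht' : 0 < t := ht
      have h1 : ‖∫ v : 𝕐, √t ^ N * symbol t a.1 (a.1 + √t • u) (2 * ‖v‖) * Real.exp (-‖v‖ ^ 2)‖ ≤
          Real.exp (-(1 / 2 * ‖u‖ ^ 2)) * Real.pi ^ (k / 2 : ℝ) := by
        rw [← integral_exp_neg_norm_sq, ← integral_const_mul]
        exact norm_integral_le_of_norm_le (integrable_exp_neg_norm_sq.const_mul _)
          (Eventually.of_forall (hbd t ht u))
      simp only [hH]
      rw [norm_mul]
      refine (mul_le_of_le_one_left (norm_nonneg _) ?_).trans h1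
      rw [Real.norm_eq_abs, Real.abs_exp, Real.exp_le_one_iff, neg_nonpos]
      positivity
    · refine Eventually.of_forall fun u => ?_
      have h1 : Tendsto (fun t : ℝ => Real.exp (-(t * ‖u‖ ^ 2))) (𝓝[>] 0) (𝓝 1) := by
        have : Continuous fun t : ℝ => Real.exp (-(t * ‖u‖ ^ 2)) := by fun_prop
        have h := (this.tendsto 0).mono_left (nhdsWithin_le_nhds (s := Ioi 0))
        simpa using h
      have h2 : Tendsto (fun t => ∫ v : 𝕐, √t ^ N * symbol t a.1 (a.1 + √t • u) (2 * ‖v‖) *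
          Real.exp (-‖v‖ ^ 2)) (𝓝[>] 0)
          (𝓝 (∫ v : 𝕐, Real.exp (-(1 / 2 * ‖u‖ ^ 2)) * Real.exp (-‖v‖ ^ 2))) := by
        refine tendsto_integral_filter_of_dominated_convergence _ ?_ ?_
          (integrable_exp_neg_norm_sq.const_mul (Real.exp (-(1 / 2 * ‖u‖ ^ 2)))) ?_
        · filter_upwards [self_mem_nhdsWithin] with t ht
          exact ((hcont t ht).comp (Continuous.prodMk_right u)).aestronglyMeasurable
        · filter_upwards [self_mem_nhdsWithin] with t ht
          exact Eventually.of_forall (hbd t ht u)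
        · exact Eventually.of_forall fun v =>
            (tendsto_symbol_parabolic a.1 u (2 * ‖v‖)).mul_const _
      rw [integral_const_mul, integral_exp_neg_norm_sq] at h2
      simpa using h1.mul h2
  have h := (hlim.const_mul A).congr' (f₂ := fun t => ∫ b : Pt N k, kernel a.1 b.1 (a.2 - b.2) t *
      (Real.exp (-‖a.1 - b.1‖ ^ 2) * Real.exp (-‖a.2 - b.2‖ ^ 2))) (by
    filter_upwards [self_mem_nhdsWithin] with t ht using (key t ht).symm)
  convert h using 2
  have h2 := GaussianFourier.integral_rexp_neg_mul_sq_norm (V := 𝕏) (b := 1 / 2) (by norm_num)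
  simp only [neg_mul] at h2
  rw [integral_mul_const, h2, finrank_euclideanSpace, Fintype.card_fin, hA,
    show Real.pi / (1 / 2) = 2 * Real.pi by ring, Real.rpow_neg (by positivity),
    Real.rpow_neg (by positivity)]
  field_simp

/-- Korovkin's device: near a, continuity gives ε; away from a, the function 1 - Gaussian is bounded
below and a multiple of it exceeds 2 sup|φ|. One test function thus controls all φ. -/
theorem exists_abs_sub_le {φ : Pt N k → ℝ} (hφ : Continuous φ) (hc : HasCompactSupport φ)
    (a : Pt N k) {ε : ℝ} (hε : 0 < ε) : ∃ C : ℝ, 0 ≤ C ∧ ∀ b, |φ b - φ a| ≤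
      ε + C * (1 - Real.exp (-‖a.1 - b.1‖ ^ 2) * Real.exp (-‖a.2 - b.2‖ ^ 2)) := by
  obtain ⟨M, hM⟩ := hc.exists_bound_of_continuous hφ
  have hM0 : 0 ≤ M := (norm_nonneg _).trans (hM a)
  obtain ⟨δ, hδ, hclose⟩ := Metric.continuousAt_iff.1 hφ.continuousAt ε hε
  have he : 0 < 1 - Real.exp (-δ ^ 2) := by
    rw [sub_pos, Real.exp_lt_one_iff]
    nlinarith
  refine ⟨2 * M / (1 - Real.exp (-δ ^ 2)), by positivity, fun b => ?_⟩
  have hle : Real.exp (-‖a.1 - b.1‖ ^ 2) * Real.exp (-‖a.2 - b.2‖ ^ 2) ≤ 1 := by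
    rw [← Real.exp_add, Real.exp_le_one_iff]
    nlinarith [sq_nonneg ‖a.1 - b.1‖, sq_nonneg ‖a.2 - b.2‖]
  by_cases h : dist b a < δ
  · have h1 : |φ b - φ a| < ε := hclose h
    have := mul_nonneg (div_nonneg (mul_nonneg zero_le_two hM0) he.le) (sub_nonneg.2 hle)
    linarith
  · have h1 : |φ b - φ a| ≤ 2 * M := by
      have := abs_sub (φ b) (φ a)
      have h2 := hM a
      have h3 := hM b
      rw [Real.norm_eq_abs] at h2 h3
      linarith
    have h2 : Real.exp (-‖a.1 - b.1‖ ^ 2) * Real.exp (-‖a.2 - b.2‖ ^ 2) ≤ Real.exp (-δ ^ 2) := by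
      rw [← Real.exp_add, Real.exp_le_exp]
      rw [not_lt, dist_comm, Prod.dist_eq, le_max_iff, dist_eq_norm, dist_eq_norm] at h
      rcases h with h | h <;>
      nlinarith [sq_nonneg ‖a.1 - b.1‖, sq_nonneg ‖a.2 - b.2‖]
    calc |φ b - φ a| ≤ 2 * M := h1
      _ = 2 * M / (1 - Real.exp (-δ ^ 2)) * (1 - Real.exp (-δ ^ 2)) := by field_simp
      _ ≤ 2 * M / (1 - Real.exp (-δ ^ 2)) *
          (1 - Real.exp (-‖a.1 - b.1‖ ^ 2) * Real.exp (-‖a.2 - b.2‖ ^ 2)) := by gcongr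
      _ ≤ _ := by linarith

theorem tendsto_integral_kernel_mul (hN : 1 ≤ N) (hk : 1 ≤ k) {φ : Pt N k → ℝ}
    (hφ : Continuous φ) (hc : HasCompactSupport φ) (a : Pt N k) :
    Tendsto (fun t => ∫ b : Pt N k, kernel a.1 b.1 (a.2 - b.2) t * φ b) (𝓝[>] 0) (𝓝 (φ a)) := by
  rw [Metric.tendsto_nhds]
  intro ε hε
  obtain ⟨C, hC, hle⟩ := exists_abs_sub_le hφ hc a (half_pos (half_pos hε))
  obtain ⟨M, hM⟩ := hc.exists_bound_of_continuous hφ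
  have hlim : Tendsto (fun t => C * (1 - ∫ b : Pt N k, kernel a.1 b.1 (a.2 - b.2) t *
      (Real.exp (-‖a.1 - b.1‖ ^ 2) * Real.exp (-‖a.2 - b.2‖ ^ 2)))) (𝓝[>] 0) (𝓝 0) := by
    simpa using ((tendsto_integral_kernel_mul_gaussian hN hk a).const_sub 1).const_mul C
  filter_upwards [self_mem_nhdsWithin, hlim.eventually_lt_const (half_pos hε)] with t ht hsmall
  have hKi := integrable_kernel_pt hN hk ht a
  have hφi : Integrable fun b : Pt N k => kernel a.1 b.1 (a.2 - b.2) t * φ b :=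
    hKi.mul_bdd hφ.aestronglyMeasurable (Eventually.of_forall hM)
  have hgi : Integrable fun b : Pt N k => kernel a.1 b.1 (a.2 - b.2) t *
        (Real.exp (-‖a.1 - b.1‖ ^ 2) * Real.exp (-‖a.2 - b.2‖ ^ 2)) := by
    refine hKi.mul_bdd (c := 1)
      (Continuous.aestronglyMeasurable (by fun_prop)) (Eventually.of_forall fun b => ?_)
    rw [Real.norm_eq_abs, abs_mul, Real.abs_exp, Real.abs_exp, ← Real.exp_add,
      Real.exp_le_one_iff]
    nlinarith [sq_nonneg ‖a.1 - b.1‖, sq_nonneg ‖a.2 - b.2‖]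
  have hsub : (∫ b : Pt N k, kernel a.1 b.1 (a.2 - b.2) t * φ b) - φ a =
      ∫ b : Pt N k, kernel a.1 b.1 (a.2 - b.2) t * (φ b - φ a) := by
    simp_rw [mul_sub]
    rw [integral_sub hφi (hKi.mul_const _), integral_mul_const, integral_kernel_pt hN hk ht,
      one_mul]
  rw [dist_eq_norm, hsub]
  have hrhs : ∫ b : Pt N k, (ε / 2 / 2 + C) * kernel a.1 b.1 (a.2 - b.2) t -
      C * (kernel a.1 b.1 (a.2 - b.2) t *
        (Real.exp (-‖a.1 - b.1‖ ^ 2) * Real.exp (-‖a.2 - b.2‖ ^ 2))) =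
      (ε / 2 / 2 + C) - C * ∫ b : Pt N k, kernel a.1 b.1 (a.2 - b.2) t *
        (Real.exp (-‖a.1 - b.1‖ ^ 2) * Real.exp (-‖a.2 - b.2‖ ^ 2)) := by
    rw [integral_sub (hKi.const_mul _) (hgi.const_mul _), integral_const_mul, integral_const_mul,
      integral_kernel_pt hN hk ht, mul_one]
  have h := norm_integral_le_of_norm_le
    (f := fun b : Pt N k => kernel a.1 b.1 (a.2 - b.2) t * (φ b - φ a))
    ((hKi.const_mul (ε / 2 / 2 + C)).sub (hgi.const_mul C)) (Eventually.of_forall fun b => by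
      have h0 := kernel_nonneg a.1 b.1 hN hk (a.2 - b.2) ht
      rw [norm_mul, Real.norm_eq_abs, Real.norm_eq_abs, abs_of_nonneg h0]
      refine (mul_le_mul_of_nonneg_left (hle b) h0).trans (le_of_eq ?_)
      simp only [Pi.sub_apply]
      ring)
  simp only [Pi.sub_apply] at h
  rw [hrhs] at h
  linarith

/-- The Grushin heat kernel. -/
theorem exists_isHeatKernel (hN : 1 ≤ N) (hk : 1 ≤ k) : ∃ C : ℝ,
    IsHeatKernel (volume : Measure (Pt N k)) (((N : ℝ) + 2 * k) / 2) C
      (fun t a b => kernel a.1 b.1 (a.2 - b.2) t) := by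
  obtain ⟨C, hC, hle⟩ := exists_kernel_le (N := N) (k := k) hN hk
  exact ⟨C, {
    measurable := fun t ht => measurable_kernel_pt hN hk ht
    nonneg := fun t ht a b => kernel_nonneg _ _ hN hk _ ht
    symm := fun t ht a b => by rw [kernel_comm _ _ hN hk _ ht, neg_sub]
    mass := fun t ht a => lintegral_kernel_pt hN hk ht a
    const_pos := hC
    le := fun t ht a b => hle _ _ _ t ht
    continuousAt := fun t ht a b => continuousAt_kernel _ _ hN hk _ ht
    tendsto_zero := fun φ hφ hc a => tendsto_integral_kernel_mul hN hk hφ hc a }⟩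

end

/-! ### Smoothing estimates and time continuity for the integral operators of a heat kernel. -/

section HeatOperator

variable {Ω : Type*} [MeasurableSpace Ω] {μ : Measure Ω}

/-- The integral operator with kernel `κ t`. -/
noncomputable def heatOp (μ : Measure Ω) (κ : ℝ → Ω → Ω → ℝ) (t : ℝ) (φ : Ω → ℝ) : Ω → ℝ :=
  fun a => ∫ b, κ t a b * φ b ∂μ

theorem heatOp_congr_ae {κ : ℝ → Ω → Ω → ℝ} {φ ψ : Ω → ℝ} (t : ℝ) (h : φ =ᵐ[μ] ψ) :
    heatOp μ κ t φ = heatOp μ κ t ψ := by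
  funext a
  refine integral_congr_ae ?_
  filter_upwards [h] with b hb
  rw [hb]

/-- Scheffé's lemma: |f - g| = 2(g - f)⁺ - (g - f). The last term integrates to zero, and (g - f)⁺ ≤
|g| because f ≥ 0, so dominated convergence applies. -/
theorem tendsto_integral_abs_sub_of_integral_eq {ι : Type*} {l : Filter ι} [l.IsCountablyGenerated]
    {f : ι → Ω → ℝ} {g : Ω → ℝ} (hf : ∀ᶠ i in l, Integrable (f i) μ) (hg : Integrable g μ)
    (hf0 : ∀ᶠ i in l, ∀ a, 0 ≤ f i a) (heq : ∀ᶠ i in l, ∫ a, f i a ∂μ = ∫ a, g a ∂μ)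
    (hlim : ∀ a, Tendsto (fun i => f i a) l (𝓝 (g a))) :
    Tendsto (fun i => ∫ a, |f i a - g a| ∂μ) l (𝓝 0) := by
  have h1 : Tendsto (fun i => ∫ a, max (g a - f i a) 0 ∂μ) l (𝓝 (∫ _, (0 : ℝ) ∂μ)) := by
    refine tendsto_integral_filter_of_dominated_convergence (fun a => |g a|) ?_ ?_ hg.abs
      (Eventually.of_forall fun a => ?_)
    · filter_upwards [hf] with i hi
      exact ((hg.sub hi).pos_part).aestronglyMeasurable
    · filter_upwards [hf0] with i hi
      refine Eventually.of_forall fun a => ?_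
      rw [Real.norm_eq_abs, abs_of_nonneg (le_max_right _ _)]
      exact max_le (by linarith [hi a, le_abs_self (g a)]) (abs_nonneg _)
    · have := ((hlim a).const_sub (g a)).max (tendsto_const_nhds (x := (0 : ℝ)))
      simpa using this
  have h2 := h1.const_mul 2
  rw [integral_zero, mul_zero] at h2
  refine h2.congr' ?_
  filter_upwards [hf, heq] with i hi he
  have h3 : ∀ a, |f i a - g a| = 2 * max (g a - f i a) 0 - (g a - f i a) := by
    intro a
    rcases le_total (f i a) (g a) with h | h
    · rw [max_eq_left (by linarith), abs_of_nonpos (by linarith)]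
      ring
    · rw [max_eq_right (by linarith), abs_of_nonneg (by linarith)]
      ring
  simp_rw [h3]
  rw [integral_sub (f := fun a => 2 * max (g a - f i a) 0) (g := fun a => g a - f i a)
    ((hg.sub hi).pos_part.const_mul 2) (hg.sub hi), integral_sub hg hi, he, integral_const_mul, sub_self, sub_zero]

/-- For functions bounded by M, ∫|f|^s ≤ M^{s-1} ∫|f|. -/
theorem tendsto_eLpNorm_of_tendsto_integral {ι : Type*} {l : Filter ι} {f : ι → Ω → ℝ} {M : ℝ}
    (hf : ∀ᶠ i in l, Integrable (f i) μ) (hM : ∀ᶠ i in l, ∀ a, |f i a| ≤ M)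
    (hlim : Tendsto (fun i => ∫ a, |f i a| ∂μ) l (𝓝 0)) {s : ℝ} (hs : 1 ≤ s) :
    Tendsto (fun i => eLpNorm (f i) (ENNReal.ofReal s) μ) l (𝓝 0) := by
  have hs0 : 0 < s := one_pos.trans_le hs
  have h1 : Tendsto (fun i => (ENNReal.ofReal M ^ (s - 1) *
      ENNReal.ofReal (∫ a, |f i a| ∂μ)) ^ (1 / s)) l (𝓝 0) := by
    have h2 := (ENNReal.continuous_ofReal.tendsto _).comp hlim
    rw [ENNReal.ofReal_zero] at h2
    have h3 := ENNReal.Tendsto.const_mul (a := ENNReal.ofReal M ^ (s - 1)) h2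
      (Or.inr (ENNReal.rpow_ne_top_of_nonneg (by linarith) ENNReal.ofReal_ne_top))
    rw [mul_zero] at h3
    have h4 := (ENNReal.continuous_rpow_const (y := 1 / s)).tendsto 0 |>.comp h3
    rwa [ENNReal.zero_rpow_of_pos (by positivity)] at h4
  refine tendsto_of_tendsto_of_tendsto_of_le_of_le' tendsto_const_nhds h1
    (Eventually.of_forall fun _ => zero_le) ?_
  filter_upwards [hf, hM] with i hi hb
  rw [eLpNorm_eq_lintegral_rpow_enorm_toReal (by simpa using hs0) ENNReal.ofReal_ne_top,
    ENNReal.toReal_ofReal hs0.le]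
  refine ENNReal.rpow_le_rpow ?_ (by positivity)
  rw [ofReal_integral_eq_lintegral_ofReal hi.abs (Eventually.of_forall fun _ => abs_nonneg _),
    ← lintegral_const_mul' _ _ (ENNReal.rpow_ne_top_of_nonneg (by linarith) ENNReal.ofReal_ne_top)]
  refine lintegral_mono fun a => ?_
  rw [show s = (s - 1) + 1 by ring, ENNReal.rpow_add_of_nonneg _ _ (by linarith) zero_le_one,
    ENNReal.rpow_one, add_sub_cancel_right, ← Real.enorm_eq_ofReal_abs]
  have : ‖f i a‖ₑ ≤ ENNReal.ofReal M := by
    rw [Real.enorm_eq_ofReal_abs]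
    exact ENNReal.ofReal_le_ofReal (hb a)
  have hs1 : 0 ≤ s - 1 := by linarith
  gcongr

variable [TopologicalSpace Ω] {d C : ℝ} {κ : ℝ → Ω → Ω → ℝ}

namespace IsHeatKernel

variable (H : IsHeatKernel μ d C κ) {t : ℝ} (ht : 0 < t)
include H ht

theorem measurable_right (a : Ω) : Measurable (κ t a) :=
  (H.measurable t ht).comp (f := fun b => (a, b)) measurable_prodMk_left

theorem bound_pos : 0 < C * t ^ (-d) := mul_pos H.const_pos (Real.rpow_pos_of_pos ht _)

/-- Jensen's inequality for the probability measure with density κ(t,a,·), in the form of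
monotonicity of its L^q norms. -/
theorem lintegral_rpow_le {q : ℝ} (hq : 1 ≤ q) {g : Ω → ℝ≥0∞} (hg : AEMeasurable g μ) (a : Ω) :
    (∫⁻ b, ENNReal.ofReal (κ t a b) * g b ∂μ) ^ q ≤
      ∫⁻ b, ENNReal.ofReal (κ t a b) * g b ^ q ∂μ := by
  have hK := (H.measurable_right ht a).ennreal_ofReal
  set ν := μ.withDensity fun b => ENNReal.ofReal (κ t a b) with hν
  have hac : ν ≪ μ := withDensity_absolutelyContinuous _ _
  have : IsProbabilityMeasure ν := ⟨by
    rw [hν, withDensity_apply _ MeasurableSet.univ, Measure.restrict_univ, H.mass t ht a]⟩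
  have h := eLpNorm'_le_eLpNorm'_of_exponent_le one_pos hq ν (hg.mono_ac hac).aestronglyMeasurable
  have h0 : (0 : ℝ) < q := one_pos.trans_le hq
  simp only [eLpNorm', enorm_eq_self, ENNReal.rpow_one, div_one] at h
  have h2 := ENNReal.rpow_le_rpow h h0.le
  rw [← ENNReal.rpow_mul, one_div, inv_mul_cancel₀ h0.ne', ENNReal.rpow_one] at h2
  rwa [hν, lintegral_withDensity_eq_lintegral_mul₀ hK.aemeasurable hg,
    lintegral_withDensity_eq_lintegral_mul₀ hK.aemeasurable (hg.pow_const q)] at h2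

theorem lintegral_le (g : Ω → ℝ≥0∞) (a : Ω) : ∫⁻ b, ENNReal.ofReal (κ t a b) * g b ∂μ ≤
    ENNReal.ofReal (C * t ^ (-d)) * ∫⁻ b, g b ∂μ := by
  rw [← lintegral_const_mul' _ _ ENNReal.ofReal_ne_top]
  gcongr with b
  exact H.le t ht a b

/-- Tonelli; by symmetry the kernel has mass one in the first variable too. -/
theorem lintegral_lintegral [SFinite μ] {g : Ω → ℝ≥0∞} (hg : AEMeasurable g μ) :
    ∫⁻ a, ∫⁻ b, ENNReal.ofReal (κ t a b) * g b ∂μ ∂μ = ∫⁻ b, g b ∂μ := by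
  rw [lintegral_lintegral_swap ((H.measurable t ht).ennreal_ofReal.aemeasurable.mul hg.comp_snd)]
  refine lintegral_congr fun b => ?_
  have hm : Measurable fun a => ENNReal.ofReal (κ t a b) := by
    simp_rw [fun a => H.symm t ht a b]
    exact (H.measurable_right ht b).ennreal_ofReal
  rw [lintegral_mul_const _ hm]
  simp_rw [fun a => H.symm t ht a b]
  rw [H.mass t ht b, one_mul]

/-- Split the power s of the averaged function as q·(s-q)/q + q. By Jensen and the sup bound, the
first part is at most (BG)^{(s-q)/q}; the second part integrates to at most G by Jensen and Tonelli.
-/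
theorem lintegral_rpow_lintegral_le [SFinite μ] {q s : ℝ} (hq : 1 ≤ q) (hqs : q ≤ s)
    {g : Ω → ℝ≥0∞} (hg : AEMeasurable g μ) :
    (∫⁻ a, (∫⁻ b, ENNReal.ofReal (κ t a b) * g b ∂μ) ^ s ∂μ) ^ (1 / s) ≤
      ENNReal.ofReal (C * t ^ (-d)) ^ (1 / q - 1 / s) * (∫⁻ b, g b ^ q ∂μ) ^ (1 / q) := by
  have hq0 : 0 < q := one_pos.trans_le hq
  have hs0 : 0 < s := hq0.trans_le hqs
  set B := ENNReal.ofReal (C * t ^ (-d))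
  set G := ∫⁻ b, g b ^ q ∂μ
  have hpt : ∀ a, (∫⁻ b, ENNReal.ofReal (κ t a b) * g b ∂μ) ^ s ≤
      (B * G) ^ ((s - q) / q) * ∫⁻ b, ENNReal.ofReal (κ t a b) * g b ^ q ∂μ := by
    intro a
    have h1 := H.lintegral_rpow_le ht hq hg a
    have h2 := h1.trans (H.lintegral_le ht (fun b => g b ^ q) a)
    rw [show s = q * ((s - q) / q) + q by field_simp; ring,
      ENNReal.rpow_add_of_nonneg _ _ (mul_nonneg hq0.le (div_nonneg (sub_nonneg.2 hqs) hq0.le))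
      hq0.le, ENNReal.rpow_mul]
    have : 0 ≤ (q * ((s - q) / q) + q - q) / q := by
      rw [add_sub_cancel_right]
      exact div_nonneg (mul_nonneg hq0.le (div_nonneg (sub_nonneg.2 hqs) hq0.le)) hq0.le
    rw [show (q * ((s - q) / q) + q - q) / q = (s - q) / q by field_simp; ring] at this ⊢
    gcongr
  calc _ ≤ ((B * G) ^ ((s - q) / q) * G) ^ (1 / s) := by
        refine ENNReal.rpow_le_rpow ?_ (by positivity)
        refine (lintegral_mono hpt).trans ?_
        -- An infinite prefactor forces G = ∞, and the right side is infinite; otherwise the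
        -- constant can be pulled out of the integral without measurability.
        by_cases htop : (B * G) ^ ((s - q) / q) = ∞
        · have hG : G = ∞ := by
            by_contra hG
            refine ENNReal.rpow_ne_top_of_nonneg (div_nonneg (sub_nonneg.2 hqs) hq0.le) ?_ htop
            exact ENNReal.mul_ne_top ENNReal.ofReal_ne_top hG
          rw [htop, hG, ENNReal.top_mul_top]
          exact le_top
        · rw [lintegral_const_mul' _ _ htop, H.lintegral_lintegral ht (hg.pow_const q)]
    _ = _ := by
        have he : 0 ≤ (s - q) / q * (1 / s) :=
          mul_nonneg (div_nonneg (sub_nonneg.2 hqs) hq0.le) (by positivity)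
        rw [ENNReal.mul_rpow_of_nonneg _ _ (by positivity), ← ENNReal.rpow_mul,
          ENNReal.mul_rpow_of_nonneg _ _ he, mul_assoc,
          ← ENNReal.rpow_add_of_nonneg _ _ he (by positivity)]
        congr 2 <;> field_simp
        ring

theorem enorm_mul (φ : Ω → ℝ) (a b : Ω) :
    ‖κ t a b * φ b‖ₑ = ENNReal.ofReal (κ t a b) * ‖φ b‖ₑ := by
  rw [_root_.enorm_mul, Real.enorm_of_nonneg (H.nonneg t ht a b)]

theorem integrable {q : ℝ} (hq : 1 ≤ q) {φ : Ω → ℝ} (hφ : MemLp φ (ENNReal.ofReal q) μ) (a : Ω) :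
    Integrable (fun b => κ t a b * φ b) μ := by
  have hq0 : 0 < q := one_pos.trans_le hq
  refine ⟨(H.measurable_right ht a).aestronglyMeasurable.mul hφ.1, ?_⟩
  rw [hasFiniteIntegral_iff_enorm]
  simp_rw [H.enorm_mul ht]
  have h := (H.lintegral_rpow_le ht hq hφ.1.enorm a).trans
    (H.lintegral_le ht (fun b => ‖φ b‖ₑ ^ q) a)
  have hfin := lintegral_rpow_enorm_lt_top_of_eLpNorm_lt_top
    (by simpa using hq0) ENNReal.ofReal_ne_top hφ.2
  rw [ENNReal.toReal_ofReal hq0.le] at hfin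
  have h2 := h.trans_lt (ENNReal.mul_lt_top ENNReal.ofReal_lt_top hfin)
  exact (ENNReal.rpow_lt_top_iff_of_pos hq0).1 h2

theorem aestronglyMeasurable_heatOp [SFinite μ] {φ : Ω → ℝ} (hφ : AEStronglyMeasurable φ μ) :
    AEStronglyMeasurable (heatOp μ κ t φ) μ :=
  ((H.measurable t ht).aestronglyMeasurable.mul hφ.comp_snd).integral_prod_right'

theorem eLpNorm_heatOp_le [SFinite μ] {q s : ℝ} (hq : 1 ≤ q) (hqs : q ≤ s) {φ : Ω → ℝ}
    (hφ : AEStronglyMeasurable φ μ) :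
    eLpNorm (heatOp μ κ t φ) (ENNReal.ofReal s) μ ≤
      ENNReal.ofReal (C * t ^ (-d)) ^ (1 / q - 1 / s) * eLpNorm φ (ENNReal.ofReal q) μ := by
  have hq0 : 0 < q := one_pos.trans_le hq
  have hs0 : 0 < s := hq0.trans_le hqs
  rw [eLpNorm_eq_lintegral_rpow_enorm_toReal (by simpa using hs0) ENNReal.ofReal_ne_top,
    eLpNorm_eq_lintegral_rpow_enorm_toReal (by simpa using hq0) ENNReal.ofReal_ne_top,
    ENNReal.toReal_ofReal hq0.le, ENNReal.toReal_ofReal hs0.le]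
  refine le_trans ?_ (H.lintegral_rpow_lintegral_le ht hq hqs hφ.enorm)
  refine ENNReal.rpow_le_rpow (lintegral_mono fun a => ENNReal.rpow_le_rpow ?_ hs0.le)
    (by positivity)
  simp_rw [← H.enorm_mul ht φ a]
  exact enorm_integral_le_lintegral_enorm _

theorem memLp_heatOp [SFinite μ] {q s : ℝ} (hq : 1 ≤ q) (hqs : q ≤ s) {φ : Ω → ℝ}
    (hφ : MemLp φ (ENNReal.ofReal q) μ) : MemLp (heatOp μ κ t φ) (ENNReal.ofReal s) μ := by
  refine ⟨H.aestronglyMeasurable_heatOp ht hφ.1, (H.eLpNorm_heatOp_le ht hq hqs hφ.1).trans_lt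
    (ENNReal.mul_lt_top ?_ hφ.2)⟩
  refine ENNReal.rpow_lt_top_of_nonneg (sub_nonneg.2 ?_) ENNReal.ofReal_ne_top
  exact one_div_le_one_div_of_le (one_pos.trans_le hq) hqs

end IsHeatKernel

/-- The heat operator from `L^q` to `L^s`. -/
noncomputable def heatLp [SFinite μ] (H : IsHeatKernel μ d C κ) {q s : ℝ} (hq : 1 ≤ q)
    (hqs : q ≤ s) [Fact (1 ≤ ENNReal.ofReal q)] [Fact (1 ≤ ENNReal.ofReal s)] {t : ℝ}
    (ht : 0 < t) : Lp ℝ (ENNReal.ofReal q) μ →L[ℝ] Lp ℝ (ENNReal.ofReal s) μ :=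
  LinearMap.mkContinuous
    { toFun := fun φ => (H.memLp_heatOp ht hq hqs (Lp.memLp φ)).toLp _
      map_add' := fun φ ψ => by
        rw [← MemLp.toLp_add]
        refine MemLp.toLp_congr _ _ (Eventually.of_forall fun a => ?_)
        rw [heatOp_congr_ae t (Lp.coeFn_add φ ψ)]
        simp only [heatOp, Pi.add_apply, mul_add]
        exact integral_add (H.integrable ht hq (Lp.memLp φ) a) (H.integrable ht hq (Lp.memLp ψ) a)
      map_smul' := fun c φ => by
        rw [RingHom.id_apply, ← MemLp.toLp_const_smul]
        refine MemLp.toLp_congr _ _ (Eventually.of_forall fun a => ?_)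
        rw [heatOp_congr_ae t (Lp.coeFn_smul c φ)]
        simp only [heatOp, Pi.smul_apply, smul_eq_mul, mul_left_comm _ c]
        exact integral_const_mul _ _ }
    ((C * t ^ (-d)) ^ (1 / q - 1 / s)) fun φ => by
      have hB := H.bound_pos ht
      simp only [LinearMap.coe_mk, AddHom.coe_mk, Lp.norm_toLp]
      have h := H.eLpNorm_heatOp_le ht hq hqs (Lp.aestronglyMeasurable φ)
      have h2 := ENNReal.toReal_mono (ENNReal.mul_ne_top (ENNReal.rpow_ne_top_of_nonneg
        (sub_nonneg.2 (one_div_le_one_div_of_le (one_pos.trans_le hq) hqs)) ENNReal.ofReal_ne_top)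
        (Lp.eLpNorm_ne_top φ)) h
      rwa [ENNReal.toReal_mul, ← ENNReal.toReal_rpow, ENNReal.toReal_ofReal hB.le] at h2

section heatLp

variable [SFinite μ] (H : IsHeatKernel μ d C κ) {q s : ℝ} (hq : 1 ≤ q)
    (hqs : q ≤ s) [Fact (1 ≤ ENNReal.ofReal q)] [Fact (1 ≤ ENNReal.ofReal s)] {t : ℝ}
    (ht : 0 < t)

theorem coeFn_heatLp (φ : Lp ℝ (ENNReal.ofReal q) μ) :
    heatLp H hq hqs ht φ =ᵐ[μ] heatOp μ κ t φ :=
  MemLp.coeFn_toLp (H.memLp_heatOp ht hq hqs (Lp.memLp φ))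

theorem norm_heatLp_le : ‖heatLp H hq hqs ht‖ ≤ (C * t ^ (-d)) ^ (1 / q - 1 / s) :=
  LinearMap.mkContinuous_norm_le _ (Real.rpow_nonneg (H.bound_pos ht).le _) _

end heatLp

namespace IsHeatKernel

section

variable (H : IsHeatKernel μ d C κ) {t : ℝ} (ht : 0 < t)
include H ht

theorem integral_eq_one (a : Ω) : ∫ b, κ t a b ∂μ = 1 := by
  rw [integral_eq_lintegral_of_nonneg_ae (Eventually.of_forall (H.nonneg t ht a))
    (H.measurable_right ht a).aestronglyMeasurable, H.mass t ht a, ENNReal.toReal_one]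

theorem integrable_kernel (a : Ω) : Integrable (κ t a) μ := by
  refine ⟨(H.measurable_right ht a).aestronglyMeasurable, ?_⟩
  rw [hasFiniteIntegral_iff_ofReal (Eventually.of_forall (H.nonneg t ht a)), H.mass t ht a]
  exact ENNReal.one_lt_top

theorem heatOp_nonneg {φ : Ω → ℝ} (h0 : ∀ a, 0 ≤ φ a) (a : Ω) : 0 ≤ heatOp μ κ t φ a :=
  integral_nonneg fun b => mul_nonneg (H.nonneg t ht a b) (h0 b)

theorem heatOp_le {φ : Ω → ℝ} {M : ℝ} (hφ : Integrable φ μ) (hM : ∀ a, φ a ≤ M) (a : Ω) :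
    heatOp μ κ t φ a ≤ M := by
  have hi := H.integrable ht le_rfl (φ := φ) (by simpa [memLp_one_iff_integrable] using hφ) a
  calc heatOp μ κ t φ a ≤ ∫ b, κ t a b * M ∂μ := integral_mono hi
        ((H.integrable_kernel ht a).mul_const M)
        fun b => mul_le_mul_of_nonneg_left (hM b) (H.nonneg t ht a b)
    _ = M := by rw [integral_mul_const, H.integral_eq_one ht, one_mul]

theorem integrable_heatOp [SFinite μ] {φ : Ω → ℝ} (hφ : Integrable φ μ) :
    Integrable (heatOp μ κ t φ) μ := by
  have := H.memLp_heatOp ht le_rfl le_rfl (φ := φ) (q := 1)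
    (by simpa [memLp_one_iff_integrable] using hφ)
  simpa [memLp_one_iff_integrable] using this

theorem integral_heatOp [SFinite μ] {φ : Ω → ℝ} (hφ : Integrable φ μ) (h0 : ∀ a, 0 ≤ φ a) :
    ∫ a, heatOp μ κ t φ a ∂μ = ∫ a, φ a ∂μ := by
  rw [integral_eq_lintegral_of_nonneg_ae (Eventually.of_forall (H.heatOp_nonneg ht h0))
    (H.aestronglyMeasurable_heatOp ht hφ.1), integral_eq_lintegral_of_nonneg_ae
    (Eventually.of_forall h0) hφ.1,
    ← H.lintegral_lintegral ht hφ.aestronglyMeasurable.aemeasurable.ennreal_ofReal]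
  congr 1
  refine lintegral_congr fun a => ?_
  rw [heatOp, ofReal_integral_eq_lintegral_ofReal (H.integrable ht le_rfl (φ := φ)
    (by simpa [memLp_one_iff_integrable] using hφ) a)
    (Eventually.of_forall fun b => mul_nonneg (H.nonneg t ht a b) (h0 b))]
  refine lintegral_congr fun b => ?_
  rw [ENNReal.ofReal_mul (H.nonneg t ht a b)]

end

variable (H : IsHeatKernel μ d C κ)
include H

theorem tendsto_heatOp (hd : 0 ≤ d) {φ : Ω → ℝ} (hφ : Integrable φ μ) {t₀ : ℝ} (ht₀ : 0 < t₀)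
    (a : Ω) : Tendsto (fun t => heatOp μ κ t φ a) (𝓝 t₀) (𝓝 (heatOp μ κ t₀ φ a)) := by
  have hev : ∀ᶠ t in 𝓝 t₀, t₀ / 2 < t := eventually_gt_nhds (by linarith)
  refine tendsto_integral_filter_of_dominated_convergence
    (fun b => C * (t₀ / 2) ^ (-d) * |φ b|) ?_ ?_ (hφ.abs.const_mul _)
    (Eventually.of_forall fun b => (H.continuousAt t₀ ht₀ a b).tendsto.mul_const _)
  · filter_upwards [hev] with t ht
    exact (H.measurable_right (by linarith) a).aestronglyMeasurable.mul hφ.1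
  · filter_upwards [hev] with t ht
    have ht' : 0 < t := by linarith
    refine Eventually.of_forall fun b => ?_
    rw [Real.norm_eq_abs, abs_mul, abs_of_nonneg (H.nonneg t ht' a b)]
    refine mul_le_mul_of_nonneg_right ((H.le t ht' a b).trans ?_) (abs_nonneg _)
    refine mul_le_mul_of_nonneg_left ?_ H.const_pos.le
    exact Real.rpow_le_rpow_of_nonpos (by linarith) ht.le (by linarith)

/-- Pointwise convergence of `S(t) φ` to a function of the same mass improves to convergence
in `L^s`, for nonnegative bounded integrable `φ`. -/
theorem tendsto_eLpNorm_heatOp_sub [SFinite μ] {l : Filter ℝ} [l.IsCountablyGenerated] [l.NeBot]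
    (hl : ∀ᶠ t in l, 0 < t) {φ g : Ω → ℝ} (hφ : Integrable φ μ) (h0 : ∀ a, 0 ≤ φ a) {M : ℝ}
    (hM : ∀ a, φ a ≤ M) (hg : Integrable g μ) (heq : ∫ a, φ a ∂μ = ∫ a, g a ∂μ)
    (hlim : ∀ a, Tendsto (fun t => heatOp μ κ t φ a) l (𝓝 (g a))) {s : ℝ} (hs : 1 ≤ s) :
    Tendsto (fun t => eLpNorm (fun a => heatOp μ κ t φ a - g a) (ENNReal.ofReal s) μ) l (𝓝 0) := by
  have hg0 : ∀ a, 0 ≤ g a := fun a => ge_of_tendsto (hlim a) (by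
    filter_upwards [hl] with t ht using H.heatOp_nonneg ht h0 a)
  have hgM : ∀ a, g a ≤ M := fun a => le_of_tendsto (hlim a) (by
    filter_upwards [hl] with t ht using H.heatOp_le ht hφ hM a)
  refine tendsto_eLpNorm_of_tendsto_integral (M := M) ?_ ?_ ?_ hs
  · filter_upwards [hl] with t ht using (H.integrable_heatOp ht hφ).sub hg
  · filter_upwards [hl] with t ht a
    have h1 := H.heatOp_nonneg ht h0 a
    have h2 := H.heatOp_le ht hφ hM a
    rw [abs_le]
    constructor <;> linarith [hg0 a, hgM a]
  · refine tendsto_integral_abs_sub_of_integral_eq ?_ hg ?_ ?_ hlim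
    · filter_upwards [hl] with t ht using H.integrable_heatOp ht hφ
    · filter_upwards [hl] with t ht using H.heatOp_nonneg ht h0
    · filter_upwards [hl] with t ht
      rw [H.integral_heatOp ht hφ h0, heq]

theorem heatOp_sub {t : ℝ} (ht : 0 < t) {φ ψ : Ω → ℝ} (hφ : Integrable φ μ)
    (hψ : Integrable ψ μ) (a : Ω) :
    heatOp μ κ t (fun b => φ b - ψ b) a = heatOp μ κ t φ a - heatOp μ κ t ψ a := by
  simp only [heatOp, mul_sub]
  exact integral_sub
    (H.integrable ht le_rfl (φ := φ) (by simpa [memLp_one_iff_integrable] using hφ) a)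
    (H.integrable ht le_rfl (φ := ψ) (by simpa [memLp_one_iff_integrable] using hψ) a)

section

variable [OpensMeasurableSpace Ω] [IsFiniteMeasureOnCompacts μ] [SFinite μ]

/-- The limit operator T stands for S(t₀) or for the identity. Scheffé's argument needs nonnegative
functions, so φ is split into its positive and negative parts; additivity of T on this splitting
follows from uniqueness of pointwise limits. -/
theorem tendsto_eLpNorm_heatOp_sub_of_continuous {l : Filter ℝ} [l.IsCountablyGenerated]
    [l.NeBot] (hl : ∀ᶠ t in l, 0 < t) {T : (Ω → ℝ) → Ω → ℝ}
    (hTi : ∀ φ, Continuous φ → HasCompactSupport φ → Integrable (T φ) μ)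
    (hTeq : ∀ φ, Continuous φ → HasCompactSupport φ → (∀ a, 0 ≤ φ a) →
      ∫ a, φ a ∂μ = ∫ a, T φ a ∂μ)
    (hTlim : ∀ φ, Continuous φ → HasCompactSupport φ → ∀ a,
      Tendsto (fun t => heatOp μ κ t φ a) l (𝓝 (T φ a)))
    {φ : Ω → ℝ} (hφ : Continuous φ) (hc : HasCompactSupport φ) {s : ℝ} (hs : 1 ≤ s) :
    Tendsto (fun t => eLpNorm (fun a => heatOp μ κ t φ a - T φ a) (ENNReal.ofReal s) μ) l
      (𝓝 0) := by
  set φ₁ : Ω → ℝ := fun a => max (φ a) 0 with hφ₁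
  set φ₂ : Ω → ℝ := fun a => max (-φ a) 0 with hφ₂
  have c₁ : Continuous φ₁ := hφ.max continuous_const
  have c₂ : Continuous φ₂ := hφ.neg.max continuous_const
  have s₁ : HasCompactSupport φ₁ := hc.comp_left (g := fun x => max x 0) (by simp)
  have s₂ : HasCompactSupport φ₂ := hc.comp_left (g := fun x => max (-x) 0) (by simp)
  have i₁ := c₁.integrable_of_hasCompactSupport (μ := μ) s₁
  have i₂ := c₂.integrable_of_hasCompactSupport (μ := μ) s₂
  have hsub : φ = fun a => φ₁ a - φ₂ a := by
    funext a
    simp only [hφ₁, hφ₂]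
    rcases le_total (φ a) 0 with h | h
    · rw [max_eq_right h, max_eq_left (by linarith)]; ring
    · rw [max_eq_left h, max_eq_right (by linarith)]; ring
  obtain ⟨M₁, hM₁⟩ := s₁.exists_bound_of_continuous c₁
  obtain ⟨M₂, hM₂⟩ := s₂.exists_bound_of_continuous c₂
  have t₁ := H.tendsto_eLpNorm_heatOp_sub hl i₁ (fun a => le_max_right _ _)
    (fun a => (le_abs_self _).trans (hM₁ a)) (hTi _ c₁ s₁)
    (hTeq _ c₁ s₁ fun a => le_max_right _ _) (hTlim _ c₁ s₁) hs
  have t₂ := H.tendsto_eLpNorm_heatOp_sub hl i₂ (fun a => le_max_right _ _)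
    (fun a => (le_abs_self _).trans (hM₂ a)) (hTi _ c₂ s₂)
    (hTeq _ c₂ s₂ fun a => le_max_right _ _) (hTlim _ c₂ s₂) hs
  have hT : ∀ a, T φ a = T φ₁ a - T φ₂ a := fun a => by
    refine tendsto_nhds_unique (hTlim φ hφ hc a)
      (((hTlim _ c₁ s₁ a).sub (hTlim _ c₂ s₂ a)).congr' ?_)
    filter_upwards [hl] with t ht
    rw [← H.heatOp_sub ht i₁ i₂, ← hsub]
  have t₃ := t₁.add t₂
  rw [add_zero] at t₃
  refine tendsto_of_tendsto_of_tendsto_of_le_of_le' tendsto_const_nhds t₃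
    (Eventually.of_forall fun _ => zero_le) ?_
  filter_upwards [hl] with t ht
  have : (fun a => heatOp μ κ t φ a - T φ a) = (fun a => heatOp μ κ t φ₁ a - T φ₁ a) -
      fun a => heatOp μ κ t φ₂ a - T φ₂ a := by
    funext a
    rw [Pi.sub_apply, hT]
    conv_lhs => rw [hsub]
    rw [H.heatOp_sub ht i₁ i₂]
    ring
  rw [this]
  refine eLpNorm_sub_le ?_ ?_ ?_
  · exact ((H.integrable_heatOp ht i₁).sub (hTi _ c₁ s₁)).1
  · exact ((H.integrable_heatOp ht i₂).sub (hTi _ c₂ s₂)).1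
  · simpa using hs

theorem tendsto_eLpNorm_heatOp_sub_pos (hd : 0 ≤ d) {t₀ : ℝ} (ht₀ : 0 < t₀) {φ : Ω → ℝ}
    (hφ : Continuous φ) (hc : HasCompactSupport φ) {s : ℝ} (hs : 1 ≤ s) :
    Tendsto (fun t => eLpNorm (fun a => heatOp μ κ t φ a - heatOp μ κ t₀ φ a)
      (ENNReal.ofReal s) μ) (𝓝 t₀) (𝓝 0) :=
  H.tendsto_eLpNorm_heatOp_sub_of_continuous (eventually_gt_nhds ht₀) (T := heatOp μ κ t₀)
    (fun _ h hc => H.integrable_heatOp ht₀ (h.integrable_of_hasCompactSupport hc))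
    (fun _ h hc h0 => (H.integral_heatOp ht₀ (h.integrable_of_hasCompactSupport hc) h0).symm)
    (fun _ h hc => H.tendsto_heatOp hd (h.integrable_of_hasCompactSupport hc) ht₀) hφ hc hs

theorem tendsto_eLpNorm_heatOp_sub_zero {φ : Ω → ℝ}
    (hφ : Continuous φ) (hc : HasCompactSupport φ) {s : ℝ} (hs : 1 ≤ s) :
    Tendsto (fun t => eLpNorm (fun a => heatOp μ κ t φ a - φ a)
      (ENNReal.ofReal s) μ) (𝓝[>] 0) (𝓝 0) :=
  H.tendsto_eLpNorm_heatOp_sub_of_continuous (l := 𝓝[>] 0) self_mem_nhdsWithin (T := id)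
    (fun _ h hc => h.integrable_of_hasCompactSupport hc)
    (fun _ _ _ _ => rfl) (fun _ h hc => H.tendsto_zero _ h hc) hφ hc hs

end

end IsHeatKernel

end HeatOperator

/-! ### Strong continuity of the heat operators between Lebesgue spaces. -/

/-- Strong convergence on a dense set of an eventually bounded family of operators. -/
theorem tendsto_clm_apply_of_dense {X Y ι : Type*} [NormedAddCommGroup X] [NormedSpace ℝ X]
    [NormedAddCommGroup Y] [NormedSpace ℝ Y] {l : Filter ι} {T : ι → X →L[ℝ] Y} {T₀ : X →L[ℝ] Y}
    {M : ℝ} (hM : ∀ᶠ i in l, ‖T i‖ ≤ M) {D : Set X} (hD : Dense D)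
    (h : ∀ ψ ∈ D, Tendsto (fun i => T i ψ) l (𝓝 (T₀ ψ))) (φ : X) :
    Tendsto (fun i => T i φ) l (𝓝 (T₀ φ)) := by
  rw [Metric.tendsto_nhds]
  intro ε hε
  have hK : 0 < |M| + ‖T₀‖ + 1 := by positivity
  obtain ⟨ψ, hψD, hψ⟩ := Metric.dense_iff.1 hD φ (ε / 2 / (|M| + ‖T₀‖ + 1)) (by positivity)
  rw [Metric.mem_ball, dist_comm, dist_eq_norm, lt_div_iff₀ hK] at hψD
  filter_upwards [hM, Metric.tendsto_nhds.1 (h ψ hψ) (ε / 2) (half_pos hε)] with i hi hi'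
  rw [dist_eq_norm] at hi' ⊢
  have e : T i φ - T₀ φ = T i (φ - ψ) + (T i ψ - T₀ ψ) - T₀ (φ - ψ) := by
    rw [map_sub, map_sub]
    abel
  have h1 : ‖T i (φ - ψ)‖ ≤ |M| * ‖φ - ψ‖ :=
    (T i).le_of_opNorm_le (hi.trans (le_abs_self M)) _
  have h2 : ‖T₀ (φ - ψ)‖ ≤ ‖T₀‖ * ‖φ - ψ‖ := T₀.le_opNorm _
  rw [e]
  have h3 := norm_sub_le (T i (φ - ψ) + (T i ψ - T₀ ψ)) (T₀ (φ - ψ))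
  have h4 := norm_add_le (T i (φ - ψ)) (T i ψ - T₀ ψ)
  nlinarith [norm_nonneg (φ - ψ)]

theorem tendsto_Lp_of_eLpNorm {Ω : Type*} [MeasurableSpace Ω] {μ : Measure Ω} {q : ℝ≥0∞} [Fact (1 ≤ q)] {ι : Type*} {l : Filter ι}
    {F : ι → Lp ℝ q μ} {F₀ : Lp ℝ q μ} {f : ι → Ω → ℝ} {f₀ : Ω → ℝ}
    (hF : ∀ᶠ i in l, F i =ᵐ[μ] f i) (hF₀ : F₀ =ᵐ[μ] f₀)
    (h : Tendsto (fun i => eLpNorm (fun a => f i a - f₀ a) q μ) l (𝓝 0)) :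
    Tendsto F l (𝓝 F₀) := by
  rw [tendsto_iff_norm_sub_tendsto_zero]
  have h2 := (ENNReal.tendsto_toReal ENNReal.zero_ne_top).comp h
  rw [ENNReal.toReal_zero] at h2
  refine h2.congr' ?_
  filter_upwards [hF] with i hi
  rw [Lp.norm_def]
  simp only [Function.comp]
  congr 1
  exact eLpNorm_congr_ae ((Lp.coeFn_sub _ _).trans (hi.sub hF₀)).symm

theorem exponent_nonneg {q s : ℝ} (hq : 1 ≤ q) (hqs : q ≤ s) : 0 ≤ 1 / q - 1 / s :=
  sub_nonneg.2 (one_div_le_one_div_of_le (one_pos.trans_le hq) hqs)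

section Strong

variable {Ω : Type*} [TopologicalSpace Ω] [MeasurableSpace Ω] {μ : Measure Ω}

/-- The classes in `L^q` with a continuous compactly supported representative. -/
def contCompact (μ : Measure Ω) (q : ℝ≥0∞) : Set (Lp ℝ q μ) :=
  {φ | ∃ g : Ω → ℝ, Continuous g ∧ HasCompactSupport g ∧ φ =ᵐ[μ] g}

theorem dense_contCompact [NormalSpace Ω] [BorelSpace Ω] [R1Space Ω]
    [WeaklyLocallyCompactSpace Ω] [μ.Regular] {q : ℝ≥0∞} [Fact (1 ≤ q)] (hq : q ≠ ∞) :
    Dense (contCompact μ q) := by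
  rw [Metric.dense_iff]
  intro φ ε hε
  obtain ⟨g, hgs, hle, hgc, hgm⟩ := (Lp.memLp φ).exists_hasCompactSupport_eLpNorm_sub_le hq
    (ε := ENNReal.ofReal (ε / 2)) (by simpa using hε)
  refine ⟨hgm.toLp g, ?_, g, hgc, hgs, hgm.coeFn_toLp⟩
  rw [Metric.mem_ball, dist_comm, dist_eq_norm, Lp.norm_def]
  have : eLpNorm (φ - hgm.toLp g : Lp ℝ q μ) q μ ≤ ENNReal.ofReal (ε / 2) := by
    refine le_of_eq_of_le (eLpNorm_congr_ae ?_) hle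
    exact (Lp.coeFn_sub _ _).trans (EventuallyEq.rfl.sub hgm.coeFn_toLp)
  have h2 := ENNReal.toReal_mono ENNReal.ofReal_ne_top this
  rw [ENNReal.toReal_ofReal (by positivity)] at h2
  linarith

variable {d C : ℝ} {κ : ℝ → Ω → Ω → ℝ} [SFinite μ] (H : IsHeatKernel μ d C κ) {q s : ℝ}
    (hq : 1 ≤ q) (hqs : q ≤ s) [Fact (1 ≤ ENNReal.ofReal q)] [Fact (1 ≤ ENNReal.ofReal s)]

/-- The heat operator from `L^q` to `L^s` at positive times, extended by zero. -/
noncomputable def heatFamily (t : ℝ) : Lp ℝ (ENNReal.ofReal q) μ →L[ℝ] Lp ℝ (ENNReal.ofReal s) μ :=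
  if ht : 0 < t then heatLp H hq hqs ht else 0

/-- The heat operator from `L^q` to `L^s`, normalized to be bounded uniformly in time. -/
noncomputable def scaledHeat (t : ℝ) : Lp ℝ (ENNReal.ofReal q) μ →L[ℝ] Lp ℝ (ENNReal.ofReal s) μ :=
  t ^ (d * (1 / q - 1 / s)) • heatFamily H hq hqs t

theorem heatFamily_of_pos {t : ℝ} (ht : 0 < t) : heatFamily H hq hqs t = heatLp H hq hqs ht :=
  dif_pos ht

theorem heatFamily_of_nonpos {t : ℝ} (ht : t ≤ 0) : heatFamily H hq hqs t = 0 :=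
  dif_neg (not_lt.2 ht)

theorem scaledHeat_of_nonpos {t : ℝ} (ht : t ≤ 0) : scaledHeat H hq hqs t = 0 := by
  rw [scaledHeat, heatFamily_of_nonpos _ _ _ ht, smul_zero]

theorem coeFn_heatFamily {t : ℝ} (ht : 0 < t) (φ : Lp ℝ (ENNReal.ofReal q) μ) :
    heatFamily H hq hqs t φ =ᵐ[μ] heatOp μ κ t φ := by
  rw [heatFamily_of_pos _ _ _ ht]
  exact coeFn_heatLp H hq hqs ht φ

theorem coeFn_heatFamily_of_ae {t : ℝ} (ht : 0 < t) {φ : Lp ℝ (ENNReal.ofReal q) μ} {g : Ω → ℝ}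
    (hg : φ =ᵐ[μ] g) : heatFamily H hq hqs t φ =ᵐ[μ] heatOp μ κ t g := by
  rw [← heatOp_congr_ae t hg]
  exact coeFn_heatFamily H hq hqs ht φ

theorem norm_scaledHeat_le (t : ℝ) : ‖scaledHeat H hq hqs t‖ ≤ C ^ (1 / q - 1 / s) := by
  have hC := H.const_pos
  rcases le_or_gt t 0 with ht | ht
  · rw [scaledHeat_of_nonpos _ _ _ ht, norm_zero]
    positivity
  · rw [scaledHeat, norm_smul, Real.norm_eq_abs, abs_of_pos (by positivity),
      heatFamily_of_pos _ _ _ ht]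
    refine (mul_le_mul_of_nonneg_left (norm_heatLp_le H hq hqs ht) (by positivity)).trans
      (le_of_eq ?_)
    rw [Real.mul_rpow hC.le (by positivity), ← Real.rpow_mul ht.le, mul_left_comm,
      ← Real.rpow_add ht]
    simp

section

variable [NormalSpace Ω] [BorelSpace Ω] [R1Space Ω] [WeaklyLocallyCompactSpace Ω] [μ.Regular]

theorem continuousAt_heatFamily (hd : 0 ≤ d) (φ : Lp ℝ (ENNReal.ofReal q) μ) {t₀ : ℝ}
    (ht₀ : 0 < t₀) : ContinuousAt (fun t => heatFamily H hq hqs t φ) t₀ := by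
  have hC := H.const_pos
  have hev : ∀ᶠ t in 𝓝 t₀, t₀ / 2 < t := eventually_gt_nhds (by linarith)
  refine tendsto_clm_apply_of_dense (M := (C * (t₀ / 2) ^ (-d)) ^ (1 / q - 1 / s)) ?_
    (dense_contCompact (μ := μ) ENNReal.ofReal_ne_top) (fun ψ hψ => ?_) φ
  · filter_upwards [hev] with t ht
    have ht' : 0 < t := by linarith
    rw [heatFamily_of_pos _ _ _ ht']
    refine (norm_heatLp_le H hq hqs ht').trans ?_
    refine Real.rpow_le_rpow (by positivity) ?_ (exponent_nonneg hq hqs)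
    refine mul_le_mul_of_nonneg_left ?_ H.const_pos.le
    exact Real.rpow_le_rpow_of_nonpos (by linarith) ht.le (by linarith)
  · obtain ⟨g, hgc, hgs, hg⟩ := hψ
    refine tendsto_Lp_of_eLpNorm (f := fun t => heatOp μ κ t g) ?_
      (coeFn_heatFamily_of_ae H hq hqs ht₀ hg)
      (H.tendsto_eLpNorm_heatOp_sub_pos hd ht₀ hgc hgs (hq.trans hqs))
    filter_upwards [hev] with t ht
    exact coeFn_heatFamily_of_ae H hq hqs (by linarith) hg

theorem continuousAt_scaledHeat (hd : 0 ≤ d) (φ : Lp ℝ (ENNReal.ofReal q) μ) {t₀ : ℝ}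
    (ht₀ : 0 < t₀) : ContinuousAt (fun t => scaledHeat H hq hqs t φ) t₀ :=
  (continuousAt_id.rpow_const (Or.inl ht₀.ne')).smul (continuousAt_heatFamily H hq hqs hd φ ht₀)

theorem tendsto_heatFamily_zero (φ : Lp ℝ (ENNReal.ofReal q) μ) :
    Tendsto (fun t => heatFamily H hq le_rfl t φ) (𝓝[>] 0) (𝓝 φ) := by
  refine tendsto_clm_apply_of_dense (M := 1) (T₀ := ContinuousLinearMap.id ℝ _) ?_
    (dense_contCompact (μ := μ) ENNReal.ofReal_ne_top) (fun ψ hψ => ?_) φ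
  · filter_upwards [self_mem_nhdsWithin] with t ht
    rw [heatFamily_of_pos _ _ _ ht]
    refine (norm_heatLp_le H hq le_rfl ht).trans (le_of_eq ?_)
    rw [sub_self, Real.rpow_zero]
  · obtain ⟨g, hgc, hgs, hg⟩ := hψ
    refine tendsto_Lp_of_eLpNorm (f := fun t => heatOp μ κ t g) ?_ hg
      (H.tendsto_eLpNorm_heatOp_sub_zero hgc hgs hq)
    filter_upwards [self_mem_nhdsWithin] with t ht
    exact coeFn_heatFamily_of_ae H hq le_rfl ht hg

/-- For φ in the dense class, which lies in L^s, S(t) is a contraction on L^s and the positive power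
of t tends to zero; the uniform bound extends this to L^q. It makes the normalized evolution,
extended by 0 to t ≤ 0, continuous at the origin. -/
theorem tendsto_scaledHeat_zero (hd : 0 < d) (hlt : q < s) (φ : Lp ℝ (ENNReal.ofReal q) μ) :
    Tendsto (fun t => scaledHeat H hq hqs t φ) (𝓝[>] 0) (𝓝 0) := by
  have hs : 1 ≤ s := hq.trans hqs
  have he : 0 < d * (1 / q - 1 / s) :=
    mul_pos hd (sub_pos.2 (one_div_lt_one_div_of_lt (one_pos.trans_le hq) hlt))
  refine tendsto_clm_apply_of_dense (T₀ := 0)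
    (Eventually.of_forall fun t => norm_scaledHeat_le H hq hqs t)
    (dense_contCompact (μ := μ) ENNReal.ofReal_ne_top) (fun ψ hψ => ?_) φ
  obtain ⟨g, hgc, hgs, hg⟩ := hψ
  have hgm : MemLp g (ENNReal.ofReal s) μ := hgc.memLp_of_hasCompactSupport hgs
  have h1 : Tendsto (fun t : ℝ => t ^ (d * (1 / q - 1 / s)) *
      (eLpNorm g (ENNReal.ofReal s) μ).toReal) (𝓝[>] 0) (𝓝 0) := by
    have h2 : ContinuousAt (fun t : ℝ => t ^ (d * (1 / q - 1 / s))) 0 :=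
      continuousAt_id.rpow_const (Or.inr he.le)
    have h3 := (h2.tendsto.mono_left (nhdsWithin_le_nhds (s := Ioi 0))).mul_const
      (eLpNorm g (ENNReal.ofReal s) μ).toReal
    rwa [Real.zero_rpow he.ne', zero_mul] at h3
  refine squeeze_zero_norm' ?_ h1
  filter_upwards [self_mem_nhdsWithin] with t ht
  have ht' : (0 : ℝ) < t := ht
  rw [scaledHeat, _root_.smul_apply, norm_smul, Real.norm_eq_abs,
    abs_of_pos (Real.rpow_pos_of_pos ht' _)]
  refine mul_le_mul_of_nonneg_left ?_ (Real.rpow_nonneg ht'.le _)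
  rw [Lp.norm_def, eLpNorm_congr_ae (coeFn_heatFamily_of_ae H hq hqs ht' hg)]
  refine ENNReal.toReal_mono hgm.2.ne ?_
  refine (H.eLpNorm_heatOp_le ht' hs le_rfl hgm.1).trans (le_of_eq ?_)
  rw [sub_self, ENNReal.rpow_zero, one_mul]

/-- The normalized linear evolution is continuous on the whole line. -/
theorem continuous_scaledHeat (hd : 0 < d) (hlt : q < s) (φ : Lp ℝ (ENNReal.ofReal q) μ) :
    Continuous (fun t => scaledHeat H hq hqs t φ) := by
  rw [continuous_iff_continuousAt]
  intro t
  rcases lt_trichotomy t 0 with ht | rfl | ht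
  · refine (continuousAt_const (y := (0 : Lp ℝ (ENNReal.ofReal s) μ))).congr ?_
    filter_upwards [eventually_lt_nhds ht] with τ hτ
    rw [scaledHeat_of_nonpos _ _ _ hτ.le, _root_.zero_apply]
  · rw [ContinuousAt, scaledHeat_of_nonpos _ _ _ le_rfl, _root_.zero_apply,
      ← nhdsLE_sup_nhdsGT]
    refine Tendsto.sup ?_ (tendsto_scaledHeat_zero H hq hqs hd hlt φ)
    refine (tendsto_const_nhds (x := (0 : Lp ℝ (ENNReal.ofReal s) μ))).congr' ?_
    filter_upwards [self_mem_nhdsWithin] with τ hτ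
    rw [scaledHeat_of_nonpos _ _ _ hτ, _root_.zero_apply]
  · exact continuousAt_scaledHeat H hq hqs hd.le φ ht

end

end Strong

/-! ### The power nonlinearity -/

/-- Bernoulli's inequality for b/a, multiplied by a^ρ. -/
theorem rpow_sub_rpow_le {ρ a b : ℝ} (hρ : 1 ≤ ρ) (hb : 0 ≤ b) (hba : b ≤ a) :
    a ^ ρ - b ^ ρ ≤ ρ * (a - b) * a ^ (ρ - 1) := by
  rcases (hb.trans hba).eq_or_lt with rfl | ha
  · obtain rfl : b = 0 := le_antisymm hba hb
    simp
  have h := one_add_mul_self_le_rpow_one_add (s := b / a - 1)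
    (by have := div_nonneg hb ha.le; linarith) hρ
  rw [add_sub_cancel, Real.div_rpow hb ha.le, le_div_iff₀ (by positivity)] at h
  have h1 : a ^ ρ = a * a ^ (ρ - 1) := by
    rw [← Real.rpow_one_add' ha.le (by linarith)]
    congr 1
    ring
  have h2 : (1 + ρ * (b / a - 1)) * a ^ ρ = a ^ ρ - ρ * (a - b) * a ^ (ρ - 1) := by
    rw [h1]
    field_simp
    ring
  linarith

/-- For equal signs this is `rpow_sub_rpow_le`, up to oddness. For opposite signs |a - b| = |a| +
|b|, and each term is bounded separately. -/
theorem abs_pow_mul_sub_le {ρ : ℝ} (hρ : 1 < ρ) (a b : ℝ) :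
    |(|a| ^ (ρ - 1) * a - |b| ^ (ρ - 1) * b)| ≤ ρ * (|a - b| * (|a| + |b|) ^ (ρ - 1)) := by
  have hρ1 : 0 < ρ - 1 := by linarith
  have hpow : ∀ c : ℝ, 0 ≤ c → c ^ (ρ - 1) * c = c ^ ρ := fun c hc => by
    rw [← Real.rpow_add_one' hc (by linarith)]
    congr 1
    ring
  have same : ∀ a b : ℝ, 0 ≤ b → b ≤ a →
      |(|a| ^ (ρ - 1) * a - |b| ^ (ρ - 1) * b)| ≤ ρ * (|a - b| * (|a| + |b|) ^ (ρ - 1)) := by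
    intro a b hb hba
    have ha := hb.trans hba
    rw [abs_of_nonneg ha, abs_of_nonneg hb, hpow a ha, hpow b hb, abs_of_nonneg
      (sub_nonneg.2 (Real.rpow_le_rpow hb hba (by linarith))), abs_of_nonneg (sub_nonneg.2 hba),
      ← mul_assoc]
    refine (rpow_sub_rpow_le hρ.le hb hba).trans ?_
    have := sub_nonneg.2 hba
    gcongr
    linarith
  have opp : ∀ a b : ℝ, 0 ≤ a → b ≤ 0 →
      |(|a| ^ (ρ - 1) * a - |b| ^ (ρ - 1) * b)| ≤ ρ * (|a - b| * (|a| + |b|) ^ (ρ - 1)) := by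
    intro a b ha hb
    have hb' : 0 ≤ -b := by linarith
    rw [abs_of_nonneg ha, abs_of_nonpos hb]
    have e : a ^ (ρ - 1) * a - (-b) ^ (ρ - 1) * b = a ^ (ρ - 1) * a + (-b) ^ (ρ - 1) * (-b) := by
      ring
    rw [e, abs_of_nonneg (by positivity), abs_of_nonneg (by linarith)]
    have h1 : a ^ (ρ - 1) * a ≤ (a + -b) ^ (ρ - 1) * a := by gcongr; linarith
    have h2 : (-b) ^ (ρ - 1) * (-b) ≤ (a + -b) ^ (ρ - 1) * (-b) := by gcongr; linarith
    have h3 : 0 ≤ (a - b) * (a + -b) ^ (ρ - 1) :=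
      mul_nonneg (by linarith) (Real.rpow_nonneg (by linarith) _)
    nlinarith
  have neg : ∀ a b : ℝ, |(|(-a)| ^ (ρ - 1) * (-a) - |(-b)| ^ (ρ - 1) * (-b))| =
      |(|a| ^ (ρ - 1) * a - |b| ^ (ρ - 1) * b)| := fun a b => by
    rw [abs_neg, abs_neg, ← abs_neg]
    congr 1
    ring
  rcases le_total 0 a with ha | ha <;> rcases le_total 0 b with hb | hb
  · rcases le_total b a with h | h
    · exact same a b hb h
    · rw [abs_sub_comm, abs_sub_comm a b, add_comm |a|]
      exact same b a ha h
  · exact opp a b ha hb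
  · rw [abs_sub_comm, abs_sub_comm a b, add_comm |a|]
    exact opp b a hb ha
  · rw [← neg a b, ← abs_neg a, ← abs_neg b, ← abs_neg (a - b), neg_sub', ← neg_add_eq_sub]
    rcases le_total a b with h | h
    · have := same (-a) (-b) (by linarith) (by linarith)
      simpa [abs_neg, sub_eq_add_neg, add_comm] using this
    · have := same (-b) (-a) (by linarith) (by linarith)
      rw [abs_sub_comm, abs_sub_comm (-b), add_comm |(-b)|] at this
      simpa [abs_neg, sub_eq_add_neg, add_comm] using this

section PowLp

variable {Ω : Type*} [MeasurableSpace Ω] {μ : Measure Ω} {r ρ : ℝ}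

theorem holderTriple_ofReal (hr : 0 < r) (hρ : 1 < ρ) :
    ENNReal.HolderTriple (ENNReal.ofReal r) (ENNReal.ofReal (r / (ρ - 1)))
      (ENNReal.ofReal (r / ρ)) := by
  have hρ1 : 0 < ρ - 1 := by linarith
  have hρ0 : 0 < ρ := by linarith
  refine ⟨?_⟩
  rw [← ENNReal.ofReal_inv_of_pos hr, ← ENNReal.ofReal_inv_of_pos (by positivity),
    ← ENNReal.ofReal_inv_of_pos (by positivity), ← ENNReal.ofReal_add (by positivity)
    (by positivity)]
  congr 1
  field_simp
  ring

/-- The pointwise Lipschitz bound followed by Hölder with ρ/r = 1/r + (ρ-1)/r. -/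
theorem eLpNorm_pow_sub_le (hr : 1 ≤ r) (hρ : 1 < ρ) {u v : Ω → ℝ}
    (hu : AEStronglyMeasurable u μ) (hv : AEStronglyMeasurable v μ) :
    eLpNorm (fun a => |u a| ^ (ρ - 1) * u a - |v a| ^ (ρ - 1) * v a) (ENNReal.ofReal (r / ρ)) μ ≤
      ENNReal.ofReal ρ * (eLpNorm (u - v) (ENNReal.ofReal r) μ *
        (eLpNorm u (ENNReal.ofReal r) μ + eLpNorm v (ENNReal.ofReal r) μ) ^ (ρ - 1)) := by
  have hρ1 : 0 < ρ - 1 := by linarith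
  have hr0 : 0 < r := one_pos.trans_le hr
  have hT := holderTriple_ofReal hr0 hρ
  set h : Ω → ℝ := fun a => |u a| + |v a| with hh
  have hm : AEStronglyMeasurable h μ := hu.norm.add hv.norm
  have h1 : eLpNorm (fun a => |u a| ^ (ρ - 1) * u a - |v a| ^ (ρ - 1) * v a)
      (ENNReal.ofReal (r / ρ)) μ ≤
      ENNReal.ofReal ρ * eLpNorm ((u - v) • fun a => ‖h a‖ ^ (ρ - 1)) (ENNReal.ofReal (r / ρ)) μ := by
    refine eLpNorm_le_mul_eLpNorm_of_ae_le_mul (Eventually.of_forall fun a => ?_) _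
    have h0 : 0 ≤ |u a| + |v a| := by positivity
    simp only [Real.norm_eq_abs, Pi.smul_apply', Pi.sub_apply, smul_eq_mul, hh]
    rw [abs_mul, abs_of_nonneg h0, abs_of_nonneg (Real.rpow_nonneg h0 _)]
    exact abs_pow_mul_sub_le hρ _ _
  refine h1.trans ?_
  gcongr
  refine (eLpNorm_smul_le_mul_eLpNorm (p := ENNReal.ofReal r)
    (q := ENNReal.ofReal (r / (ρ - 1))) ?_ (hu.sub hv)).trans ?_
  · exact (hm.norm.aemeasurable.pow_const (ρ - 1)).aestronglyMeasurable
  · rw [eLpNorm_norm_rpow h hρ1, ← ENNReal.ofReal_mul (by positivity),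
      div_mul_cancel₀ _ hρ1.ne']
    gcongr
    have := eLpNorm_add_le (p := ENNReal.ofReal r) hu.norm hv.norm (by simpa using hr)
    rw [eLpNorm_norm, eLpNorm_norm] at this
    exact this

theorem memLp_pow (hr : 1 ≤ r) (hρ : 1 < ρ) {u : Ω → ℝ} (hu : MemLp u (ENNReal.ofReal r) μ) :
    MemLp (fun a => |u a| ^ (ρ - 1) * u a) (ENNReal.ofReal (r / ρ)) μ := by
  have hm : AEStronglyMeasurable (fun a => |u a| ^ (ρ - 1) * u a) μ :=
    ((hu.1.norm.aemeasurable.pow_const (ρ - 1)).mul hu.1.aemeasurable).aestronglyMeasurable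
  refine ⟨hm, ?_⟩
  have h := eLpNorm_pow_sub_le (v := fun _ => (0 : ℝ)) hr hρ hu.1 aestronglyMeasurable_const
  simp only [mul_zero, sub_zero, eLpNorm_zero', add_zero] at h
  refine h.trans_lt (ENNReal.mul_lt_top ENNReal.ofReal_lt_top (ENNReal.mul_lt_top ?_
    (ENNReal.rpow_lt_top_of_nonneg (by linarith) hu.2.ne)))
  exact (hu.sub MemLp.zero').2

/-- The map `u ↦ |u|^{ρ-1} u` from `L^r` to `L^{r/ρ}`. -/
noncomputable def powLp (hr : 1 ≤ r) (hρ : 1 < ρ) (u : Lp ℝ (ENNReal.ofReal r) μ) :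
    Lp ℝ (ENNReal.ofReal (r / ρ)) μ :=
  (memLp_pow hr hρ (Lp.memLp u)).toLp _

theorem coeFn_powLp (hr : 1 ≤ r) (hρ : 1 < ρ) (u : Lp ℝ (ENNReal.ofReal r) μ) :
    powLp hr hρ u =ᵐ[μ] fun a => |u a| ^ (ρ - 1) * u a :=
  MemLp.coeFn_toLp (memLp_pow hr hρ (Lp.memLp u))

theorem powLp_zero (hr : 1 ≤ r) (hρ : 1 < ρ) :
    powLp hr hρ (0 : Lp ℝ (ENNReal.ofReal r) μ) = 0 := by
  refine Lp.ext ?_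
  filter_upwards [coeFn_powLp hr hρ (0 : Lp ℝ (ENNReal.ofReal r) μ),
    Lp.coeFn_zero ℝ (ENNReal.ofReal r) μ, Lp.coeFn_zero ℝ (ENNReal.ofReal (r / ρ)) μ]
    with a h1 h2 h3
  rw [h1, h2, h3]
  simp

theorem norm_powLp_sub_le (hr : 1 ≤ r) (hρ : 1 < ρ) (u v : Lp ℝ (ENNReal.ofReal r) μ) :
    ‖powLp hr hρ u - powLp hr hρ v‖ ≤ ρ * (‖u - v‖ * (‖u‖ + ‖v‖) ^ (ρ - 1)) := by
  have h := eLpNorm_pow_sub_le (r := r) hr hρ (Lp.aestronglyMeasurable u)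
    (Lp.aestronglyMeasurable v)
  have e1 : eLpNorm (powLp hr hρ u - powLp hr hρ v : Lp ℝ (ENNReal.ofReal (r / ρ)) μ)
      (ENNReal.ofReal (r / ρ)) μ = eLpNorm
      (fun a => |u a| ^ (ρ - 1) * u a - |v a| ^ (ρ - 1) * v a) (ENNReal.ofReal (r / ρ)) μ :=
    eLpNorm_congr_ae ((Lp.coeFn_sub _ _).trans
      ((coeFn_powLp hr hρ u).sub (coeFn_powLp hr hρ v)))
  rw [← e1, ← eLpNorm_congr_ae (Lp.coeFn_sub u v)] at h
  have hfin : ENNReal.ofReal ρ * (eLpNorm (u - v : Lp ℝ (ENNReal.ofReal r) μ) (ENNReal.ofReal r) μ *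
        (eLpNorm u (ENNReal.ofReal r) μ + eLpNorm v (ENNReal.ofReal r) μ) ^ (ρ - 1)) ≠ ∞ :=
    ENNReal.mul_ne_top ENNReal.ofReal_ne_top (ENNReal.mul_ne_top (Lp.eLpNorm_ne_top _)
      (ENNReal.rpow_ne_top_of_nonneg (by linarith)
        (ENNReal.add_ne_top.2 ⟨Lp.eLpNorm_ne_top _, Lp.eLpNorm_ne_top _⟩)))
  have h2 := ENNReal.toReal_mono hfin h
  rwa [ENNReal.toReal_mul, ENNReal.toReal_mul, ENNReal.toReal_ofReal (by linarith),
    ← ENNReal.toReal_rpow, ENNReal.toReal_add (Lp.eLpNorm_ne_top _) (Lp.eLpNorm_ne_top _),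
    ← Lp.norm_def, ← Lp.norm_def, ← Lp.norm_def, ← Lp.norm_def] at h2

end PowLp

/-! ### Duhamel integrals on the unit interval and the fixed point -/

section FixedPoint

variable {X Y : Type*} [NormedAddCommGroup X] [NormedSpace ℝ X]
  [NormedAddCommGroup Y] [NormedSpace ℝ Y]

/-- Uniformly bounded operators, vanishing for `t ≤ 0`, strongly continuous for `t > 0`. -/
structure IsEvolution (K : ℝ) (A : ℝ → Y →L[ℝ] X) : Prop where
  norm_le : ∀ t, ‖A t‖ ≤ K
  of_nonpos : ∀ t ≤ 0, A t = 0
  continuousAt : ∀ y, ∀ t, 0 < t → ContinuousAt (fun t => A t y) t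

/-- The Duhamel integral in the variable `σ = s / t`. -/
noncomputable def duhamel (A : ℝ → Y →L[ℝ] X) (w : ℝ → ℝ) (g : ℝ → Y) (t : ℝ) : X :=
  ∫ σ in Ioo (0 : ℝ) 1, w σ • A (t * (1 - σ)) (g (t * σ))

namespace IsEvolution

variable {K : ℝ} {A : ℝ → Y →L[ℝ] X} (hA : IsEvolution K A) {w : ℝ → ℝ} {g : ℝ → Y}
include hA

theorem bound_nonneg : 0 ≤ K := (norm_nonneg _).trans (hA.norm_le 0)

/-- Strong continuity and a uniform operator bound give joint continuity; norm continuity of A is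
not required. -/
theorem continuousAt_apply {S : Type*} [TopologicalSpace S] {τ : S → ℝ} {y : S → Y} {s : S}
    (hτ : ContinuousAt τ s) (hy : ContinuousAt y s) (h0 : 0 < τ s) :
    ContinuousAt (fun s => A (τ s) (y s)) s := by
  have h1 : Tendsto (fun s' => K * ‖y s' - y s‖ + ‖A (τ s') (y s) - A (τ s) (y s)‖) (𝓝 s)
      (𝓝 0) := by
    have h2 := (tendsto_iff_norm_sub_tendsto_zero.1 hy).const_mul K
    have h3 := tendsto_iff_norm_sub_tendsto_zero.1
      ((hA.continuousAt (y s) (τ s) h0).tendsto.comp hτ)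
    simpa using h2.add h3
  refine tendsto_iff_norm_sub_tendsto_zero.2 (squeeze_zero (fun _ => norm_nonneg _)
    (fun s' => ?_) h1)
  have e : A (τ s') (y s') - A (τ s) (y s) =
      A (τ s') (y s' - y s) + (A (τ s') (y s) - A (τ s) (y s)) := by
    rw [map_sub]
    abel
  rw [e]
  exact (norm_add_le _ _).trans (add_le_add_left ((A (τ s')).le_of_opNorm_le (hA.norm_le _) _) _)

theorem continuousAt_apply_mul (hg : Continuous g) (hg0 : ∀ t ≤ 0, g t = 0) {σ : ℝ}
    (hσ : σ ∈ Ioo (0 : ℝ) 1) (t : ℝ) :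
    ContinuousAt (fun t => A (t * (1 - σ)) (g (t * σ))) t := by
  have hσ1 : 0 < 1 - σ := sub_pos.2 hσ.2
  rcases lt_or_ge 0 t with ht | ht
  · exact hA.continuousAt_apply (by fun_prop) (by fun_prop) (mul_pos ht hσ1)
  -- For t ≤ 0 the forcing vanishes at tσ and is small nearby, so boundedness of A suffices,
  -- although A need not be continuous at time zero.
  · have h0 : g (t * σ) = 0 := hg0 _ (mul_nonpos_of_nonpos_of_nonneg ht hσ.1.le)
    have h1 : Tendsto (fun t' => K * ‖g (t' * σ)‖) (𝓝 t) (𝓝 0) := by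
      have : Continuous fun t' => K * ‖g (t' * σ)‖ := by fun_prop
      simpa [h0] using this.tendsto t
    rw [ContinuousAt, h0, map_zero]
    exact squeeze_zero_norm (fun t' => (A _).le_of_opNorm_le (hA.norm_le _) _) h1

theorem aestronglyMeasurable_integrand (hw : IntegrableOn w (Ioo 0 1)) (hg : Continuous g)
    (t : ℝ) : AEStronglyMeasurable (fun σ => w σ • A (t * (1 - σ)) (g (t * σ)))
      (volume.restrict (Ioo 0 1)) := by
  refine hw.aestronglyMeasurable.smul ?_
  rcases le_or_gt t 0 with ht | ht
  · refine (aestronglyMeasurable_const (b := (0 : X))).congr ?_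
    filter_upwards [ae_restrict_mem measurableSet_Ioo] with σ hσ
    rw [hA.of_nonpos _ (mul_nonpos_of_nonpos_of_nonneg ht (sub_nonneg.2 hσ.2.le)),
      _root_.zero_apply]
  · refine ContinuousOn.aestronglyMeasurable (fun σ hσ => ?_) measurableSet_Ioo
    exact (hA.continuousAt_apply (τ := fun σ => t * (1 - σ)) (y := fun σ => g (t * σ))
      (by fun_prop) (by fun_prop) (mul_pos ht (sub_pos.2 hσ.2))).continuousWithinAt

theorem norm_integrand_le {G : ℝ} (hG : ∀ t, ‖g t‖ ≤ G) (t σ : ℝ) :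
    ‖w σ • A (t * (1 - σ)) (g (t * σ))‖ ≤ |w σ| * (K * G) := by
  rw [norm_smul, Real.norm_eq_abs]
  have := hA.bound_nonneg
  refine mul_le_mul_of_nonneg_left (((A _).le_of_opNorm_le (hA.norm_le _) _).trans ?_)
    (abs_nonneg _)
  gcongr
  exact hG _

theorem integrableOn_integrand (hw : IntegrableOn w (Ioo 0 1)) (hg : Continuous g) {G : ℝ}
    (hG : ∀ t, ‖g t‖ ≤ G) (t : ℝ) :
    IntegrableOn (fun σ => w σ • A (t * (1 - σ)) (g (t * σ))) (Ioo 0 1) :=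
  (hw.abs.mul_const (K * G)).mono' (hA.aestronglyMeasurable_integrand hw hg t)
    (Eventually.of_forall fun σ => hA.norm_integrand_le hG t σ)

theorem norm_duhamel_le (hw : IntegrableOn w (Ioo 0 1)) {G : ℝ} (hG : ∀ t, ‖g t‖ ≤ G) (t : ℝ) :
    ‖duhamel A w g t‖ ≤ (∫ σ in Ioo (0 : ℝ) 1, |w σ|) * (K * G) := by
  rw [← integral_mul_const]
  exact norm_integral_le_of_norm_le (hw.abs.mul_const _)
    (Eventually.of_forall fun σ => hA.norm_integrand_le hG t σ)

theorem duhamel_of_nonpos {t : ℝ} (ht : t ≤ 0) : duhamel A w g t = 0 := by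
  rw [duhamel, setIntegral_congr_fun (g := fun _ => (0 : X)) measurableSet_Ioo fun σ hσ => ?_,
    integral_zero]
  simp only
  rw [hA.of_nonpos _ (mul_nonpos_of_nonpos_of_nonneg ht (sub_nonneg.2 hσ.2.le)),
    _root_.zero_apply, smul_zero]

/-- In the variable σ the domain and the weight do not depend on t, so dominated convergence applies
directly, including at t = 0. -/
theorem continuous_duhamel (hw : IntegrableOn w (Ioo 0 1)) (hg : Continuous g)
    (hg0 : ∀ t ≤ 0, g t = 0) {G : ℝ} (hG : ∀ t, ‖g t‖ ≤ G) : Continuous (duhamel A w g) := by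
  refine continuous_iff_continuousAt.2 fun t => continuousAt_of_dominated
    (bound := fun σ => |w σ| * (K * G))
    (Eventually.of_forall fun t => hA.aestronglyMeasurable_integrand hw hg t)
    (Eventually.of_forall fun t => Eventually.of_forall fun σ => hA.norm_integrand_le hG t σ)
    (hw.abs.mul_const _) ?_
  filter_upwards [ae_restrict_mem measurableSet_Ioo] with σ hσ
  exact (hA.continuousAt_apply_mul hg hg0 hσ t).const_smul _

theorem duhamel_sub (hw : IntegrableOn w (Ioo 0 1)) {g' : ℝ → Y} (hg : Continuous g)
    (hg' : Continuous g') {G : ℝ} (hG : ∀ t, ‖g t‖ ≤ G) (hG' : ∀ t, ‖g' t‖ ≤ G) (t : ℝ) :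
    duhamel A w g t - duhamel A w g' t = duhamel A w (fun t => g t - g' t) t := by
  rw [duhamel, duhamel, duhamel, ← integral_sub (hA.integrableOn_integrand hw hg hG t)
    (hA.integrableOn_integrand hw hg' hG' t)]
  simp_rw [map_sub, smul_sub]

/-- A small forcing term yields a solution of the Duhamel equation, by contraction. -/
theorem exists_duhamel_solution [CompleteSpace X] {F : X → Y} {L ρ a : ℝ} (hL : 0 ≤ L)
    (hρ : 1 < ρ) (hF : ∀ u v, ‖F u - F v‖ ≤ L * (‖u - v‖ * (‖u‖ + ‖v‖) ^ (ρ - 1))) (hF0 : F 0 = 0)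
    (hw : IntegrableOn w (Ioo 0 1)) {v₀ : ℝ → X} (hv₀ : Continuous v₀) (hv₀0 : ∀ t ≤ 0, v₀ t = 0)
    (hv₀a : ∀ t, ‖v₀ t‖ ≤ a)
    (hsmall : (∫ σ in Ioo (0 : ℝ) 1, |w σ|) * (K * (L * (4 * a) ^ (ρ - 1))) ≤ 1 / 2) :
    ∃ v : ℝ → X, Continuous v ∧ (∀ t ≤ 0, v t = 0) ∧ (∀ t, ‖v t‖ ≤ 2 * a) ∧
      ∀ t, v t = v₀ t + duhamel A w (fun s => F (v s)) t := by
  have ha : 0 ≤ a := (norm_nonneg _).trans (hv₀a 0)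
  have hK := hA.bound_nonneg
  set W := ∫ σ in Ioo (0 : ℝ) 1, |w σ| with hW
  have hW0 : 0 ≤ W := integral_nonneg fun _ => abs_nonneg _
  have hρ1 : 0 < ρ - 1 := by linarith
  have hFc : Continuous F := by
    refine continuous_iff_continuousAt.2 fun u => tendsto_iff_norm_sub_tendsto_zero.2
      (squeeze_zero (fun _ => norm_nonneg _) (fun v => hF v u) ?_)
    have : Continuous fun v : X => L * (‖v - u‖ * (‖v‖ + ‖u‖) ^ (ρ - 1)) :=
      continuous_const.mul ((by fun_prop : Continuous fun v : X => ‖v - u‖).mul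
        ((by fun_prop : Continuous fun v : X => ‖v‖ + ‖u‖).rpow_const fun _ => Or.inr hρ1.le))
    simpa using this.tendsto u
  have hFle : ∀ u v, ‖u‖ ≤ 2 * a → ‖v‖ ≤ 2 * a →
      ‖F u - F v‖ ≤ L * (4 * a) ^ (ρ - 1) * ‖u - v‖ := by
    intro u v hu hv
    refine (hF u v).trans ?_
    have : (‖u‖ + ‖v‖) ^ (ρ - 1) ≤ (4 * a) ^ (ρ - 1) := by
      gcongr
      linarith
    calc _ ≤ L * (‖u - v‖ * (4 * a) ^ (ρ - 1)) := by gcongr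
      _ = _ := by ring
  have hFbd : ∀ u, ‖u‖ ≤ 2 * a → ‖F u‖ ≤ L * (4 * a) ^ (ρ - 1) * (2 * a) := by
    intro u hu
    have := hFle u 0 hu (by simpa using ha)
    rw [hF0, sub_zero, sub_zero] at this
    exact this.trans (by gcongr)
  -- The contraction acts on the closed ball of radius 2a, hence the 4a in the Lipschitz bound for
  -- ‖u‖ + ‖v‖. Vanishing for t ≤ 0 is kept as a closed condition because continuity of the Duhamel
  -- term uses it.
  set S : Set (BoundedContinuousFunction ℝ X) :=
    {v | (∀ t ≤ 0, v t = 0) ∧ ∀ t, ‖v t‖ ≤ 2 * a} with hS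
  have hSclosed : IsClosed S := by
    have : S = (⋂ t ≤ (0 : ℝ), {v : BoundedContinuousFunction ℝ X | v t = 0}) ∩
        ⋂ t, {v : BoundedContinuousFunction ℝ X | ‖v t‖ ≤ 2 * a} := by
      ext v
      simp [hS]
    rw [this]
    refine IsClosed.inter (isClosed_biInter fun t _ => isClosed_eq ?_ continuous_const)
      (isClosed_iInter fun t => isClosed_le ?_ continuous_const)
    · exact (continuous_eval_const (F := BoundedContinuousFunction ℝ X) t)
    · exact (continuous_eval_const (F := BoundedContinuousFunction ℝ X) t).norm
  have hcont : ∀ v ∈ S, Continuous (duhamel A w fun s => F (v s)) := fun v hv =>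
    hA.continuous_duhamel hw (hFc.comp v.continuous)
      (fun t ht => by rw [hv.1 t ht, hF0]) fun t => hFbd _ (hv.2 t)
  -- The smallness condition bounds the Duhamel term by ½·2a, and a + a = 2a.
  have hbd : ∀ v ∈ S, ∀ t, ‖v₀ t + duhamel A w (fun s => F (v s)) t‖ ≤ 2 * a := fun v hv t => by
    have h1 := hA.norm_duhamel_le hw (fun t => hFbd _ (hv.2 t)) t
    have h2 := hv₀a t
    have h3 := norm_add_le (v₀ t) (duhamel A w (fun s => F (v s)) t)
    have h4 := mul_le_mul_of_nonneg_right hsmall (show 0 ≤ 2 * a by linarith)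
    have h5 : W * (K * (L * (4 * a) ^ (ρ - 1) * (2 * a))) =
        W * (K * (L * (4 * a) ^ (ρ - 1))) * (2 * a) := by ring
    rw [← hW, h5] at h1
    linarith
  let Φ : S → S := fun v => ⟨BoundedContinuousFunction.ofNormedAddCommGroup
    (fun t => v₀ t + duhamel A w (fun s => F (v.1 s)) t) (hv₀.add (hcont v.1 v.2)) (2 * a)
    (hbd v.1 v.2), fun t ht => by
      simp [hv₀0 t ht, hA.duhamel_of_nonpos ht], fun t => hbd v.1 v.2 t⟩
  have hΦ : ∀ (v : S) (t : ℝ), (Φ v).1 t = v₀ t + duhamel A w (fun s => F (v.1 s)) t :=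
    fun _ _ => rfl
  have hcontr : ContractingWith (1 / 2) Φ := by
    refine ⟨by
      rw [← NNReal.coe_lt_coe]
      norm_num, LipschitzWith.of_dist_le_mul fun u v => ?_⟩
    rw [Subtype.dist_eq, Subtype.dist_eq]
    refine (BoundedContinuousFunction.dist_le (by positivity)).2 fun t => ?_
    rw [hΦ, hΦ, dist_eq_norm, add_sub_add_left_eq_sub, hA.duhamel_sub hw (g := fun s => F (u.1 s))
      (g' := fun s => F (v.1 s)) (hFc.comp u.1.continuous) (hFc.comp v.1.continuous) (fun t => hFbd _ (u.2.2 t))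
      (fun t => hFbd _ (v.2.2 t))]
    have h1 := hA.norm_duhamel_le (g := fun t => F (u.1 t) - F (v.1 t)) hw
      (G := L * (4 * a) ^ (ρ - 1) * dist u.1 v.1) (fun t => by
        refine (hFle _ _ (u.2.2 t) (v.2.2 t)).trans ?_
        rw [← dist_eq_norm]
        gcongr
        exact BoundedContinuousFunction.dist_coe_le_dist t) t
    refine h1.trans ?_
    have h5 : W * (K * (L * (4 * a) ^ (ρ - 1) * dist u.1 v.1)) =
        W * (K * (L * (4 * a) ^ (ρ - 1))) * dist u.1 v.1 := by ring
    rw [← hW, h5]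
    refine (mul_le_mul_of_nonneg_right hsmall dist_nonneg).trans (le_of_eq ?_)
    push_cast
    rfl
  have : CompleteSpace S := hSclosed.completeSpace_coe
  have : Nonempty S := ⟨⟨0, fun _ _ => rfl, fun t => by simpa using ha⟩⟩
  have hfix : Φ (ContractingWith.fixedPoint Φ hcontr) = ContractingWith.fixedPoint Φ hcontr :=
    hcontr.fixedPoint_isFixedPt
  set v := ContractingWith.fixedPoint Φ hcontr
  refine ⟨v.1, v.1.continuous, v.2.1, v.2.2, fun t => ?_⟩
  rw [← hΦ v t, hfix]

end IsEvolution

end FixedPoint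

/-! ### Beta weights and the substitution s = tσ. -/

theorem integrableOn_rpow_mul_one_sub_rpow {a b : ℝ} (ha : a < 1) (hb : b < 1) :
    IntegrableOn (fun σ : ℝ => σ ^ (-a) * (1 - σ) ^ (-b)) (Ioo 0 1) := by
  have h := Complex.betaIntegral_convergent (u := ((1 - a : ℝ) : ℂ)) (v := ((1 - b : ℝ) : ℂ))
    (by rw [Complex.ofReal_re]; linarith) (by rw [Complex.ofReal_re]; linarith)
  rw [intervalIntegrable_iff_integrableOn_Ioo_of_le zero_le_one] at h
  refine (IntegrableOn.congr_fun h.norm (fun σ hσ => ?_) measurableSet_Ioo)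
  have e1 : ((1 - a : ℝ) : ℂ) - 1 = ((-a : ℝ) : ℂ) := by push_cast; ring
  have e2 : ((1 - b : ℝ) : ℂ) - 1 = ((-b : ℝ) : ℂ) := by push_cast; ring
  have e3 : (1 : ℂ) - (σ : ℂ) = ((1 - σ : ℝ) : ℂ) := by push_cast; ring
  have h1 : 0 < 1 - σ := sub_pos.2 hσ.2
  rw [e1, e2, e3, norm_mul, Complex.norm_cpow_eq_rpow_re_of_pos hσ.1,
    Complex.norm_cpow_eq_rpow_re_of_pos h1, Complex.ofReal_re, Complex.ofReal_re]

theorem integrableOn_Ioo_comp_mul_left {E : Type*} [NormedAddCommGroup E] {f : ℝ → E} {t : ℝ}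
    (ht : 0 < t) (h : IntegrableOn (fun σ => f (t * σ)) (Ioo 0 1)) : IntegrableOn f (Ioo 0 t) := by
  have himg : Ioo 0 1 = (fun σ => t * σ) ⁻¹' Ioo 0 t := by
    ext σ
    simp only [mem_Ioo, mem_preimage, mul_pos_iff_of_pos_left ht, mul_lt_iff_lt_one_right ht]
  have hm : Measurable[_, _] (fun σ : ℝ => t * σ) := measurable_const_mul t
  have h2 : Integrable (fun σ => (Ioo 0 t).indicator f (t * σ)) := by
    rw [← integrable_indicator_iff measurableSet_Ioo, himg] at h
    exact h
  rw [← integrable_indicator_iff measurableSet_Ioo]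
  exact (integrable_comp_mul_left_iff _ ht.ne').1 h2

theorem integral_Ioo_comp_mul_left {E : Type*} [NormedAddCommGroup E] [NormedSpace ℝ E]
    (f : ℝ → E) {t : ℝ} (ht : 0 < t) :
    ∫ s in Ioo 0 t, f s = ∫ σ in Ioo (0 : ℝ) 1, t • f (t * σ) := by
  rw [← integral_Ioc_eq_integral_Ioo, ← integral_Ioc_eq_integral_Ioo,
    ← intervalIntegral.integral_of_le ht.le, ← intervalIntegral.integral_of_le zero_le_one,
    intervalIntegral.integral_smul, intervalIntegral.smul_integral_comp_mul_left, mul_zero,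
    mul_one]

/-! ### Comparison of Bochner integrals in different Lebesgue spaces, and log-convexity of norms. -/

section Lp

variable {Ω : Type*} [MeasurableSpace Ω] {μ : Measure Ω}

theorem integrableOn_Lp {q : ℝ≥0∞} (hq : 1 ≤ q) (φ : Lp ℝ q μ) {S : Set Ω} (hS : μ S ≠ ∞) :
    IntegrableOn φ S μ := by
  have : IsFiniteMeasure (μ.restrict S) := ⟨by
    rw [Measure.restrict_apply_univ]
    exact hS.lt_top⟩
  exact ((Lp.memLp φ).restrict S).integrable hq

/-- Integration over a set of finite measure, as a functional on `L^q`. -/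
noncomputable def setIntegralLp (q : ℝ≥0∞) [hq : Fact (1 ≤ q)] {S : Set Ω} (hS : μ S ≠ ∞) :
    Lp ℝ q μ →L[ℝ] ℝ :=
  LinearMap.mkContinuous
    { toFun := fun φ => ∫ a in S, φ a ∂μ
      map_add' := fun φ ψ => by
        rw [integral_congr_ae (ae_restrict_of_ae (Lp.coeFn_add φ ψ))]
        exact integral_add (integrableOn_Lp hq.out φ hS) (integrableOn_Lp hq.out ψ hS)
      map_smul' := fun c φ => by
        rw [integral_congr_ae (ae_restrict_of_ae (Lp.coeFn_smul c φ))]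
        exact integral_const_mul _ _ }
    (μ S ^ (1 / (1 : ℝ≥0∞).toReal - 1 / q.toReal)).toReal fun φ => by
      have he : 0 ≤ 1 / (1 : ℝ≥0∞).toReal - 1 / q.toReal := by
        rw [ENNReal.toReal_one, div_one, sub_nonneg]
        rcases eq_or_ne q ∞ with rfl | h
        · simp
        · have := ENNReal.toReal_mono h hq.out
          rw [ENNReal.toReal_one] at this
          rw [div_le_one (by linarith)]
          exact this
      have hfin : eLpNorm φ q μ * μ S ^ (1 / (1 : ℝ≥0∞).toReal - 1 / q.toReal) ≠ ∞ :=
        ENNReal.mul_ne_top (Lp.eLpNorm_ne_top φ) (ENNReal.rpow_ne_top_of_nonneg he hS)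
      have h1 : ‖∫ a in S, φ a ∂μ‖ₑ ≤
          eLpNorm φ q μ * μ S ^ (1 / (1 : ℝ≥0∞).toReal - 1 / q.toReal) := by
        refine (enorm_integral_le_lintegral_enorm _).trans ?_
        rw [← eLpNorm_one_eq_lintegral_enorm]
        refine (eLpNorm_le_eLpNorm_mul_rpow_measure_univ (p := 1) (q := q) hq.out
          (Lp.aestronglyMeasurable φ).restrict).trans ?_
        rw [Measure.restrict_apply_univ]
        exact mul_le_mul' (eLpNorm_mono_measure _ Measure.restrict_le_self) le_rfl
      have h2 := ENNReal.toReal_mono hfin h1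
      rw [toReal_enorm, ENNReal.toReal_mul, ← Lp.norm_def, mul_comm] at h2
      exact h2

theorem setIntegralLp_apply {q : ℝ≥0∞} [Fact (1 ≤ q)] {S : Set Ω} (hS : μ S ≠ ∞)
    (φ : Lp ℝ q μ) : setIntegralLp q hS φ = ∫ a in S, φ a ∂μ :=
  rfl

/-- Bochner integrals in two Lebesgue spaces of almost everywhere equal integrands agree. -/
theorem integral_Lp_ae_eq [SigmaFinite μ] {S : Type*} [MeasurableSpace S] {ν : Measure S}
    {q s : ℝ≥0∞} [hq : Fact (1 ≤ q)] [hs : Fact (1 ≤ s)] {F : S → Lp ℝ q μ} {G : S → Lp ℝ s μ}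
    (hF : Integrable F ν) (hG : Integrable G ν) (h : ∀ᵐ σ ∂ν, F σ =ᵐ[μ] G σ) :
    (∫ σ, F σ ∂ν : Lp ℝ q μ) =ᵐ[μ] (∫ σ, G σ ∂ν : Lp ℝ s μ) := by
  -- It suffices to compare integrals over sets T of finite measure. Integration over T is a
  -- continuous functional on both spaces, so it passes inside both Bochner integrals, where the
  -- integrands agree.
  refine ae_eq_of_forall_setIntegral_eq_of_sigmaFinite
    (fun T _ hT => integrableOn_Lp hq.out _ hT.ne) (fun T _ hT => integrableOn_Lp hs.out _ hT.ne)
    fun T _ hT => ?_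
  rw [← setIntegralLp_apply hT.ne, ← setIntegralLp_apply hT.ne,
    ← ContinuousLinearMap.integral_comp_comm _ hF, ← ContinuousLinearMap.integral_comp_comm _ hG]
  refine integral_congr_ae ?_
  filter_upwards [h] with σ hσ
  rw [setIntegralLp_apply, setIntegralLp_apply]
  exact integral_congr_ae (ae_restrict_of_ae hσ)

/-- Log-convexity of the Lebesgue norms. -/
theorem eLpNorm_le_rpow_mul_rpow {p r s θ : ℝ} (hp : 0 < p) (hs : 0 < s) (hr : 0 < r)
    (hθ0 : 0 < θ) (hθ1 : θ ≤ 1) (hθ : 1 / r = (1 - θ) / p + θ / s) {f : Ω → ℝ}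
    (hf : AEStronglyMeasurable f μ) : eLpNorm f (ENNReal.ofReal r) μ ≤
      eLpNorm f (ENNReal.ofReal p) μ ^ (1 - θ) * eLpNorm f (ENNReal.ofReal s) μ ^ θ := by
  -- θ = 1 is set aside because the Hölder exponent p/(1-θ) degenerates.
  rcases hθ1.eq_or_lt with rfl | hθ1
  · have : r = s := by
      rw [sub_self, zero_div, zero_add, one_div, one_div] at hθ
      exact inv_injective hθ
    rw [this]
    simp
  have h1 : 0 < 1 - θ := sub_pos.2 hθ1
  have hT : ENNReal.HolderTriple (ENNReal.ofReal (p / (1 - θ))) (ENNReal.ofReal (s / θ))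
      (ENNReal.ofReal r) := by
    refine ⟨?_⟩
    rw [← ENNReal.ofReal_inv_of_pos hr, ← ENNReal.ofReal_inv_of_pos (by positivity),
      ← ENNReal.ofReal_inv_of_pos (by positivity), ← ENNReal.ofReal_add (by positivity)
      (by positivity), inv_div, inv_div, ← hθ, one_div]
  have h2 := eLpNorm_smul_le_mul_eLpNorm (p := ENNReal.ofReal (p / (1 - θ)))
    (q := ENNReal.ofReal (s / θ)) (r := ENNReal.ofReal r) (μ := μ)
    (f := fun a => ‖f a‖ ^ θ) (φ := fun a => ‖f a‖ ^ (1 - θ))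
    (hf.norm.aemeasurable.pow_const θ).aestronglyMeasurable
    (hf.norm.aemeasurable.pow_const (1 - θ)).aestronglyMeasurable
  rw [eLpNorm_norm_rpow f h1, eLpNorm_norm_rpow f hθ0, ← ENNReal.ofReal_mul (by positivity),
    ← ENNReal.ofReal_mul (by positivity), div_mul_cancel₀ _ h1.ne',
    div_mul_cancel₀ _ hθ0.ne'] at h2
  refine le_of_eq_of_le ?_ h2
  rw [← eLpNorm_norm]
  congr 1
  funext a
  rw [Pi.smul_apply', smul_eq_mul, ← Real.rpow_add' (norm_nonneg _) (by simp), sub_add_cancel,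
    Real.rpow_one]

end Lp

/-! ### The global solution for exponents with r/ρ ≥ 1. -/

section Global

variable {Ω : Type*} [TopologicalSpace Ω] [MeasurableSpace Ω] {μ : Measure Ω} {d C : ℝ}
  {κ : ℝ → Ω → Ω → ℝ} [SFinite μ] (H : IsHeatKernel μ d C κ)

theorem coeFn_scaledHeat {q s : ℝ} (hq : 1 ≤ q) (hqs : q ≤ s) [Fact (1 ≤ ENNReal.ofReal q)]
    [Fact (1 ≤ ENNReal.ofReal s)] {t : ℝ} (ht : 0 < t) (φ : Lp ℝ (ENNReal.ofReal q) μ) :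
    scaledHeat H hq hqs t φ =ᵐ[μ] fun a => t ^ (d * (1 / q - 1 / s)) * heatOp μ κ t φ a := by
  rw [scaledHeat, _root_.smul_apply]
  filter_upwards [Lp.coeFn_smul (t ^ (d * (1 / q - 1 / s))) (heatFamily H hq hqs t φ),
    coeFn_heatFamily H hq hqs ht φ] with a h1 h2
  rw [h1, Pi.smul_apply, h2, smul_eq_mul]

/-- The weight of the Duhamel integral in the variable `σ = s / t`. -/
noncomputable def duhamelWeight (γ e σ : ℝ) : ℝ := σ ^ (-γ) * (1 - σ) ^ (-e)

/-- The factor (1-σ)^{-e} of the weight undoes the normalization (t(1-σ))^e of the operator at time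
t - s = t(1-σ), leaving only t^e. -/
theorem duhamelWeight_mul_rpow {γ e σ t : ℝ} (hσ : σ ∈ Ioo (0 : ℝ) 1) (ht : 0 < t) :
    duhamelWeight γ e σ * (t * (1 - σ)) ^ e = σ ^ (-γ) * t ^ e := by
  have h1 : 0 < 1 - σ := sub_pos.2 hσ.2
  rw [duhamelWeight, Real.mul_rpow ht.le h1.le, Real.rpow_neg h1.le]
  have := (Real.rpow_pos_of_pos h1 e).ne'
  field_simp

theorem norm_heatFamily_ite_le {p : ℝ} (hp : 1 ≤ p)
    [Fact (1 ≤ ENNReal.ofReal p)] (φ : Lp ℝ (ENNReal.ofReal p) μ) (t : ℝ) :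
    ‖if 0 < t then heatFamily H hp le_rfl t φ else φ‖ ≤ ‖φ‖ := by
  split_ifs with ht
  · rw [heatFamily_of_pos _ _ _ ht]
    have h := norm_heatLp_le H hp le_rfl ht
    rw [sub_self, Real.rpow_zero] at h
    simpa using (heatLp H hp le_rfl ht).le_of_opNorm_le h φ
  · exact le_rfl

variable [NormalSpace Ω] [BorelSpace Ω] [R1Space Ω] [WeaklyLocallyCompactSpace Ω] [μ.Regular]

theorem isEvolution_scaledHeat (hd : 0 ≤ d) {q s : ℝ} (hq : 1 ≤ q) (hqs : q ≤ s)
    [Fact (1 ≤ ENNReal.ofReal q)] [Fact (1 ≤ ENNReal.ofReal s)] :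
    IsEvolution (C ^ (1 / q - 1 / s)) (scaledHeat H hq hqs) where
  norm_le := norm_scaledHeat_le H hq hqs
  of_nonpos := fun _ => scaledHeat_of_nonpos H hq hqs
  continuousAt := fun φ _ ht => continuousAt_scaledHeat H hq hqs hd φ ht

/-- The Duhamel integrals in two Lebesgue spaces agree up to a power of `t`. -/
theorem duhamel_ae_eq [SigmaFinite μ] (hd : 0 ≤ d) {q s r γ : ℝ} (hq : 1 ≤ q) (hqs : q ≤ s)
    (hqr : q ≤ r) [Fact (1 ≤ ENNReal.ofReal q)] [Fact (1 ≤ ENNReal.ofReal s)]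
    [Fact (1 ≤ ENNReal.ofReal r)] (hγ : γ < 1) (hs1 : d * (1 / q - 1 / s) < 1)
    (hr1 : d * (1 / q - 1 / r) < 1) {g : ℝ → Lp ℝ (ENNReal.ofReal q) μ} (hg : Continuous g)
    {G : ℝ} (hG : ∀ t, ‖g t‖ ≤ G) {t : ℝ} (ht : 0 < t) :
    (duhamel (scaledHeat H hq hqr) (duhamelWeight γ (d * (1 / q - 1 / r))) g t :
      Lp ℝ (ENNReal.ofReal r) μ) =ᵐ[μ] fun a => t ^ (d * (1 / s - 1 / r)) *
        (duhamel (scaledHeat H hq hqs) (duhamelWeight γ (d * (1 / q - 1 / s))) g t :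
          Lp ℝ (ENNReal.ofReal s) μ) a := by
  have hi₁ := (isEvolution_scaledHeat H hd hq hqr).integrableOn_integrand
    (integrableOn_rpow_mul_one_sub_rpow hγ hr1) hg hG t
  have hi₂ := (isEvolution_scaledHeat H hd hq hqs).integrableOn_integrand
    (integrableOn_rpow_mul_one_sub_rpow hγ hs1) hg hG t
  have h := integral_Lp_ae_eq (μ := μ) hi₁ (hi₂.smul (t ^ (d * (1 / s - 1 / r)))) ?_
  · rw [duhamel, duhamel]
    refine h.trans ?_
    simp only [Pi.smul_apply]
    rw [integral_smul]
    exact (Lp.coeFn_smul _ _).trans (Eventually.of_forall fun a => by simp [duhamelWeight])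
  · filter_upwards [ae_restrict_mem measurableSet_Ioo] with σ hσ
    have hτ : 0 < t * (1 - σ) := mul_pos ht (sub_pos.2 hσ.2)
    filter_upwards [
      Lp.coeFn_smul (duhamelWeight γ (d * (1 / q - 1 / r)) σ)
        (scaledHeat H hq hqr (t * (1 - σ)) (g (t * σ))),
      Lp.coeFn_smul (duhamelWeight γ (d * (1 / q - 1 / s)) σ)
        (scaledHeat H hq hqs (t * (1 - σ)) (g (t * σ))),
      Lp.coeFn_smul (t ^ (d * (1 / s - 1 / r))) (duhamelWeight γ (d * (1 / q - 1 / s)) σ •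
        scaledHeat H hq hqs (t * (1 - σ)) (g (t * σ))),
      coeFn_scaledHeat H hq hqr hτ (g (t * σ)), coeFn_scaledHeat H hq hqs hτ (g (t * σ))]
      with a h1 h2 h3 h4 h5
    refine h1.trans (Eq.trans ?_ h3.symm)
    rw [Pi.smul_apply, Pi.smul_apply, h2, Pi.smul_apply, h4, h5]
    simp only [smul_eq_mul]
    -- Both integrands are σ^{-γ} S(t(1-σ)) g(tσ) up to t^e, with exponents e differing by d(1/s -
    -- 1/r).
    have e1 := duhamelWeight_mul_rpow (γ := γ) (e := d * (1 / q - 1 / r)) hσ ht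
    have e2 := duhamelWeight_mul_rpow (γ := γ) (e := d * (1 / q - 1 / s)) hσ ht
    have e3 : t ^ (d * (1 / q - 1 / r)) = t ^ (d * (1 / s - 1 / r)) * t ^ (d * (1 / q - 1 / s)) := by
      rw [← Real.rpow_add ht]
      ring_nf
    rw [← mul_assoc, e1, e3, ← mul_assoc (duhamelWeight _ _ _), e2]
    ring

theorem continuousOn_heatFamily_ite (hd : 0 ≤ d) {p : ℝ} (hp : 1 ≤ p)
    [Fact (1 ≤ ENNReal.ofReal p)] (φ : Lp ℝ (ENNReal.ofReal p) μ) :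
    ContinuousOn (fun t => if 0 < t then heatFamily H hp le_rfl t φ else φ) (Ici 0) := by
  intro t ht
  rcases (mem_Ici.1 ht).eq_or_lt with rfl | ht
  · rw [← continuousWithinAt_Ioi_iff_Ici, ContinuousWithinAt, if_neg (lt_irrefl _)]
    refine (tendsto_heatFamily_zero H hp φ).congr' ?_
    filter_upwards [self_mem_nhdsWithin] with t ht
    exact (if_pos ht).symm
  · refine ContinuousAt.continuousWithinAt
      ((continuousAt_heatFamily H hp le_rfl hd φ ht).congr ?_)
    filter_upwards [eventually_gt_nhds ht] with τ hτ
    exact (if_pos hτ).symm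

include H in
/-- Global solutions with small data, for an exponent `r` such that `r / ρ ≥ 1`; here
`v t = t^α u t`. -/
theorem exists_global_solution [SigmaFinite μ] (hd : 0 < d) {ρ p r : ℝ} (hρ : 1 < ρ)
    (hp : p = d * (ρ - 1)) (hp1 : 1 < p) (hpr : p < r) (hrp : r < ρ * p) (hρr : ρ ≤ r)
    [Fact (1 ≤ ENNReal.ofReal p)] [Fact (1 ≤ ENNReal.ofReal r)] :
    ∃ δ : ℝ, 0 < δ ∧ ∀ u₀ : Lp ℝ (ENNReal.ofReal p) μ, ‖u₀‖ ≤ δ →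
      ∃ (u : ℝ → Lp ℝ (ENNReal.ofReal p) μ) (v : ℝ → Lp ℝ (ENNReal.ofReal r) μ),
        u 0 = u₀ ∧ ContinuousOn u (Ici 0) ∧ (∃ M, ∀ t, 0 ≤ t → ‖u t‖ ≤ M) ∧
        Continuous v ∧ (∃ M, ∀ t, ‖v t‖ ≤ M) ∧
        (∀ t, 0 < t → v t =ᵐ[μ] fun a => t ^ (d * (1 / p - 1 / r)) * u t a) ∧
        ∀ t, 0 < t → ∃ (G : Lp ℝ (ENNReal.ofReal p) μ) (F : ℝ → Lp ℝ (ENNReal.ofReal p) μ),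
          G =ᵐ[μ] heatOp μ κ t u₀ ∧
          (∀ s ∈ Ioo 0 t,
            (∀ a, Integrable (fun b => κ (t - s) a b * (|u s b| ^ (ρ - 1) * u s b)) μ) ∧
            F s =ᵐ[μ] heatOp μ κ (t - s) (fun a => |u s a| ^ (ρ - 1) * u s a)) ∧
          IntegrableOn F (Ioo 0 t) ∧ u t = G + ∫ s in Ioo 0 t, F s := by
  have hρ0 : 0 < ρ := by linarith
  have hρ1 : 0 < ρ - 1 := by linarith
  have hp0 : 0 < p := by linarith
  have hr0 : 0 < r := by linarith
  have hr1 : 1 ≤ r := by linarith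
  have hC := H.const_pos
  set q := r / ρ with hq
  have hq1 : 1 ≤ q := by rwa [hq, le_div_iff₀ hρ0, one_mul]
  have hqr : q ≤ r := div_le_self hr0.le hρ.le
  have hqp : q ≤ p := by
    rw [hq, div_le_iff₀ hρ0, mul_comm]
    exact hrp.le
  have : Fact (1 ≤ ENNReal.ofReal q) := ⟨by simpa using hq1⟩
  have hqinv : 1 / q = ρ / r := by rw [hq, one_div_div]
  set α := d * (1 / p - 1 / r) with hα
  set γ := α * ρ with hγ
  set eᵣ := d * (1 / q - 1 / r) with heᵣ
  set eₚ := d * (1 / q - 1 / p) with heₚ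
  have hα0 : 0 < α := mul_pos hd (sub_pos.2 (one_div_lt_one_div_of_lt hp0 hpr))
  -- The sum equals d(ρ-1)/p = 1. This is where the critical value of p enters: the power t^{1-γ-eₚ}
  -- disappears from the Duhamel term in L^p. Since eᵣ = eₚ + α, the power t^{α+1-γ-eᵣ} disappears
  -- likewise in L^r.
  have hsum : γ + eₚ = 1 := by
    rw [hγ, hα, heₚ, hqinv]
    have : d * (ρ - 1) / p = 1 := by rw [← hp, div_self hp0.ne']
    linear_combination this
  -- Here r < ρp is used; with `hsum` it gives γ < 1, integrability of the weight at σ = 0.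
  have heₚ0 : 0 < eₚ := by
    refine mul_pos hd (sub_pos.2 ?_)
    rw [hqinv, div_lt_div_iff₀ hp0 hr0]
    linarith
  have heₚ1 : eₚ < 1 := by
    have : 0 < γ := mul_pos hα0 hρ0
    linarith
  have hγ1 : γ < 1 := by linarith
  -- eᵣ = p/r, so p < r gives integrability at σ = 1.
  have heᵣ1 : eᵣ < 1 := by
    have : eᵣ = p / r := by
      rw [heᵣ, hqinv, hp]
      ring
    rw [this, div_lt_one hr0]
    exact hpr
  set A := scaledHeat H hq1 hqr
  set B := scaledHeat H hq1 hqp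
  have hA : IsEvolution _ A := isEvolution_scaledHeat H hd.le hq1 hqr
  have hB : IsEvolution _ B := isEvolution_scaledHeat H hd.le hq1 hqp
  have hwᵣ : IntegrableOn (duhamelWeight γ eᵣ) (Ioo 0 1) :=
    integrableOn_rpow_mul_one_sub_rpow hγ1 heᵣ1
  have hwₚ : IntegrableOn (duhamelWeight γ eₚ) (Ioo 0 1) :=
    integrableOn_rpow_mul_one_sub_rpow hγ1 heₚ1
  -- The left side is continuous in δ and vanishes at δ = 0 because ρ > 1. The choice does not
  -- involve u₀.
  obtain ⟨δ, hδ, hsmall⟩ : ∃ δ : ℝ, 0 < δ ∧ (∫ σ in Ioo (0 : ℝ) 1, |duhamelWeight γ eᵣ σ|) *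
      (C ^ (1 / q - 1 / r) * (ρ * (4 * (C ^ (1 / p - 1 / r) * δ)) ^ (ρ - 1))) ≤ 1 / 2 := by
    have hcont : Continuous fun δ : ℝ => (∫ σ in Ioo (0 : ℝ) 1, |duhamelWeight γ eᵣ σ|) *
        (C ^ (1 / q - 1 / r) * (ρ * (4 * (C ^ (1 / p - 1 / r) * δ)) ^ (ρ - 1))) :=
      continuous_const.mul (continuous_const.mul (continuous_const.mul
        ((by fun_prop : Continuous fun δ : ℝ => 4 * (C ^ (1 / p - 1 / r) * δ)).rpow_const
          fun _ => Or.inr hρ1.le)))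
    have hlim := (hcont.tendsto 0).mono_left (nhdsWithin_le_nhds (s := Ioi 0))
    simp only [mul_zero, Real.zero_rpow hρ1.ne'] at hlim
    obtain ⟨δ, h1, h2⟩ := (((hlim.eventually_lt_const (by norm_num : (0 : ℝ) < 1 / 2))).and
      self_mem_nhdsWithin).exists
    exact ⟨δ, h2, h1.le⟩
  refine ⟨δ, hδ, fun u₀ hu₀ => ?_⟩
  have hv₀a : ∀ t, ‖scaledHeat H hp1.le hpr.le t u₀‖ ≤ C ^ (1 / p - 1 / r) * δ := fun t =>
    ((scaledHeat H hp1.le hpr.le t).le_of_opNorm_le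
      (norm_scaledHeat_le H hp1.le hpr.le t) u₀).trans (by gcongr)
  obtain ⟨v, hvc, hv0, hvb, hveq⟩ := hA.exists_duhamel_solution
    (F := powLp hr1 hρ) hρ0.le hρ (norm_powLp_sub_le hr1 hρ) (powLp_zero hr1 hρ) hwᵣ
    (continuous_scaledHeat H hp1.le hpr.le hd hpr u₀)
    (fun t ht => by rw [scaledHeat_of_nonpos _ _ _ ht, _root_.zero_apply]) hv₀a hsmall
  set M := 2 * (C ^ (1 / p - 1 / r) * δ) with hM
  have hM0 : 0 ≤ M := (norm_nonneg _).trans (hvb 0)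
  set g : ℝ → Lp ℝ (ENNReal.ofReal q) μ := fun s => powLp hr1 hρ (v s) with hg
  have hgc : Continuous g := by
    refine Continuous.comp (continuous_iff_continuousAt.2 fun w =>
      tendsto_iff_norm_sub_tendsto_zero.2 (squeeze_zero (fun _ => norm_nonneg _)
        (fun w' => norm_powLp_sub_le hr1 hρ w' w) ?_)) hvc
    have : Continuous fun w' : Lp ℝ (ENNReal.ofReal r) μ =>
        ρ * (‖w' - w‖ * (‖w'‖ + ‖w‖) ^ (ρ - 1)) :=
      continuous_const.mul ((continuous_id.sub continuous_const).norm.mul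
        ((continuous_norm.add continuous_const).rpow_const fun _ => Or.inr hρ1.le))
    simpa using this.tendsto w
  have hg0 : ∀ t ≤ 0, g t = 0 := fun t ht => by simp only [hg, hv0 t ht, powLp_zero]
  have hgb : ∀ t, ‖g t‖ ≤ ρ * (M * M ^ (ρ - 1)) := fun t => by
    have h := norm_powLp_sub_le hr1 hρ (v t) 0
    rw [powLp_zero, sub_zero, sub_zero, norm_zero, add_zero] at h
    refine h.trans ?_
    have := hvb t
    gcongr
  -- u is defined in L^p by the Duhamel formula with the forcing g built from v; that v = t^α u is
  -- proved afterwards and closes the equation.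
  set u : ℝ → Lp ℝ (ENNReal.ofReal p) μ := fun t =>
    (if 0 < t then heatFamily H hp1.le le_rfl t u₀ else u₀) +
      duhamel B (duhamelWeight γ eₚ) g t with hu
  have huv : ∀ t, 0 < t → v t =ᵐ[μ] fun a => t ^ α * u t a := by
    intro t ht
    rw [hveq t]
    have e : u t = heatFamily H hp1.le le_rfl t u₀ + duhamel B (duhamelWeight γ eₚ) g t := by
      simp only [hu, if_pos ht]
    rw [e]
    filter_upwards [Lp.coeFn_add (scaledHeat H hp1.le hpr.le t u₀)
        (duhamel A (duhamelWeight γ eᵣ) g t),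
      Lp.coeFn_add (heatFamily H hp1.le le_rfl t u₀) (duhamel B (duhamelWeight γ eₚ) g t),
      coeFn_scaledHeat H hp1.le hpr.le ht u₀, coeFn_heatFamily H hp1.le le_rfl ht u₀,
      duhamel_ae_eq H hd.le hq1 hqp hqr hγ1 heₚ1 heᵣ1 hgc hgb ht] with a h1 h2 h3 h4 h5
    rw [h1, h2, Pi.add_apply, Pi.add_apply, h3, h4, h5]
    ring
  -- Homogeneity of degree ρ turns u = s^{-α} v into the factor s^{-αρ} = s^{-γ}.
  have hpow : ∀ s, 0 < s → (fun a => |u s a| ^ (ρ - 1) * u s a) =ᵐ[μ]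
      (s ^ (-γ) • g s : Lp ℝ (ENNReal.ofReal q) μ) := by
    intro s hs
    filter_upwards [Lp.coeFn_smul (s ^ (-γ)) (g s), coeFn_powLp hr1 hρ (v s), huv s hs]
      with a h1 h2 h3
    have hsα : 0 < s ^ α := Real.rpow_pos_of_pos hs _
    rw [h1, Pi.smul_apply, h2, h3, smul_eq_mul, abs_mul, abs_of_pos hsα,
      Real.mul_rpow hsα.le (abs_nonneg _)]
    have e : s ^ (-γ) * ((s ^ α) ^ (ρ - 1) * s ^ α) = 1 := by
      rw [← Real.rpow_add_one hsα.ne', sub_add_cancel, ← Real.rpow_mul hs.le, ← hγ,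
        ← Real.rpow_add hs, neg_add_cancel, Real.rpow_zero]
    linear_combination (-(|u s a| ^ (ρ - 1) * u s a)) * e
  refine ⟨u, v, ?_, ?_, ?_, hvc, ⟨M, hvb⟩, huv, ?_⟩
  · simp only [hu, if_neg (lt_irrefl (0 : ℝ)), hB.duhamel_of_nonpos le_rfl, add_zero]
  · exact (continuousOn_heatFamily_ite H hd.le hp1.le u₀).add
      (hB.continuous_duhamel hwₚ hgc hg0 hgb).continuousOn
  · exact ⟨_, fun t _ => (norm_add_le _ _).trans (add_le_add
      (norm_heatFamily_ite_le H hp1.le u₀ t) (hB.norm_duhamel_le hwₚ hgb t))⟩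
  · intro t ht
    set F : ℝ → Lp ℝ (ENNReal.ofReal p) μ := fun s =>
      heatFamily H hq1 hqp (t - s) (s ^ (-γ) • g s) with hF
    have hFσ : EqOn (fun σ => t • F (t * σ)) (fun σ => duhamelWeight γ eₚ σ •
        B (t * (1 - σ)) (g (t * σ))) (Ioo 0 1) := by
      intro σ hσ
      have e1 : t - t * σ = t * (1 - σ) := by ring
      have e2 : t * (t * σ) ^ (-γ) = duhamelWeight γ eₚ σ * (t * (1 - σ)) ^ eₚ := by
        rw [duhamelWeight_mul_rpow hσ ht, Real.mul_rpow ht.le hσ.1.le,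
          show eₚ = 1 + -γ by linarith, Real.rpow_add ht, Real.rpow_one]
        ring
      simp only [hF, e1]
      rw [map_smul, smul_smul, e2, mul_smul]
      rfl
    have hint := hB.integrableOn_integrand hwₚ hgc hgb t
    refine ⟨heatFamily H hp1.le le_rfl t u₀, F, coeFn_heatFamily H hp1.le le_rfl ht u₀,
      fun s hs => ⟨fun a => ?_, ?_⟩, ?_, ?_⟩
    · exact H.integrable (sub_pos.2 hs.2) hq1
        ((memLp_congr_ae (hpow s hs.1)).2 (Lp.memLp _)) a
    · rw [heatOp_congr_ae (t - s) (hpow s hs.1)]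
      exact coeFn_heatFamily H hq1 hqp (sub_pos.2 hs.2) _
    · refine integrableOn_Ioo_comp_mul_left ht ?_
      have h1 := (hint.congr_fun hFσ.symm measurableSet_Ioo).smul t⁻¹
      refine IntegrableOn.congr_fun h1 (fun σ _ => ?_) measurableSet_Ioo
      simp only [Pi.smul_apply]
      rw [inv_smul_smul₀ ht.ne']
    · simp only [hu, if_pos ht]
      rw [integral_Ioo_comp_mul_left F ht, setIntegral_congr_fun measurableSet_Ioo hFσ, duhamel]

end Global

/-! ### Interpolation between L^p and L^s. -/

section Interpolation

variable {Ω : Type*} [MeasurableSpace Ω] {μ : Measure Ω} {p r s : ℝ}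

/-- The interpolation parameter of `r` between `p` and `s`. -/
noncomputable def interpParam (p r s : ℝ) : ℝ := (1 / p - 1 / r) / (1 / p - 1 / s)

theorem interpParam_pos (hp : 0 < p) (hpr : p < r) (hrs : r ≤ s) : 0 < interpParam p r s :=
  div_pos (sub_pos.2 (one_div_lt_one_div_of_lt hp hpr))
    (sub_pos.2 (one_div_lt_one_div_of_lt hp (hpr.trans_le hrs)))

theorem interpParam_le_one (hp : 0 < p) (hpr : p < r) (hrs : r ≤ s) : interpParam p r s ≤ 1 := by
  rw [interpParam, div_le_one (sub_pos.2 (one_div_lt_one_div_of_lt hp (hpr.trans_le hrs)))]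
  exact sub_le_sub_left (one_div_le_one_div_of_le (hp.trans hpr) hrs) _

theorem interpParam_mul (hp : 0 < p) (hpr : p < r) (hrs : r ≤ s) :
    interpParam p r s * (1 / p - 1 / s) = 1 / p - 1 / r :=
  div_mul_cancel₀ _ (sub_pos.2 (one_div_lt_one_div_of_lt hp (hpr.trans_le hrs))).ne'

theorem eLpNorm_le_interp (hp : 0 < p) (hpr : p < r) (hrs : r ≤ s) {f : Ω → ℝ}
    (hf : AEStronglyMeasurable f μ) : eLpNorm f (ENNReal.ofReal r) μ ≤
      eLpNorm f (ENNReal.ofReal p) μ ^ (1 - interpParam p r s) *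
        eLpNorm f (ENNReal.ofReal s) μ ^ interpParam p r s := by
  refine eLpNorm_le_rpow_mul_rpow hp (hp.trans (hpr.trans_le hrs)) (hp.trans hpr)
    (interpParam_pos hp hpr hrs) (interpParam_le_one hp hpr hrs) ?_ hf
  have := interpParam_mul hp hpr hrs
  linear_combination this

end Interpolation

theorem semigroup_eq_heatOp {N k : ℕ} {t : ℝ} (ht : 0 < t) (φ : Pt N k → ℝ) :
    semigroup t φ = heatOp volume (fun t (a b : Pt N k) => kernel a.1 b.1 (a.2 - b.2) t) t φ := by
  rw [semigroup, if_neg ht.ne']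
  rfl

/-! ### Passage to the weighted spaces of intermediate exponents. -/

section Weighted

variable {N k : ℕ} {p r s d : ℝ} [Fact (1 ≤ ENNReal.ofReal p)]
  [Fact (1 ≤ ENNReal.ofReal s)] {u : ℝ → Lp ℝ (ENNReal.ofReal p) (volume : Measure (Pt N k))}
  {v : ℝ → Lp ℝ (ENNReal.ofReal s) (volume : Measure (Pt N k))}

/-- A curve which is bounded in `L^p` and bounded in `L^s` after multiplication by
`t^{d (1/p - 1/s)}` belongs to the weighted spaces of the intermediate exponents. -/
theorem mem_spaceX (hp : 0 < p) (hpr : p < r) (hrs : r ≤ s)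
    (hu : ContinuousOn u (Ici 0)) (hub : ∃ M, ∀ t, 0 ≤ t → ‖u t‖ ≤ M) (hv : Continuous v)
    (hvb : ∃ M, ∀ t, ‖v t‖ ≤ M)
    (huv : ∀ t, 0 < t → v t =ᵐ[volume] fun a => t ^ (d * (1 / p - 1 / s)) * u t a) :
    u ∈ spaceX N k (ENNReal.ofReal p) (ENNReal.ofReal r) (d * (1 / p - 1 / r)) := by
  obtain ⟨Mu, hMu⟩ := hub
  obtain ⟨Mv, hMv⟩ := hvb
  set θ := interpParam p r s with hθ
  have hθ0 : 0 < θ := interpParam_pos hp hpr hrs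
  have hθ1 : θ ≤ 1 := interpParam_le_one hp hpr hrs
  set α := d * (1 / p - 1 / s) with hα
  have hαθ : d * (1 / p - 1 / r) = α * θ := by
    rw [← interpParam_mul hp hpr hrs, hα, ← hθ]
    ring
  have hus : ∀ t, 0 < t → u t =ᵐ[volume] (t ^ (-α) • v t :
      Lp ℝ (ENNReal.ofReal s) (volume : Measure (Pt N k))) := by
    intro t ht
    filter_upwards [Lp.coeFn_smul (t ^ (-α)) (v t), huv t ht] with a h1 h2
    rw [h1, Pi.smul_apply, h2, smul_eq_mul, ← mul_assoc, ← Real.rpow_add ht, neg_add_cancel,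
      Real.rpow_zero, one_mul]
  have hnorm : ∀ t, 0 < t → eLpNorm (u t) (ENNReal.ofReal s) volume =
      ENNReal.ofReal (t ^ (-α) * ‖v t‖) := by
    intro t ht
    rw [eLpNorm_congr_ae (hus t ht), ← Lp.enorm_def, ← ofReal_norm, norm_smul,
      Real.norm_eq_abs, abs_of_pos (Real.rpow_pos_of_pos ht _)]
  have hnormp : ∀ t, eLpNorm (u t) (ENNReal.ofReal p) volume = ENNReal.ofReal ‖u t‖ := by
    intro t
    rw [← Lp.enorm_def, ofReal_norm]
  have hle : ∀ t, 0 < t → eLpNorm (u t) (ENNReal.ofReal r) volume ≤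
      ENNReal.ofReal (‖u t‖ ^ (1 - θ) * (t ^ (-α) * ‖v t‖) ^ θ) := by
    intro t ht
    refine (eLpNorm_le_interp hp hpr hrs (Lp.aestronglyMeasurable (u t))).trans (le_of_eq ?_)
    rw [← hθ, hnorm t ht, hnormp, ENNReal.ofReal_rpow_of_nonneg (norm_nonneg _)
      (sub_nonneg.2 hθ1), ENNReal.ofReal_rpow_of_nonneg (by positivity) hθ0.le,
      ← ENNReal.ofReal_mul (by positivity)]
  refine ⟨fun t ht => ⟨Lp.aestronglyMeasurable _, (hle t ht).trans_lt ENNReal.ofReal_lt_top⟩,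
    fun t ht => ?_, Mu ^ (1 - θ) * Mv ^ θ, fun t ht => ?_⟩
  · set w : ℝ → Lp ℝ (ENNReal.ofReal s) (volume : Measure (Pt N k)) :=
      fun τ => τ ^ (-α) • v τ with hw
    have hwc : ContinuousAt w t :=
      (continuousAt_id.rpow_const (Or.inl ht.ne')).smul hv.continuousAt
    have huc : ContinuousAt u t := (hu t ht.le).continuousAt (Ici_mem_nhds ht)
    have h1 : Tendsto (fun τ => ENNReal.ofReal (‖u τ - u t‖ ^ (1 - θ) * ‖w τ - w t‖ ^ θ)) (𝓝 t)
        (𝓝 0) := by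
      -- The exponent 1 - θ may be 0, so this factor need not tend to zero; the factor with exponent
      -- θ > 0 forces the limit 0.
      have h2 := (tendsto_iff_norm_sub_tendsto_zero.1 huc.tendsto).rpow_const
        (p := 1 - θ) (Or.inr (sub_nonneg.2 hθ1))
      have h3 := (tendsto_iff_norm_sub_tendsto_zero.1 hwc.tendsto).rpow_const
        (p := θ) (Or.inr hθ0.le)
      have h4 := h2.mul h3
      rw [Real.zero_rpow hθ0.ne', mul_zero] at h4
      have h5 := (ENNReal.continuous_ofReal.tendsto 0).comp h4
      rw [ENNReal.ofReal_zero] at h5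
      exact h5
    refine tendsto_of_tendsto_of_tendsto_of_le_of_le' tendsto_const_nhds h1
      (Eventually.of_forall fun _ => zero_le) ?_
    filter_upwards [eventually_gt_nhds ht] with τ hτ
    have e1 : (fun a => u τ a - u t a) =ᵐ[volume] (u τ - u t :
        Lp ℝ (ENNReal.ofReal p) (volume : Measure (Pt N k))) := (Lp.coeFn_sub _ _).symm
    have e2 : (fun a => u τ a - u t a) =ᵐ[volume] (w τ - w t :
        Lp ℝ (ENNReal.ofReal s) (volume : Measure (Pt N k))) :=
      ((hus τ hτ).sub (hus t ht)).trans (Lp.coeFn_sub _ _).symm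
    refine (eLpNorm_le_interp hp hpr hrs
      ((Lp.aestronglyMeasurable (u τ)).sub (Lp.aestronglyMeasurable (u t)))).trans (le_of_eq ?_)
    rw [← hθ]
    change eLpNorm (fun a => u τ a - u t a) _ _ ^ _ * eLpNorm (fun a => u τ a - u t a) _ _ ^ _ = _
    rw [eLpNorm_congr_ae (p := ENNReal.ofReal s) e2, eLpNorm_congr_ae (p := ENNReal.ofReal p) e1,
      ← Lp.enorm_def, ← Lp.enorm_def,
      ← ofReal_norm, ← ofReal_norm,
      ENNReal.ofReal_rpow_of_nonneg (norm_nonneg _) (sub_nonneg.2 hθ1),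
      ENNReal.ofReal_rpow_of_nonneg (norm_nonneg _) hθ0.le, ← ENNReal.ofReal_mul (by positivity)]
  · have h1 := ENNReal.toReal_mono ENNReal.ofReal_ne_top (hle t ht)
    rw [ENNReal.toReal_ofReal (by positivity)] at h1
    rw [hαθ]
    have e : t ^ (α * θ) * (t ^ (-α)) ^ θ = 1 := by
      rw [← Real.rpow_mul ht.le, ← Real.rpow_add ht]
      ring_nf
      exact Real.rpow_zero t
    calc t ^ (α * θ) * (eLpNorm (u t) (ENNReal.ofReal r) volume).toReal
        ≤ t ^ (α * θ) * (‖u t‖ ^ (1 - θ) * (t ^ (-α) * ‖v t‖) ^ θ) := by gcongr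
      _ = ‖u t‖ ^ (1 - θ) * ‖v t‖ ^ θ := by
          rw [Real.mul_rpow (by positivity) (norm_nonneg _)]
          linear_combination (‖u t‖ ^ (1 - θ) * ‖v t‖ ^ θ) * e
      _ ≤ _ := by
          have h2 := hMu t ht.le
          have h3 := hMv t
          have := sub_nonneg.2 hθ1
          have := (norm_nonneg _).trans h2
          gcongr

end Weighted

end Grushin

/-! ### The Grushin equation. -/

theorem theorem4p2 (N k : ℕ) (hN : 1 ≤ N) (hk : 1 ≤ k) (ρ p r : ℝ) (hρ : 1 < ρ)
    (hp : p = ((N : ℝ) + 2 * k) / 2 * (ρ - 1)) (hp1 : 1 < p) (hpr : p < r) (hrp : r < ρ * p)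
    [Fact (1 ≤ ENNReal.ofReal p)] :
    ∃ δ : ℝ, 0 < δ ∧
      ∀ u₀ : Lp ℝ (ENNReal.ofReal p) (volume : Measure (Grushin.Pt N k)), ‖u₀‖ ≤ δ →
        ∃ u : ℝ → Lp ℝ (ENNReal.ofReal p) (volume : Measure (Grushin.Pt N k)),
          Grushin.IsGlobalMildSolution (ENNReal.ofReal p) ρ u₀ u ∧
          u ∈ Grushin.spaceX N k (ENNReal.ofReal p) (ENNReal.ofReal r)
              (((N : ℝ) + 2 * k) / 2 * (1 / p - 1 / r)) ∩
            Grushin.spaceE N k (ENNReal.ofReal p) := by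
  obtain ⟨C, H⟩ := Grushin.exists_isHeatKernel (N := N) (k := k) hN hk
  have hN' : (0 : ℝ) < N := by exact_mod_cast hN
  have hd : 0 < ((N : ℝ) + 2 * k) / 2 := by positivity
  -- The fixed point is taken at max(r, ρ), so that the nonlinearity lands in an exponent at least
  -- 1. It stays below ρp because p > 1.
  have hps : p < max r ρ := hpr.trans_le (le_max_left _ _)
  have hsp : max r ρ < ρ * p := max_lt hrp (by nlinarith)
  have : Fact (1 ≤ ENNReal.ofReal (max r ρ)) :=
    ⟨by simpa using Or.inr hρ.le⟩
  obtain ⟨δ, hδ, hsol⟩ := Grushin.exists_global_solution H hd hρ hp hp1 hps hsp (le_max_right _ _)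
  refine ⟨δ, hδ, fun u₀ hu₀ => ?_⟩
  obtain ⟨u, v, hu0, huc, hub, hvc, hvb, huv, hduh⟩ := hsol u₀ hu₀
  refine ⟨u, ⟨huc, fun t ht => ?_⟩,
    Grushin.mem_spaceX (by linarith) hpr (le_max_left _ _) huc hub hvc hvb huv, huc, hub⟩
  rcases ht.eq_or_lt with rfl | ht
  -- At t = 0 the time interval is empty and the semigroup is the identity.
  · refine ⟨u₀, fun _ => 0, ⟨fun h => absurd h (lt_irrefl _), ?_⟩, fun s hs => ?_, ?_, ?_⟩
    · rw [Grushin.semigroup, if_pos rfl]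
    · exact absurd (hs.1.trans hs.2) (lt_irrefl _)
    · simp
    · simpa using hu0
  · obtain ⟨G, F, hG, hF, hFi, hut⟩ := hduh t ht
    refine ⟨G, F, ⟨fun _ => Eventually.of_forall fun a => ?_, ?_⟩, fun s hs =>
      ⟨fun _ => Eventually.of_forall (hF s hs).1, ?_⟩, hFi, hut⟩
    · exact H.integrable ht hp1.le (Lp.memLp u₀) a
    · rw [Grushin.semigroup_eq_heatOp ht]
      exact hG
    · rw [Grushin.semigroup_eq_heatOp (sub_pos.2 hs.2)]
      exact (hF s hs).2
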